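/- Let $\mathbb K$ be a field of characteristic $0$, let $a,b\in\mathbb Z$, and let $(\mathcal A,\cdot,[\ ,\ ],d)$ be a differential graded $(a,b)$-algebra over $\mathbb K$: a $\mathbb Z$-graded vector space $\mathcal A=\bigoplus_i\mathcal A_i$ with a product of degree $a$, a bracket of degree $b$ and a differential $d$ of degree $1$, $d^2=0$, such that for homogeneous elements $\alpha\cdot\beta=(-1)^{(|\alpha|+a)(|\beta|+a)}\beta\cdot\alpha$, $\ \alpha\cdot(\beta\cdot\gamma)=(\alpha\cdot\beta)\cdot\gamma$, $\ [\alpha,\beta]=-(-1)^{(|\alpha|+b)(|\beta|+b)}[\beta,\alpha]$, $(-1)^{(|\alpha|+b)(|\gamma|+b)}[[\alpha,\beta],\gamma]+(-1)^{(|\beta|+b)(|\alpha|+b)}[[\beta,\gamma],\alpha]+(-1)^{(|\gamma|+b)(|\beta|+b)}[[\gamma,\alpha],\beta]=0$, $[\alpha,\beta\cdot\gamma]=[\alpha,\beta]\cdot\gamma+(-1)^{(|\beta|+a)(|\alpha|+b)}\beta\cdot[\alpha,\gamma]$, $\ d(\alpha\cdot\beta)=d\alpha\cdot\beta+(-1)^{|\alpha|+a}\alpha\cdot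 d\beta$, $\ d[\alpha,\beta]=[d\alpha,\beta]+(-1)^{|\alpha|+b}[\alpha,d\beta]$. Let $V=\mathcal A[-a+1]$, i.e. $\mathcal A$ with the degree $dg(\alpha)=|\alpha|+a-1$ (written simply $\alpha$ in exponents), and let $\ell(\alpha,\beta)=(-1)^{(b-a+1)\alpha}[\alpha,\beta]$ on $V$. Let $Bat(p,q)$ be the set of $\sigma\in S_{p+q}$ with $\sigma(1)<\dots<\sigma(p)$ and $\sigma(p+1)<\dots<\sigma(p+q)$, let $\varepsilon_\alpha(\sigma^{-1})$ be the signature of the restriction of $\sigma^{-1}$ to the indices of the letters $\alpha_i$ of odd degree, and let $$bat_{p,q}(\alpha_1\otimes\dots\otimes\alpha_p,\alpha_{p+1}\otimes\dots\otimes\alpha_{p+q})=\sum_{\sigma\in Bat(p,q)}\varepsilon_\alpha(\sigma^{-1})\,\alpha_{\sigma^{-1}(1)}\otimes\dots\otimes\alpha_{\sigma^{-1}(p+q)}.$$ Let $\mathcal H=\bigoplus_{n\ge1}\Big(V^{\otimes n}\big/\sum_{p+q=n,\ p,q\ge1}\mathrm{Im}(bat_{p,q})\Big)$, write $\alpha_1\underline\otimes\dots\underline\otimes\alpha_n$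 for the class of $\alpha_1\otimes\dots\otimes\alpha_n$, and give it the degree $\alpha_1+\dots+\alpha_n$; the degree of $X\in\mathcal H$ is denoted $x$. Let $\tau(X\otimes Y)=(-1)^{xy}Y\otimes X$ on $\mathcal H\otimes\mathcal H$, $\tau_{12}=\tau\otimes id$, $\tau_{23}=id\otimes\tau$, and let $\delta:\mathcal H\to\mathcal H\otimes\mathcal H$ be the (well defined) cobracket $$\delta(X)=\sum_{U\underline\otimes W=X,\ U,W\ne\emptyset}U\otimes W-(-1)^{wu}W\otimes U ,$$ the sum being over the cuts of the word $X=\alpha_1\underline\otimes\dots\underline\otimes\alpha_n$ into two non-empty words. Let $\mathrm{pr}:\mathcal H\to V$ be the projection onto the summand $n=1$. Then there is exactly one bilinear map ("bracket") $\ell_2$ on $\mathcal H$, homogeneous of degree $b-a+1$, which extends $\ell$ in the sense that $\mathrm{pr}\circ\ell_2=\ell\circ(\mathrm{pr}\otimes\mathrm{pr})$, and which satisfies $$\delta\circ\ell_2=(\ell_2\otimes id)\circ\big(\tau_{23}\circ(\delta\otimes id)+id\otimes\delta\big)+(id\otimes\ell_2)\circ\big(\delta\otimes id+\tau_{12}\circ(id\otimes\delta)\big),\qquad(\ast)$$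 where $(id\otimes\ell_2)(X\otimes Y\otimes Z)=(-1)^{(b-a+1)x}X\otimes\ell_2(Y,Z)$. It is given, for all $p,q\ge1$ and homogeneous $\alpha_1,\dots,\alpha_{p+q}$, with $X=\alpha_1\underline\otimes\dots\underline\otimes\alpha_p$ and $Y=\alpha_{p+1}\underline\otimes\dots\underline\otimes\alpha_{p+q}$, by $$\ell_2(X,Y)=\sum_{\substack{\sigma\in Bat(p,q),\ k\\ \sigma^{-1}(k)\le p<\sigma^{-1}(k+1)}}\varepsilon_\alpha(\sigma^{-1})\,(-1)^{(b-a+1)\sum_{s<k}\alpha_{\sigma^{-1}(s)}}\ \alpha_{\sigma^{-1}(1)}\underline\otimes\dots\underline\otimes\ell(\alpha_{\sigma^{-1}(k)},\alpha_{\sigma^{-1}(k+1)})\underline\otimes\dots\underline\otimes\alpha_{\sigma^{-1}(p+q)}.$$ -/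

import Mathlib

open scoped TensorProduct DirectSum

namespace ABAlgebra

/-! ### Graded vector spaces -/

section Graded

variable {𝕜 V : Type*} [Field 𝕜] [AddCommGroup V] [Module 𝕜 V]

/-- The shifted grading `V[k]` of a graded vector space `V`: `V[k]_i = V_{i+k}`. -/
def shift (𝒱 : ℤ → Submodule 𝕜 V) (k : ℤ) : ℤ → Submodule 𝕜 V := fun i => 𝒱 (i + k)

noncomputable instance (𝒱 : ℤ → Submodule 𝕜 V) [DirectSum.Decomposition 𝒱] (k : ℤ) :
    DirectSum.Decomposition (shift 𝒱 k) :=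
  DirectSum.IsInternal.chooseDecomposition _ <| by
    have h := DirectSum.Decomposition.isInternal 𝒱
    rw [DirectSum.isInternal_submodule_iff_iSupIndep_and_iSup_eq_top] at h ⊢
    exact ⟨h.1.comp (add_left_injective k),
      ((Equiv.addRight k).iSup_comp (g := 𝒱)).trans h.2⟩

/-- The linear map of `V` equal to `v ↦ (-1)^{c·i} v` on the component of degree `i`. -/
noncomputable def signTwist (𝒱 : ℤ → Submodule 𝕜 V) [DirectSum.Decomposition 𝒱] (c : ℤ) :
    V →ₗ[𝕜] V :=
  DirectSum.toModule 𝕜 ℤ V (fun i => (c * i).negOnePow • (𝒱 i).subtype) ∘ₗ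
    (DirectSum.decomposeLinearEquiv 𝒱).toLinearMap

theorem signTwist_of_mem (𝒱 : ℤ → Submodule 𝕜 V) [DirectSum.Decomposition 𝒱] (c : ℤ)
    {i : ℤ} {v : V} (hv : v ∈ 𝒱 i) : signTwist 𝒱 c v = (c * i).negOnePow • v := by
  rw [signTwist, LinearMap.comp_apply, LinearEquiv.coe_coe, DirectSum.decomposeLinearEquiv_apply,
    DirectSum.decompose_of_mem 𝒱 hv, ← DirectSum.lof_eq_of 𝕜, DirectSum.toModule_lof]
  rfl

end Graded

/-! ### Differential `(a,b)`-algebras -/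

/-- A differential graded `(a,b)`-algebra structure on the graded vector space `A = ⨁ 𝒜 i`:
a product of degree `a`, a bracket of degree `b` and a differential of degree `1`. -/
structure DiffABAlgebra {𝕜 A : Type*} [Field 𝕜] [AddCommGroup A] [Module 𝕜 A]
    (𝒜 : ℤ → Submodule 𝕜 A) (a b : ℤ) where
  /-- the product `α · β` -/
  mul : A →ₗ[𝕜] A →ₗ[𝕜] A
  /-- the bracket `[α, β]` -/
  bracket : A →ₗ[𝕜] A →ₗ[𝕜] A
  /-- the differential -/
  d : A →ₗ[𝕜] A
  mul_mem : ∀ {i j : ℤ} {α β : A}, α ∈ 𝒜 i → β ∈ 𝒜 j → mul α β ∈ 𝒜 (i + j + a)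
  bracket_mem : ∀ {i j : ℤ} {α β : A}, α ∈ 𝒜 i → β ∈ 𝒜 j → bracket α β ∈ 𝒜 (i + j + b)
  d_mem : ∀ {i : ℤ} {α : A}, α ∈ 𝒜 i → d α ∈ 𝒜 (i + 1)
  mul_comm : ∀ {i j : ℤ} {α β : A}, α ∈ 𝒜 i → β ∈ 𝒜 j →
    mul α β = ((i + a) * (j + a)).negOnePow • mul β α
  mul_assoc : ∀ α β γ : A, mul α (mul β γ) = mul (mul α β) γ
  bracket_antisymm : ∀ {i j : ℤ} {α β : A}, α ∈ 𝒜 i → β ∈ 𝒜 j →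
    bracket α β = -(((i + b) * (j + b)).negOnePow • bracket β α)
  jacobi : ∀ {i j k : ℤ} {α β γ : A}, α ∈ 𝒜 i → β ∈ 𝒜 j → γ ∈ 𝒜 k →
    ((i + b) * (k + b)).negOnePow • bracket (bracket α β) γ
      + ((j + b) * (i + b)).negOnePow • bracket (bracket β γ) α
      + ((k + b) * (j + b)).negOnePow • bracket (bracket γ α) β = 0
  leibniz : ∀ {i j : ℤ} {α β : A} (γ : A), α ∈ 𝒜 i → β ∈ 𝒜 j →
    bracket α (mul β γ)
      = mul (bracket α β) γ + ((j + a) * (i + b)).negOnePow • mul β (bracket α γ)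
  d_d : ∀ α : A, d (d α) = 0
  d_mul : ∀ {i : ℤ} {α : A} (β : A), α ∈ 𝒜 i →
    d (mul α β) = mul (d α) β + (i + a).negOnePow • mul α (d β)
  d_bracket : ∀ {i : ℤ} {α : A} (β : A), α ∈ 𝒜 i →
    d (bracket α β) = bracket (d α) β + (i + b).negOnePow • bracket α (d β)

/-- The grading `A[-a+1]` of `A`, that is `dg(α) = |α| + a - 1`. -/
abbrev shifted {𝕜 A : Type*} [Field 𝕜] [AddCommGroup A] [Module 𝕜 A]
    (𝒜 : ℤ → Submodule 𝕜 A) (a : ℤ) : ℤ → Submodule 𝕜 A := shift 𝒜 (-a + 1)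

/-- The shifted bracket `ℓ(α, β) = (-1)^{(b-a+1)·dg(α)} [α, β]` on `A[-a+1]`. -/
noncomputable def DiffABAlgebra.shiftedBracket {𝕜 A : Type*} [Field 𝕜] [AddCommGroup A]
    [Module 𝕜 A] {𝒜 : ℤ → Submodule 𝕜 A} [DirectSum.Decomposition 𝒜] {a b : ℤ}
    (S : DiffABAlgebra 𝒜 a b) : A →ₗ[𝕜] A →ₗ[𝕜] A :=
  S.bracket ∘ₗ signTwist (shifted 𝒜 a) (b - a + 1)

/-! ### Shuffles -/

/-- The Koszul sign `ε_α(σ⁻¹)` of the rearrangement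
`α_1, …, α_n ↦ α_{σ⁻¹(1)}, …, α_{σ⁻¹(n)}` of vectors of degrees `d`: the signature of the
permutation restricted to the letters of odd degree (each inversion of two odd letters
contributes `-1`). -/
def koszulSign {n : ℕ} (d : Fin n → ℤ) (σ : Equiv.Perm (Fin n)) : ℤˣ :=
  ∏ i, ∏ j, if i < j ∧ σ j < σ i then (d i * d j).negOnePow else 1

/-- The set `Bat(p, n-p)` of the `(p, n-p)`-shuffles: the permutations `σ` of `n` letters with
`σ(1) < … < σ(p)` and `σ(p+1) < … < σ(n)`. -/
def battements (n p : ℕ) : Finset (Equiv.Perm (Fin n)) :=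
  Finset.univ.filter fun σ =>
    StrictMonoOn σ {i | i.val < p} ∧ StrictMonoOn σ {i | p ≤ i.val}

/-! Combinatorial facts on shuffles, used to see that the cobracket is well defined. -/

theorem prod_pairs_comp {n : ℕ} (σ : Equiv.Perm (Fin n)) (g : Fin n → Fin n → ℤˣ)
    (hg : ∀ i j, g i j = g j i) :
    (∏ i, ∏ j, if i < j then g (σ i) (σ j) else 1) = ∏ i, ∏ j, if i < j then g i j else 1 := by
  have h1 : (∏ i, ∏ j, if i < j then g (σ i) (σ j) else 1)
      = ∏ i, ∏ j, if σ.symm i < σ.symm j then g i j else 1 := by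
    rw [← Equiv.prod_comp σ (fun i => ∏ j, if σ.symm i < σ.symm j then g i j else 1)]
    refine Finset.prod_congr rfl fun i _ => ?_
    rw [← Equiv.prod_comp σ (fun j => if σ.symm (σ i) < σ.symm j then g (σ i) j else 1)]
    simp
  have e1 : ∀ i j, (if σ.symm i < σ.symm j then g i j else 1)
      = (if σ.symm i < σ.symm j ∧ i < j then g i j else 1)
        * (if σ.symm i < σ.symm j ∧ j < i then g i j else 1) := by
    intro i j
    rcases lt_trichotomy i j with h | h | h
    · simp [h, h.asymm]
    · simp [h]
    · simp [h, h.asymm]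
  have e2 : ∀ i j, (if i < j then g i j else 1)
      = (if σ.symm i < σ.symm j ∧ i < j then g i j else 1)
        * (if σ.symm j < σ.symm i ∧ i < j then g i j else 1) := by
    intro i j
    rcases lt_trichotomy (σ.symm i) (σ.symm j) with h | h | h
    · simp [h, h.asymm]
    · have : i = j := σ.symm.injective h
      simp [this]
    · simp [h, h.asymm]
  rw [h1]
  simp_rw [e1, e2, Finset.prod_mul_distrib]
  congr 1
  rw [Finset.prod_comm]
  simp_rw [hg]

theorem koszulSign_mul {n : ℕ} (d : Fin n → ℤ) (ρ σ : Equiv.Perm (Fin n)) :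
    koszulSign d (ρ * σ) = koszulSign d σ * koszulSign (fun i => d (σ.symm i)) ρ := by
  set g : Fin n → Fin n → ℤˣ := fun x y =>
    if (x < y ∧ ρ y < ρ x) ∨ (y < x ∧ ρ x < ρ y) then
      (d (σ.symm x) * d (σ.symm y)).negOnePow else 1 with hgdef
  have hg : ∀ x y, g x y = g y x := by
    intro x y
    simp only [hgdef, mul_comm (d (σ.symm x)), or_comm]
  have h2 : koszulSign (fun i => d (σ.symm i)) ρ = ∏ i, ∏ j, if i < j then g i j else 1 := by
    unfold koszulSign
    refine Finset.prod_congr rfl fun i _ => Finset.prod_congr rfl fun j _ => ?_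
    by_cases h : i < j
    · simp [hgdef, h, h.asymm]
    · simp [h]
  rw [h2, ← prod_pairs_comp σ g hg, koszulSign, koszulSign, ← Finset.prod_mul_distrib]
  refine Finset.prod_congr rfl fun i _ => ?_
  rw [← Finset.prod_mul_distrib]
  refine Finset.prod_congr rfl fun j _ => ?_
  by_cases h : i < j
  · have hne : σ i ≠ σ j := fun e => h.ne (σ.injective e)
    have hne' : ρ (σ i) ≠ ρ (σ j) := fun e => hne (ρ.injective e)
    simp only [hgdef, Equiv.Perm.mul_apply, h, true_and, Equiv.symm_apply_apply, if_true]
    rcases lt_or_gt_of_ne hne with h3 | h3 <;> rcases lt_or_gt_of_ne hne' with h4 | h4 <;>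
      simp [h3, h4, h3.asymm, h4.asymm]
  · simp [h]

/-- block permutation -/
def block {j m : ℕ} (ρ₁ : Equiv.Perm (Fin j)) (ρ₂ : Equiv.Perm (Fin m)) :
    Equiv.Perm (Fin (j + m)) :=
  finSumFinEquiv.permCongr (Equiv.sumCongr ρ₁ ρ₂)

theorem block_castAdd {j m : ℕ} (ρ₁ : Equiv.Perm (Fin j)) (ρ₂ : Equiv.Perm (Fin m)) (x : Fin j) :
    block ρ₁ ρ₂ (Fin.castAdd m x) = Fin.castAdd m (ρ₁ x) := by
  simp [block, Equiv.permCongr_apply]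

theorem block_natAdd {j m : ℕ} (ρ₁ : Equiv.Perm (Fin j)) (ρ₂ : Equiv.Perm (Fin m)) (x : Fin m) :
    block ρ₁ ρ₂ (Fin.natAdd j x) = Fin.natAdd j (ρ₂ x) := by
  simp [block, Equiv.permCongr_apply]

theorem block_symm {j m : ℕ} (ρ₁ : Equiv.Perm (Fin j)) (ρ₂ : Equiv.Perm (Fin m)) :
    (block ρ₁ ρ₂).symm = block ρ₁.symm ρ₂.symm := by
  rfl

theorem koszulSign_block {j m : ℕ} (d : Fin (j + m) → ℤ) (ρ₁ : Equiv.Perm (Fin j))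
    (ρ₂ : Equiv.Perm (Fin m)) :
    koszulSign d (block ρ₁ ρ₂) = koszulSign (fun x => d (Fin.castAdd m x)) ρ₁
      * koszulSign (fun y => d (Fin.natAdd j y)) ρ₂ := by
  have a1 : ∀ (x : Fin j) (y : Fin m), ¬ (Fin.natAdd j y < Fin.castAdd m x) := by
    intro x y; rw [Fin.lt_def]; simp; omega
  simp only [koszulSign, Fin.prod_univ_add, block_castAdd, block_natAdd]
  have l11 : ∀ (x x' : Fin j), Fin.castAdd m x < Fin.castAdd m x' ↔ x < x' := fun _ _ => Iff.rfl
  simp [a1, l11]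

/-- The number of letters `< p` -/
def lowCount {j n : ℕ} (p : ℕ) (s : Fin j → Fin n) : ℕ :=
  (Finset.univ.filter fun x => (s x).val < p).card

theorem lt_lowCount {j n : ℕ} (p : ℕ) {s : Fin j → Fin n} (hs : StrictMono s) (x : Fin j) :
    x.val < lowCount p s ↔ (s x).val < p := by
  constructor
  · intro h
    by_contra hx
    have : (Finset.univ.filter fun x => (s x).val < p) ⊆ Finset.Iio x := by
      intro y hy
      simp only [Finset.mem_filter, Finset.mem_univ, true_and, Finset.mem_Iio] at hy ⊢
      by_contra hxy
      have := hs.monotone (not_lt.1 hxy)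
      rw [Fin.le_def] at this
      omega
    have := Finset.card_le_card this
    rw [Fin.card_Iio] at this
    unfold lowCount at h
    omega
  · intro h
    have : Finset.Iic x ⊆ (Finset.univ.filter fun x => (s x).val < p) := by
      intro y hy
      simp only [Finset.mem_filter, Finset.mem_univ, true_and, Finset.mem_Iic] at hy ⊢
      have := hs.monotone hy
      rw [Fin.le_def] at this
      omega
    have := Finset.card_le_card this
    rw [Fin.card_Iic] at this
    unfold lowCount
    omega

theorem mem_battements {n p : ℕ} {σ : Equiv.Perm (Fin n)} :
    σ ∈ battements n p ↔
      (∀ i i' : Fin n, i < i' → i'.val < p → σ i < σ i') ∧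
      (∀ i i' : Fin n, i < i' → p ≤ i.val → σ i < σ i') := by
  rw [battements, Finset.mem_filter]
  simp only [Finset.mem_univ, true_and, StrictMonoOn, Set.mem_ofPred_eq]
  constructor
  · rintro ⟨h1, h2⟩
    refine ⟨fun i i' h h' => h1 ?_ h' h, fun i i' h h' => h2 h' ?_ h⟩
    · rw [Fin.lt_def] at h; omega
    · rw [Fin.lt_def] at h; omega
  · rintro ⟨h1, h2⟩
    exact ⟨fun i _ i' h' h => h1 i i' h h', fun i h' i' _ h => h2 i i' h h'⟩

section
variable {j m : ℕ}

/-- both halves of the word of `σ` are increasing -/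
def Sorted (j m : ℕ) (σ : Equiv.Perm (Fin (j + m))) : Prop :=
  StrictMono (fun x : Fin j => σ.symm (Fin.castAdd m x)) ∧
    StrictMono (fun y : Fin m => σ.symm (Fin.natAdd j y))

theorem mem_of_block_mul {p : ℕ} {σ : Equiv.Perm (Fin (j + m))} (hs : Sorted j m σ)
    (ρ₁ : Equiv.Perm (Fin j)) (ρ₂ : Equiv.Perm (Fin m)) :
    block ρ₁ ρ₂ * σ ∈ battements (j + m) p ↔
      σ ∈ battements (j + m) p ∧
      ρ₁ ∈ battements j (lowCount p fun x : Fin j => σ.symm (Fin.castAdd m x)) ∧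
      ρ₂ ∈ battements m (lowCount p fun y : Fin m => σ.symm (Fin.natAdd j y)) := by
  have c1 := lt_lowCount p hs.1
  have c2 := lt_lowCount p hs.2
  have l12 : ∀ (x : Fin j) (y : Fin m), Fin.castAdd m x < Fin.natAdd j y := by
    intro x y; rw [Fin.lt_def]; simp; omega
  have l11 : ∀ (x x' : Fin j), Fin.castAdd m x < Fin.castAdd m x' ↔ x < x' := by
    exact fun _ _ => Iff.rfl
  have l22 : ∀ (x x' : Fin m), Fin.natAdd j x < Fin.natAdd j x' ↔ x < x' := by
    intro x y; rw [Fin.lt_def, Fin.lt_def]; simp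
  -- a general comparison
  have key : ∀ i i' : Fin (j + m), i < i' →
      ((block ρ₁ ρ₂ * σ) i < (block ρ₁ ρ₂ * σ) i' → σ i < σ i') := by
    intro i i' h
    obtain ⟨k, rfl⟩ := σ.symm.surjective i
    obtain ⟨k', rfl⟩ := σ.symm.surjective i'
    simp only [Equiv.Perm.mul_apply, Equiv.apply_symm_apply]
    revert h
    refine Fin.addCases (fun x => ?_) (fun y => ?_) k <;>
    refine Fin.addCases (fun x' => ?_) (fun y' => ?_) k'
    · intro h _
      rw [l11]; exact hs.1.lt_iff_lt.1 h
    · intro h _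
      exact l12 _ _
    · intro h
      rw [block_castAdd, block_natAdd]
      intro h'
      exact absurd h' (l12 _ _).asymm
    · intro h _
      rw [l22]; exact hs.2.lt_iff_lt.1 h
  constructor
  · intro h
    rw [mem_battements] at h
    refine ⟨mem_battements.2 ⟨fun i i' a b => key i i' a (h.1 i i' a b),
      fun i i' a b => key i i' a (h.2 i i' a b)⟩, mem_battements.2 ⟨?_, ?_⟩,
      mem_battements.2 ⟨?_, ?_⟩⟩
    · intro x x' hx hx'
      have := h.1 _ _ (hs.1 hx) ((c1 x').1 hx')
      simpa [block_castAdd, l11] using this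
    · intro x x' hx hx'
      have := h.2 _ _ (hs.1 hx) (not_lt.1 fun h0 => (not_lt.2 hx') ((c1 x).2 h0))
      simpa [block_castAdd, l11] using this
    · intro x x' hx hx'
      have := h.1 _ _ (hs.2 hx) ((c2 x').1 hx')
      simpa [block_natAdd, l22] using this
    · intro x x' hx hx'
      have := h.2 _ _ (hs.2 hx) (not_lt.1 fun h0 => (not_lt.2 hx') ((c2 x).2 h0))
      simpa [block_natAdd, l22] using this
  · rintro ⟨h, h1, h2⟩
    rw [mem_battements] at h h1 h2 ⊢
    constructor
    · intro i i' hi hi'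
      have h3 := h.1 i i' hi hi'
      obtain ⟨k, rfl⟩ := σ.symm.surjective i
      obtain ⟨k', rfl⟩ := σ.symm.surjective i'
      simp only [Equiv.Perm.mul_apply, Equiv.apply_symm_apply] at h3 ⊢
      revert hi hi' h3
      refine Fin.addCases (fun x => ?_) (fun y => ?_) k <;>
      refine Fin.addCases (fun x' => ?_) (fun y' => ?_) k' <;> intro hi' hi h3
      · rw [block_castAdd, block_castAdd, l11]
        exact h1.1 _ _ ((l11 _ _).1 h3) ((c1 _).2 hi')
      · rw [block_castAdd, block_natAdd]; exact l12 _ _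
      · exact absurd h3 (l12 _ _).asymm
      · rw [block_natAdd, block_natAdd, l22]
        exact h2.1 _ _ ((l22 _ _).1 h3) ((c2 _).2 hi')
    · intro i i' hi hi'
      have h3 := h.2 i i' hi hi'
      obtain ⟨k, rfl⟩ := σ.symm.surjective i
      obtain ⟨k', rfl⟩ := σ.symm.surjective i'
      simp only [Equiv.Perm.mul_apply, Equiv.apply_symm_apply] at h3 ⊢
      revert hi hi' h3
      refine Fin.addCases (fun x => ?_) (fun y => ?_) k <;>
      refine Fin.addCases (fun x' => ?_) (fun y' => ?_) k' <;> intro hi' hi h3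
      · rw [block_castAdd, block_castAdd, l11]
        exact h1.2 _ _ ((l11 _ _).1 h3) (not_lt.1 fun h0 => not_lt.2 hi' ((c1 _).1 h0))
      · rw [block_castAdd, block_natAdd]; exact l12 _ _
      · exact absurd h3 (l12 _ _).asymm
      · rw [block_natAdd, block_natAdd, l22]
        exact h2.2 _ _ ((l22 _ _).1 h3) (not_lt.1 fun h0 => not_lt.2 hi' ((c2 _).1 h0))

theorem exists_block_sorted (σ : Equiv.Perm (Fin (j + m))) :
    ∃ (ρ₁ : Equiv.Perm (Fin j)) (ρ₂ : Equiv.Perm (Fin m)) (σ₀ : Equiv.Perm (Fin (j + m))),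
      Sorted j m σ₀ ∧ σ = block ρ₁ ρ₂ * σ₀ := by
  set f₁ : Fin j → Fin (j + m) := fun x => σ.symm (Fin.castAdd m x)
  set f₂ : Fin m → Fin (j + m) := fun x => σ.symm (Fin.natAdd j x)
  have i1 : Function.Injective f₁ := σ.symm.injective.comp (Fin.castAdd_injective _ _)
  have i2 : Function.Injective f₂ := σ.symm.injective.comp (Fin.natAdd_injective _ _)
  refine ⟨Tuple.sort f₁, Tuple.sort f₂, (block (Tuple.sort f₁) (Tuple.sort f₂)).symm * σ,
    ⟨?_, ?_⟩, ?_⟩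
  · have := (Tuple.monotone_sort f₁).strictMono_of_injective (i1.comp (Equiv.injective _))
    intro x x' h
    have := this h
    simpa [Equiv.Perm.mul_def, block_castAdd, f₁] using this
  · have := (Tuple.monotone_sort f₂).strictMono_of_injective (i2.comp (Equiv.injective _))
    intro x x' h
    have := this h
    simpa [Equiv.Perm.mul_def, block_natAdd, f₂] using this
  · ext x; simp

theorem block_sorted_inj {ρ₁ ρ₁' : Equiv.Perm (Fin j)} {ρ₂ ρ₂' : Equiv.Perm (Fin m)}
    {σ σ' : Equiv.Perm (Fin (j + m))} (hs : Sorted j m σ) (hs' : Sorted j m σ')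
    (h : block ρ₁ ρ₂ * σ = block ρ₁' ρ₂' * σ') : σ = σ' ∧ ρ₁ = ρ₁' ∧ ρ₂ = ρ₂' := by
  have hsy : ∀ k, σ.symm ((block ρ₁ ρ₂).symm k) = σ'.symm ((block ρ₁' ρ₂').symm k) := by
    intro k
    have := congrArg (fun e : Equiv.Perm (Fin (j + m)) => e.symm k) h
    simpa [Equiv.Perm.mul_def] using this
  have e1 : (fun x : Fin j => σ.symm (Fin.castAdd m x)) = fun x => σ'.symm (Fin.castAdd m x) := by
    refine (hs.1.range_inj hs'.1).1 ?_
    ext z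
    constructor
    · rintro ⟨x, rfl⟩
      refine ⟨ρ₁'.symm (ρ₁ x), ?_⟩
      have := hsy (Fin.castAdd m (ρ₁ x))
      simp only [block_symm, block_castAdd, Equiv.symm_apply_apply] at this
      exact this.symm
    · rintro ⟨x, rfl⟩
      refine ⟨ρ₁.symm (ρ₁' x), ?_⟩
      have := hsy (Fin.castAdd m (ρ₁' x))
      simp only [block_symm, block_castAdd, Equiv.symm_apply_apply] at this
      exact this
  have e2 : (fun x : Fin m => σ.symm (Fin.natAdd j x)) = fun x => σ'.symm (Fin.natAdd j x) := by
    refine (hs.2.range_inj hs'.2).1 ?_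
    ext z
    constructor
    · rintro ⟨x, rfl⟩
      refine ⟨ρ₂'.symm (ρ₂ x), ?_⟩
      have := hsy (Fin.natAdd j (ρ₂ x))
      simp only [block_symm, block_natAdd, Equiv.symm_apply_apply] at this
      exact this.symm
    · rintro ⟨x, rfl⟩
      refine ⟨ρ₂.symm (ρ₂' x), ?_⟩
      have := hsy (Fin.natAdd j (ρ₂' x))
      simp only [block_symm, block_natAdd, Equiv.symm_apply_apply] at this
      exact this
  have hσ : σ = σ' := by
    apply Equiv.symm_bijective.injective
    ext k : 1
    induction k using Fin.addCases with
    | left x => exact congrFun e1 x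
    | right y => exact congrFun e2 y
  subst hσ
  have hb := mul_right_cancel h
  refine ⟨rfl, ?_, ?_⟩
  · ext x : 1
    have := congrArg (fun e : Equiv.Perm (Fin (j + m)) => e (Fin.castAdd m x)) hb
    simpa [block_castAdd] using this
  · ext x : 1
    have := congrArg (fun e : Equiv.Perm (Fin (j + m)) => e (Fin.natAdd j x)) hb
    simpa [block_natAdd] using this

open Classical in
theorem sum_battements {W : Type*} [AddCommMonoid W] (p : ℕ)
    (F : Equiv.Perm (Fin (j + m)) → W) :
    ∑ σ ∈ battements (j + m) p, F σ =
      ∑ σ ∈ (battements (j + m) p).filter (Sorted j m),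
        ∑ ρ₁ ∈ battements j (lowCount p fun x : Fin j => σ.symm (Fin.castAdd m x)),
          ∑ ρ₂ ∈ battements m (lowCount p fun y : Fin m => σ.symm (Fin.natAdd j y)),
            F (block ρ₁ ρ₂ * σ) := by
  simp_rw [← Finset.sum_product']
  rw [Finset.sum_sigma']
  symm
  refine Finset.sum_bij (fun x _ => block x.2.1 x.2.2 * x.1) ?_ ?_ ?_ ?_
  · rintro ⟨σ, ρ₁, ρ₂⟩ h
    simp only [Finset.mem_sigma, Finset.mem_filter, Finset.mem_product] at h ⊢
    exact (mem_of_block_mul h.1.2 _ _).2 ⟨h.1.1, h.2⟩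
  · rintro ⟨σ, ρ₁, ρ₂⟩ h ⟨σ', ρ₁', ρ₂'⟩ h' e
    simp only [Finset.mem_sigma, Finset.mem_filter, Finset.mem_product] at h h'
    obtain ⟨rfl, rfl, rfl⟩ := block_sorted_inj h.1.2 h'.1.2 e
    rfl
  · intro σ h
    obtain ⟨ρ₁, ρ₂, σ₀, hs, rfl⟩ := exists_block_sorted σ
    have := (mem_of_block_mul hs _ _).1 h
    refine ⟨⟨σ₀, ρ₁, ρ₂⟩, ?_, rfl⟩
    simp only [Finset.mem_sigma, Finset.mem_filter, Finset.mem_product]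
    exact ⟨⟨this.1, hs⟩, this.2⟩
  · intros; rfl

end

/-! ### The space `⨂̲⁺ V` -/

section Packets

variable {𝕜 V : Type*} [Field 𝕜] [AddCommGroup V] [Module 𝕜 V]

/-- The shuffle product `bat_{p,n-p}(v_1 ⊗ … ⊗ v_p, v_{p+1} ⊗ … ⊗ v_n)` of homogeneous vectors
`v_i` of degrees `d i`. -/
noncomputable def bat {n : ℕ} (p : ℕ) (d : Fin n → ℤ) (v : Fin n → V) : ⨂[𝕜]^n V :=
  ∑ σ ∈ battements n p, ((koszulSign d σ : ℤ) : 𝕜) • PiTensorProduct.tprod 𝕜 fun i => v (σ.symm i)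

variable (𝒱 : ℤ → Submodule 𝕜 V)

/-- The sum of the images of all `bat_{p,q}` with `p + q = n` and `p, q ≥ 1`; since homogeneous
tensors span the tensor power, each image is the span of the shuffle products of homogeneous
vectors. -/
def batImage (n : ℕ) : Submodule 𝕜 (⨂[𝕜]^n V) :=
  ⨆ p ∈ Finset.Ioo 0 n,
    Submodule.span 𝕜 {t | ∃ (d : Fin n → ℤ) (v : Fin n → V), (∀ i, v i ∈ 𝒱 (d i)) ∧ t = bat p d v}

/-- `⨂̲ⁿ V = (⨂ⁿ V) / ∑_{p+q=n} Im bat_{p,q}`. -/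
def PacketPower (n : ℕ) : Type _ := (⨂[𝕜]^n V) ⧸ batImage 𝒱 n

noncomputable instance (n : ℕ) : AddCommGroup (PacketPower 𝒱 n) :=
  inferInstanceAs (AddCommGroup ((⨂[𝕜]^n V) ⧸ batImage 𝒱 n))

noncomputable instance (n : ℕ) : Module 𝕜 (PacketPower 𝒱 n) :=
  inferInstanceAs (Module 𝕜 ((⨂[𝕜]^n V) ⧸ batImage 𝒱 n))

/-- The quotient map `⨂ⁿ V → ⨂̲ⁿ V`. -/
noncomputable def PacketPower.mk (n : ℕ) : (⨂[𝕜]^n V) →ₗ[𝕜] PacketPower 𝒱 n :=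
  (batImage 𝒱 n).mkQ

/-- A linear map on `⨂ⁿ V` vanishing on the images of the `bat_{p,q}` factors through `⨂̲ⁿ V`. -/
noncomputable def PacketPower.lift {W : Type*} [AddCommGroup W] [Module 𝕜 W] (n : ℕ)
    (f : (⨂[𝕜]^n V) →ₗ[𝕜] W) (hf : batImage 𝒱 n ≤ LinearMap.ker f) :
    PacketPower 𝒱 n →ₗ[𝕜] W :=
  (batImage 𝒱 n).liftQ f hf

theorem PacketPower.lift_mk {W : Type*} [AddCommGroup W] [Module 𝕜 W] (n : ℕ)
    (f : (⨂[𝕜]^n V) →ₗ[𝕜] W) (hf : batImage 𝒱 n ≤ LinearMap.ker f) (t : ⨂[𝕜]^n V) :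
    PacketPower.lift 𝒱 n f hf (PacketPower.mk 𝒱 n t) = f t := rfl

theorem PacketPower.mk_eq_zero {n : ℕ} {t : ⨂[𝕜]^n V} :
    PacketPower.mk 𝒱 n t = 0 ↔ t ∈ batImage 𝒱 n :=
  Submodule.Quotient.mk_eq_zero _

/-- `⨂̲⁺ V = ⨁_{n ≥ 1} ⨂̲ⁿ V`; the summand of index `n : ℕ` is `⨂̲ⁿ⁺¹ V`. -/
abbrev Packets : Type _ := ⨁ n : ℕ, PacketPower 𝒱 (n + 1)

/-- The class in `⨂̲⁺ V` of a tensor of length `n` (it is `0` for `n = 0`, as `⨂̲⁺ V` starts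
with `n = 1`). -/
noncomputable def cls : (n : ℕ) → (⨂[𝕜]^n V) →ₗ[𝕜] Packets 𝒱
  | 0 => 0
  | n + 1 =>
    DirectSum.lof 𝕜 ℕ (fun n => PacketPower 𝒱 (n + 1)) n ∘ₗ PacketPower.mk 𝒱 (n + 1)

/-- The packet `v_1 ⊗̲ … ⊗̲ v_n`. -/
noncomputable def packet {n : ℕ} (v : Fin n → V) : Packets 𝒱 :=
  cls 𝒱 n (PiTensorProduct.tprod 𝕜 v)

/-- The component of degree `k` of `⨂̲⁺ V`, where the degree of `v_1 ⊗̲ … ⊗̲ v_n` is the sum of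
the degrees of the `v_i`. -/
noncomputable def packetDegree (k : ℤ) : Submodule 𝕜 (Packets 𝒱) :=
  Submodule.span 𝕜 {X | ∃ (n : ℕ) (d : Fin n → ℤ) (v : Fin n → V),
    0 < n ∧ (∀ i, v i ∈ 𝒱 (d i)) ∧ ∑ i, d i = k ∧ X = packet 𝒱 v}

theorem batImage_one : batImage 𝒱 1 = ⊥ := by
  have : Finset.Ioo 0 1 = (∅ : Finset ℕ) := by decide
  simp [batImage, this]

/-- The projection of `⨂̲⁺ V` onto its space of cogenerators `V = ⨂̲¹ V`. -/
noncomputable def cogenProj : Packets 𝒱 →ₗ[𝕜] V :=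
  PacketPower.lift 𝒱 1
      (PiTensorProduct.subsingletonEquiv (R := 𝕜) (s := fun _ : Fin 1 => V) 0).toLinearMap
      ((batImage_one 𝒱).trans_le bot_le) ∘ₗ
    DirectSum.component 𝕜 ℕ (fun n => PacketPower 𝒱 (n + 1)) 0

variable {𝒱} in
theorem mem_batImage {n p : ℕ} (hp : 0 < p) (hn : p < n) {d : Fin n → ℤ} {v : Fin n → V}
    (hv : ∀ i, v i ∈ 𝒱 (d i)) : bat p d v ∈ batImage 𝒱 n :=
  Submodule.mem_iSup_of_mem p (Submodule.mem_iSup_of_mem (by simp [hp, hn])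
    (Submodule.subset_span ⟨d, v, hv, rfl⟩))

variable {𝒱} in
theorem batImage_le {n : ℕ} {S : Submodule 𝕜 (⨂[𝕜]^n V)}
    (h : ∀ p, 0 < p → p < n → ∀ (d : Fin n → ℤ) (v : Fin n → V), (∀ i, v i ∈ 𝒱 (d i)) →
      bat p d v ∈ S) : batImage 𝒱 n ≤ S := by
  refine iSup₂_le fun p hp => Submodule.span_le.2 ?_
  rw [Finset.mem_Ioo] at hp
  rintro _ ⟨d, v, hv, rfl⟩
  exact h p hp.1 hp.2 d v hv

theorem cls_of_mem {n : ℕ} {t : ⨂[𝕜]^n V} (ht : t ∈ batImage 𝒱 n) : cls 𝒱 n t = 0 := by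
  cases n with
  | zero => rfl
  | succ n =>
    rw [cls, LinearMap.comp_apply, (PacketPower.mk_eq_zero 𝒱).2 ht, map_zero]

theorem packet_zero (v : Fin 0 → V) : packet 𝒱 v = 0 := rfl

theorem negOnePow_sum {n : ℕ} (d : Fin n → ℤ) :
    (∑ i, d i).negOnePow = ∏ i, (d i).negOnePow := by
  induction n with
  | zero => simp
  | succ n ih => rw [Fin.sum_univ_succ, Fin.prod_univ_succ, Int.negOnePow_add, ih]

/-! ### Cutting tensors -/

/-- The map `⨂^(j+m) V → ⨂̲⁺ V ⊗ ⨂̲⁺ V` cutting a tensor of length `n = j + m` after its `j`-th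
letter: `v_1 ⊗ … ⊗ v_n ↦ (v_1 ⊗̲ … ⊗̲ v_j) ⊗ (v_{j+1} ⊗̲ … ⊗̲ v_n)` (this is `0` if `j = 0` or
`m = 0`). -/
noncomputable def cut {n : ℕ} (j m : ℕ) (h : j + m = n) :
    (⨂[𝕜]^n V) →ₗ[𝕜] Packets 𝒱 ⊗[𝕜] Packets 𝒱 :=
  TensorProduct.map (cls 𝒱 j) (cls 𝒱 m) ∘ₗ
    (TensorPower.mulEquiv (R := 𝕜) (M := V) (n := j) (m := m)).symm.toLinearMap ∘ₗ
      (TensorPower.cast 𝕜 V h.symm).toLinearMap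

theorem cut_tprod {n : ℕ} (j m : ℕ) (h : j + m = n) (w : Fin n → V) :
    cut 𝒱 j m h (PiTensorProduct.tprod 𝕜 w)
      = packet 𝒱 (fun x : Fin j => w (Fin.cast h (Fin.castAdd m x))) ⊗ₜ
        packet 𝒱 (fun y : Fin m => w (Fin.cast h (Fin.natAdd j y))) := by
  subst h
  have : TensorPower.mulEquiv (R := 𝕜) (M := V) (n := j) (m := m)
      (PiTensorProduct.tprod 𝕜 (fun x : Fin j => w (Fin.castAdd m x)) ⊗ₜ[𝕜]
        PiTensorProduct.tprod 𝕜 (fun y : Fin m => w (Fin.natAdd j y)))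
      = PiTensorProduct.tprod 𝕜 w := by
    rw [← TensorPower.gMul_def, TensorPower.tprod_mul_tprod]
    congr 1
    exact Fin.append_castAdd_natAdd
  simp only [cut, LinearMap.comp_apply, LinearEquiv.coe_coe, TensorPower.cast_refl,
    LinearEquiv.refl_apply]
  rw [← this, LinearEquiv.symm_apply_apply, TensorProduct.map_tmul]
  rfl

theorem battements_trivial {n p : ℕ} (h : p = 0 ∨ n ≤ p) : battements n p = {1} := by
  ext σ
  rw [mem_battements, Finset.mem_singleton]
  constructor
  · rintro ⟨h1, h2⟩
    have hs : StrictMono σ := by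
      intro i i' hi
      rcases h with h | h
      · exact h2 _ _ hi (by omega)
      · exact h1 _ _ hi (by omega)
    have := (hs.range_inj strictMono_id).1 (by simp [σ.surjective.range_eq])
    ext i : 1
    exact congrFun this i
  · rintro rfl
    exact ⟨fun _ _ h _ => h, fun _ _ h _ => h⟩

theorem koszulSign_one {n : ℕ} (d : Fin n → ℤ) : koszulSign d 1 = 1 := by
  refine Finset.prod_eq_one fun i _ => Finset.prod_eq_one fun j _ => if_neg ?_
  rintro ⟨h1, h2⟩
  exact h1.asymm h2

theorem bat_trivial {n p : ℕ} (h : p = 0 ∨ n ≤ p) (d : Fin n → ℤ) (v : Fin n → V) :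
    bat (𝕜 := 𝕜) p d v = PiTensorProduct.tprod 𝕜 v := by
  rw [bat, battements_trivial h, Finset.sum_singleton, koszulSign_one]
  simp only [Units.val_one, Int.cast_one, one_smul]
  rfl

/-- The permutation exchanging the blocks of the first `m` and of the last `j` letters. -/
def blockSwap (j m : ℕ) : Equiv.Perm (Fin (j + m)) :=
  (finAddFlip.trans (finCongr (add_comm m j))).symm

theorem blockSwap_symm_castAdd (j m : ℕ) (x : Fin j) :
    (blockSwap j m).symm (Fin.castAdd m x) = Fin.cast (add_comm m j) (Fin.natAdd m x) := by
  simp [blockSwap]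

theorem blockSwap_symm_natAdd (j m : ℕ) (y : Fin m) :
    (blockSwap j m).symm (Fin.natAdd j y) = Fin.cast (add_comm m j) (Fin.castAdd j y) := by
  simp [blockSwap]

theorem koszulSign_blockSwap {j m : ℕ} (d : Fin (j + m) → ℤ) :
    koszulSign d (blockSwap j m) =
      ((∑ y : Fin m, d (Fin.cast (add_comm m j) (Fin.castAdd j y))) *
        ∑ x : Fin j, d (Fin.cast (add_comm m j) (Fin.natAdd m x))).negOnePow := by
  rw [koszulSign, ← Equiv.prod_comp (blockSwap j m).symm]
  have : ∀ i, (∏ k, if i < k ∧ blockSwap j m k < blockSwap j m i then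
      (d i * d k).negOnePow else 1) = ∏ k, if i < (blockSwap j m).symm k ∧
        k < blockSwap j m i then (d i * d ((blockSwap j m).symm k)).negOnePow else 1 := by
    intro i
    rw [← Equiv.prod_comp (blockSwap j m).symm]
    simp
  simp_rw [this, Equiv.apply_symm_apply, Fin.prod_univ_add, blockSwap_symm_castAdd,
    blockSwap_symm_natAdd]
  have a1 : ∀ x x' : Fin j, ¬ (Fin.cast (add_comm m j) (Fin.natAdd m x) <
      Fin.cast (add_comm m j) (Fin.natAdd m x') ∧ Fin.castAdd m x' < Fin.castAdd m x) := by
    intro x x'; simp only [Fin.lt_def, Fin.val_cast, Fin.val_natAdd, Fin.val_castAdd]; omega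
  have a2 : ∀ (x : Fin j) (y : Fin m), ¬ (Fin.cast (add_comm m j) (Fin.natAdd m x) <
      Fin.cast (add_comm m j) (Fin.castAdd j y) ∧ Fin.natAdd j y < Fin.castAdd m x) := by
    intro x x'; simp only [Fin.lt_def, Fin.val_cast, Fin.val_natAdd, Fin.val_castAdd]; omega
  have a3 : ∀ (x : Fin j) (y : Fin m), (Fin.cast (add_comm m j) (Fin.castAdd j y) <
      Fin.cast (add_comm m j) (Fin.natAdd m x) ∧ Fin.castAdd m x < Fin.natAdd j y) := by
    intro x x'; simp only [Fin.lt_def, Fin.val_cast, Fin.val_natAdd, Fin.val_castAdd]; omega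
  have a4 : ∀ y y' : Fin m, ¬ (Fin.cast (add_comm m j) (Fin.castAdd j y) <
      Fin.cast (add_comm m j) (Fin.castAdd j y') ∧ Fin.natAdd j y' < Fin.natAdd j y) := by
    intro x x'; simp only [Fin.lt_def, Fin.val_cast, Fin.val_natAdd, Fin.val_castAdd]; omega
  simp only [if_neg (a1 _ _), if_neg (a2 _ _), if_pos (a3 _ _), if_neg (a4 _ _),
    Finset.prod_const_one, one_mul, mul_one]
  rw [Finset.sum_mul, negOnePow_sum]
  refine Finset.prod_congr rfl fun y _ => ?_
  rw [Finset.mul_sum, negOnePow_sum]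

theorem sorted_one (j m : ℕ) : Sorted j m 1 := by
  constructor <;> intro x x' h
  · exact h
  · change Fin.natAdd j x < Fin.natAdd j x'
    simpa using h

theorem sorted_blockSwap (j m : ℕ) : Sorted j m (blockSwap j m) := by
  constructor <;> intro x x' h <;>
    simp only [blockSwap_symm_castAdd, blockSwap_symm_natAdd, Fin.lt_def, Fin.val_cast,
      Fin.val_natAdd, Fin.val_castAdd] at h ⊢ <;> omega

theorem sorted_low_high {j m p : ℕ} (hj : 0 < j) (hm : 0 < m) {σ : Equiv.Perm (Fin (j + m))}
    (hs : Sorted j m σ) :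
    ((∀ x : Fin j, (σ.symm (Fin.castAdd m x)).val < p) ∧
      ∀ y : Fin m, ¬ (σ.symm (Fin.natAdd j y)).val < p) ↔ σ = 1 ∧ j = p := by
  constructor
  · rintro ⟨h1, h2⟩
    have hmono : StrictMono σ.symm := by
      intro i i'
      refine Fin.addCases (fun x => ?_) (fun y => ?_) i <;>
      refine Fin.addCases (fun x' => ?_) (fun y' => ?_) i' <;> intro h
      · exact hs.1 h
      · have := h1 x
        have := h2 y'
        rw [Fin.lt_def]; omega
      · rw [Fin.lt_def] at h
        simp at h; omega
      · exact hs.2 (by simpa using h)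
    have he := (hmono.range_inj strictMono_id).1 (by simp [σ.symm.surjective.range_eq])
    have hσ : σ = 1 := by
      apply Equiv.symm_bijective.injective
      ext i : 1
      exact congrFun he i
    refine ⟨hσ, ?_⟩
    subst hσ
    have e1 := h1 ⟨j - 1, by omega⟩
    have e2 := h2 ⟨0, hm⟩
    change j - 1 < p at e1
    change ¬ (j + 0 < p) at e2
    omega
  · rintro ⟨rfl, rfl⟩
    refine ⟨fun x => x.2, fun y => ?_⟩
    change ¬ (j + y.val < j)
    omega

theorem sorted_high_low {j m p : ℕ} (hj : 0 < j) (hm : 0 < m) {σ : Equiv.Perm (Fin (j + m))}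
    (hs : Sorted j m σ) :
    ((∀ x : Fin j, ¬ (σ.symm (Fin.castAdd m x)).val < p) ∧
      ∀ y : Fin m, (σ.symm (Fin.natAdd j y)).val < p) ↔ σ = blockSwap j m ∧ m = p := by
  constructor
  · rintro ⟨h1, h2⟩
    set g : Fin (j + m) → Fin (j + m) := fun i => σ.symm (blockSwap j m i) with hg
    have hb : ∀ i, (∃ y : Fin m, i.val = y.val ∧ blockSwap j m i = Fin.natAdd j y) ∨
        ∃ x : Fin j, i.val = m + x.val ∧ blockSwap j m i = Fin.castAdd m x := by
      intro i
      obtain ⟨k, rfl⟩ := (blockSwap j m).symm.surjective i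
      rw [Equiv.apply_symm_apply]
      refine Fin.addCases (fun x => ?_) (fun y => ?_) k
      · right
        exact ⟨x, by rw [blockSwap_symm_castAdd]; rfl, rfl⟩
      · left
        exact ⟨y, by rw [blockSwap_symm_natAdd]; rfl, rfl⟩
    have hmono : StrictMono g := by
      intro i i' h
      rw [Fin.lt_def] at h
      rcases hb i with ⟨y, e, e'⟩ | ⟨x, e, e'⟩ <;> rcases hb i' with ⟨y', f, f'⟩ | ⟨x', f, f'⟩ <;>
        simp only [hg, e', f']
      · exact hs.2 (by rw [Fin.lt_def]; omega)
      · have := h1 x'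
        have := h2 y
        rw [Fin.lt_def]; omega
      · omega
      · exact hs.1 (by rw [Fin.lt_def]; omega)
    have he := (hmono.range_inj strictMono_id).1 (by
      simp [show g = (blockSwap j m).trans σ.symm from rfl])
    have hσ : σ = blockSwap j m := by
      ext i : 1
      have := congrFun he ((blockSwap j m).symm (σ i))
      simp only [hg, Equiv.apply_symm_apply, Equiv.symm_apply_apply, id] at this
      rw [this, Equiv.apply_symm_apply, ← this]
    refine ⟨hσ, ?_⟩
    subst hσ
    have e1 := h1 ⟨0, hj⟩
    have e2 := h2 ⟨m - 1, by omega⟩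
    rw [blockSwap_symm_castAdd] at e1
    rw [blockSwap_symm_natAdd] at e2
    change ¬ (m + 0 < p) at e1
    change m - 1 < p at e2
    omega
  · rintro ⟨rfl, rfl⟩
    refine ⟨fun x => ?_, fun y => ?_⟩
    · rw [blockSwap_symm_castAdd]
      change ¬ (m + x.val < m)
      omega
    · rw [blockSwap_symm_natAdd]
      exact y.2

theorem lowCount_le {j n : ℕ} (p : ℕ) (s : Fin j → Fin n) : lowCount p s ≤ j :=
  (Finset.card_le_univ _).trans (by simp)

/-- The part of the cut of a shuffle product in which the set of the first `j` letters is fixed. -/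
theorem sum_cut_block {j m : ℕ} {d : Fin (j + m) → ℤ} {v : Fin (j + m) → V}
    (σ : Equiv.Perm (Fin (j + m))) (r s : ℕ) :
    ∑ ρ₁ ∈ battements j r, ∑ ρ₂ ∈ battements m s,
        cut 𝒱 j m rfl (((koszulSign d (block ρ₁ ρ₂ * σ) : ℤ) : 𝕜) •
          PiTensorProduct.tprod 𝕜 fun i => v ((block ρ₁ ρ₂ * σ).symm i))
      = ((koszulSign d σ : ℤ) : 𝕜) •
        (cls 𝒱 j (bat r (fun x => d (σ.symm (Fin.castAdd m x)))
            fun x => v (σ.symm (Fin.castAdd m x))) ⊗ₜ[𝕜]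
          cls 𝒱 m (bat s (fun y => d (σ.symm (Fin.natAdd j y)))
            fun y => v (σ.symm (Fin.natAdd j y)))) := by
  simp only [bat, map_sum, map_smul, TensorProduct.sum_tmul, TensorProduct.tmul_sum,
    Finset.smul_sum]
  rw [Finset.sum_comm]
  refine Finset.sum_congr rfl fun ρ₂ _ => ?_
  refine Finset.sum_congr rfl fun ρ₁ _ => ?_
  rw [cut_tprod, koszulSign_mul, koszulSign_block, TensorProduct.smul_tmul_smul, smul_smul]
  push_cast
  congr 1
  have e1 : ∀ x : Fin j, (block ρ₁ ρ₂ * σ).symm (Fin.castAdd m x)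
      = σ.symm (Fin.castAdd m (ρ₁.symm x)) := fun x => by
    rw [← block_castAdd ρ₁.symm ρ₂.symm, ← block_symm]; rfl
  have e2 : ∀ x : Fin m, (block ρ₁ ρ₂ * σ).symm (Fin.natAdd j x)
      = σ.symm (Fin.natAdd j (ρ₂.symm x)) := fun x => by
    rw [← block_natAdd ρ₁.symm ρ₂.symm, ← block_symm]; rfl
  simp only [Fin.cast_eq_self, e1, e2]
  rfl

open Classical in
theorem cut_bat {j m p : ℕ} (hp : 0 < p) (hp' : p < j + m) {d : Fin (j + m) → ℤ}
    {v : Fin (j + m) → V} (hv : ∀ i, v i ∈ 𝒱 (d i)) :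
    cut 𝒱 j m rfl (bat p d v)
      = (if j = p then packet 𝒱 (fun x : Fin j => v (Fin.castAdd m x)) ⊗ₜ[𝕜]
          packet 𝒱 (fun y : Fin m => v (Fin.natAdd j y)) else 0)
        + (if m = p then
          ((koszulSign d (blockSwap j m) : ℤ) : 𝕜) •
            (packet 𝒱 (fun x : Fin j => v (Fin.cast (add_comm m j) (Fin.natAdd m x))) ⊗ₜ[𝕜]
              packet 𝒱 (fun y : Fin m => v (Fin.cast (add_comm m j) (Fin.castAdd j y)))) else 0) := by
  rcases Nat.eq_zero_or_pos j with rfl | hj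
  · have h0 : ∀ w : Fin 0 → V, packet 𝒱 w = 0 := packet_zero 𝒱
    rw [bat, map_sum]
    simp only [map_smul, cut_tprod, h0, TensorProduct.zero_tmul, smul_zero, Finset.sum_const_zero,
      ite_self, add_zero]
  rcases Nat.eq_zero_or_pos m with rfl | hm
  · have h0 : ∀ w : Fin 0 → V, packet 𝒱 w = 0 := packet_zero 𝒱
    rw [bat, map_sum]
    simp only [map_smul, cut_tprod, h0, TensorProduct.tmul_zero, smul_zero, Finset.sum_const_zero,
      ite_self, add_zero]
  rw [bat, map_sum, sum_battements]
  set T₁ := packet 𝒱 (fun x : Fin j => v (Fin.castAdd m x)) ⊗ₜ[𝕜]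
          packet 𝒱 (fun y : Fin m => v (Fin.natAdd j y)) with hT₁
  set T₂ := ((koszulSign d (blockSwap j m) : ℤ) : 𝕜) •
            (packet 𝒱 (fun x : Fin j => v (Fin.cast (add_comm m j) (Fin.natAdd m x))) ⊗ₜ[𝕜]
              packet 𝒱 (fun y : Fin m => v (Fin.cast (add_comm m j) (Fin.castAdd j y)))) with hT₂
  have hne : (1 : Equiv.Perm (Fin (j + m))) ≠ blockSwap j m := by
    intro h
    have := blockSwap_symm_castAdd j m ⟨0, hj⟩
    rw [← h] at this
    have := congrArg Fin.val this
    change 0 = m + 0 at this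
    omega
  have hterm : ∀ σ ∈ (battements (j + m) p).filter (Sorted j m),
      ∑ ρ₁ ∈ battements j (lowCount p fun x : Fin j => σ.symm (Fin.castAdd m x)),
        ∑ ρ₂ ∈ battements m (lowCount p fun y : Fin m => σ.symm (Fin.natAdd j y)),
          cut 𝒱 j m rfl (((koszulSign d (block ρ₁ ρ₂ * σ) : ℤ) : 𝕜) •
            PiTensorProduct.tprod 𝕜 fun i => v ((block ρ₁ ρ₂ * σ).symm i))
      = (if 1 = σ then (if j = p then T₁ else 0) else 0)
        + (if blockSwap j m = σ then (if m = p then T₂ else 0) else 0) := by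
    intro σ hσ
    have hs : Sorted j m σ := (Finset.mem_filter.1 hσ).2
    rw [sum_cut_block 𝒱]
    have c1 := lt_lowCount p hs.1
    have c2 := lt_lowCount p hs.2
    have l1 := lowCount_le p fun x : Fin j => σ.symm (Fin.castAdd m x)
    have l2 := lowCount_le p fun y : Fin m => σ.symm (Fin.natAdd j y)
    set r := lowCount p fun x : Fin j => σ.symm (Fin.castAdd m x)
    set s := lowCount p fun y : Fin m => σ.symm (Fin.natAdd j y)
    have hA : r = j ∧ s = 0 ↔ σ = 1 ∧ j = p := by
      rw [← sorted_low_high hj hm hs]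
      constructor
      · rintro ⟨h1, h2⟩
        exact ⟨fun x => (c1 x).1 (by omega), fun y h => by have := (c2 y).2 h; omega⟩
      · rintro ⟨h1, h2⟩
        have e1 := (c1 ⟨j - 1, by omega⟩).2 (h1 _)
        have e2 := mt (c2 ⟨0, hm⟩).1 (h2 _)
        simp only at e1 e2
        omega
    have hB : r = 0 ∧ s = m ↔ σ = blockSwap j m ∧ m = p := by
      rw [← sorted_high_low hj hm hs]
      constructor
      · rintro ⟨h1, h2⟩
        exact ⟨fun x h => by have := (c1 x).2 h; omega, fun y => (c2 y).1 (by omega)⟩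
      · rintro ⟨h1, h2⟩
        have e1 := (c2 ⟨m - 1, by omega⟩).2 (h2 _)
        have e2 := mt (c1 ⟨0, hj⟩).1 (h1 _)
        simp only at e1 e2
        omega
    by_cases hAc : r = j ∧ s = 0
    · obtain ⟨rfl, rfl⟩ := hA.1 hAc
      rw [bat_trivial (Or.inr hAc.1.ge), bat_trivial (Or.inl hAc.2), koszulSign_one]
      rw [if_pos rfl, if_pos rfl, if_neg hne.symm, add_zero]
      simp only [Units.val_one, Int.cast_one, one_smul]
      rfl
    by_cases hBc : r = 0 ∧ s = m
    · obtain ⟨rfl, rfl⟩ := hB.1 hBc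
      rw [bat_trivial (Or.inl hBc.1), bat_trivial (Or.inr hBc.2.ge)]
      rw [if_neg hne, if_pos rfl, if_pos rfl, zero_add, hT₂]
      simp only [blockSwap_symm_castAdd, blockSwap_symm_natAdd]
      rfl
    have z1 : (if 1 = σ then (if j = p then T₁ else 0) else 0) = 0 := by
      rw [← ite_and, if_neg]
      rintro ⟨h1, h2⟩
      exact hAc (hA.2 ⟨h1.symm, h2⟩)
    have z2 : (if blockSwap j m = σ then (if m = p then T₂ else 0) else 0) = 0 := by
      rw [← ite_and, if_neg]
      rintro ⟨h1, h2⟩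
      exact hBc (hB.2 ⟨h1.symm, h2⟩)
    rw [z1, z2, add_zero]
    by_cases h1 : 0 < r ∧ r < j
    · rw [cls_of_mem 𝒱 (mem_batImage h1.1 h1.2 fun x => hv _), TensorProduct.zero_tmul, smul_zero]
    by_cases h2 : 0 < s ∧ s < m
    · rw [cls_of_mem 𝒱 (mem_batImage h2.1 h2.2 fun x => hv _), TensorProduct.tmul_zero, smul_zero]
    exfalso
    rcases (show r = 0 ∧ s = 0 ∨ r = j ∧ s = m by omega) with ⟨h3, h4⟩ | ⟨h3, h4⟩
    · obtain ⟨k, hk⟩ := σ.symm.surjective ⟨0, by omega⟩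
      revert hk
      refine Fin.addCases (fun x hk => ?_) (fun y hk => ?_) k
      · have := (c1 x).2 (by simp only [hk]; omega)
        omega
      · have := (c2 y).2 (by simp only [hk]; omega)
        omega
    · obtain ⟨k, hk⟩ := σ.symm.surjective ⟨p, hp'⟩
      revert hk
      refine Fin.addCases (fun x hk => ?_) (fun y hk => ?_) k
      · have := (c1 x).1 (by omega)
        simp only [hk] at this
        omega
      · have := (c2 y).1 (by omega)
        simp only [hk] at this
        omega
  rw [Finset.sum_congr rfl hterm, Finset.sum_add_distrib, Finset.sum_ite_eq, Finset.sum_ite_eq]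
  congr 1
  · rw [← ite_and]
    refine if_congr ?_ rfl rfl
    refine ⟨fun h => h.2, fun h => ⟨?_, h⟩⟩
    rw [Finset.mem_filter, mem_battements]
    exact ⟨⟨fun _ _ h _ => h, fun _ _ h _ => h⟩, sorted_one j m⟩
  · rw [← ite_and]
    refine if_congr ?_ rfl rfl
    refine ⟨fun h => h.2, fun h => ⟨?_, h⟩⟩
    subst h
    rw [Finset.mem_filter]
    refine ⟨?_, sorted_blockSwap j m⟩
    rw [← mul_one (blockSwap j m), mul_one, mem_battements]
    have hb : ∀ i, (∃ y : Fin m, i.val = y.val ∧ blockSwap j m i = Fin.natAdd j y) ∨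
        ∃ x : Fin j, i.val = m + x.val ∧ blockSwap j m i = Fin.castAdd m x := by
      intro i
      obtain ⟨k, rfl⟩ := (blockSwap j m).symm.surjective i
      rw [Equiv.apply_symm_apply]
      refine Fin.addCases (fun x => ?_) (fun y => ?_) k
      · right
        exact ⟨x, by rw [blockSwap_symm_castAdd]; rfl, rfl⟩
      · left
        exact ⟨y, by rw [blockSwap_symm_natAdd]; rfl, rfl⟩
    constructor <;> intro i i' h h' <;> rw [Fin.lt_def] at h ⊢ <;>
      rcases hb i with ⟨y, e, e'⟩ | ⟨x, e, e'⟩ <;>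
      rcases hb i' with ⟨y', f, f'⟩ | ⟨x', f, f'⟩ <;>
      rw [e', f'] <;> simp only [Fin.val_natAdd, Fin.val_castAdd] <;> omega


/-! ### Signs -/

variable [DirectSum.Decomposition 𝒱]

theorem map_signTwist_tprod (c : ℤ) {n : ℕ} {d : Fin n → ℤ} {v : Fin n → V}
    (hv : ∀ i, v i ∈ 𝒱 (d i)) :
    PiTensorProduct.map (fun _ : Fin n => signTwist 𝒱 c) (PiTensorProduct.tprod 𝕜 v)
      = (((c * ∑ i, d i).negOnePow : ℤ) : 𝕜) • PiTensorProduct.tprod 𝕜 v := by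
  rw [PiTensorProduct.map_tprod]
  have : (fun i => signTwist 𝒱 c (v i))
      = fun i => (((c * d i).negOnePow : ℤ) : 𝕜) • v i := by
    funext i
    rw [signTwist_of_mem 𝒱 c (hv i), Units.smul_def, Int.cast_smul_eq_zsmul]
  rw [this, MultilinearMap.map_smul_univ, Finset.mul_sum, negOnePow_sum]
  push_cast
  rfl

theorem map_signTwist_bat (c : ℤ) {n p : ℕ} {d : Fin n → ℤ} {v : Fin n → V}
    (hv : ∀ i, v i ∈ 𝒱 (d i)) :
    PiTensorProduct.map (fun _ : Fin n => signTwist 𝒱 c) (bat (𝕜 := 𝕜) p d v)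
      = (((c * ∑ i, d i).negOnePow : ℤ) : 𝕜) • bat (𝕜 := 𝕜) p d v := by
  rw [bat, map_sum, Finset.smul_sum]
  refine Finset.sum_congr rfl fun σ _ => ?_
  rw [map_smul, map_signTwist_tprod 𝒱 c fun i => hv (σ.symm i), smul_comm,
    Equiv.sum_comp σ.symm d]

/-- The linear map of `⨂̲⁺ V` equal to `X ↦ (-1)^{c·x} X` in degree `x`. -/
noncomputable def packetTwist (c : ℤ) : Packets 𝒱 →ₗ[𝕜] Packets 𝒱 :=
  DirectSum.lmap fun n : ℕ => PacketPower.lift 𝒱 (n + 1)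
    (PacketPower.mk 𝒱 (n + 1) ∘ₗ PiTensorProduct.map fun _ => signTwist 𝒱 c) <|
      batImage_le fun p hp hn d v hv => by
        rw [LinearMap.mem_ker, LinearMap.comp_apply, map_signTwist_bat 𝒱 c hv,
          map_smul, (PacketPower.mk_eq_zero 𝒱).2 (mem_batImage hp hn hv),
          smul_zero]

theorem packetTwist_packet (c : ℤ) {n : ℕ} {d : Fin n → ℤ} {v : Fin n → V}
    (hv : ∀ i, v i ∈ 𝒱 (d i)) :
    packetTwist 𝒱 c (packet 𝒱 v) = (((c * ∑ i, d i).negOnePow : ℤ) : 𝕜) • packet 𝒱 v := by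
  cases n with
  | zero => rw [packet_zero, map_zero, smul_zero]
  | succ n =>
    rw [packet, cls, LinearMap.comp_apply, packetTwist, DirectSum.lmap_lof,
      PacketPower.lift_mk, LinearMap.comp_apply, map_signTwist_tprod 𝒱 c hv,
      map_smul, map_smul]

/-- The volte `τ(X ⊗ Y) = (-1)^{x·y} Y ⊗ X`: with `s(X) = (-1)^x X`, the even part of `X` is
`(X + s(X))/2` and its odd part is `(X - s(X))/2`, so that `X ⊗ Y` is sent to
`Y ⊗ X_even + s(Y) ⊗ X_odd`. -/
noncomputable def volte : Packets 𝒱 ⊗[𝕜] Packets 𝒱 →ₗ[𝕜] Packets 𝒱 ⊗[𝕜] Packets 𝒱 :=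
  (TensorProduct.comm 𝕜 (Packets 𝒱) (Packets 𝒱)).toLinearMap ∘ₗ
    (TensorProduct.map ((2 : 𝕜)⁻¹ • ((LinearMap.id : Packets 𝒱 →ₗ[𝕜] Packets 𝒱) + packetTwist 𝒱 1))
        (LinearMap.id : Packets 𝒱 →ₗ[𝕜] Packets 𝒱)
      + TensorProduct.map ((2 : 𝕜)⁻¹ • ((LinearMap.id : Packets 𝒱 →ₗ[𝕜] Packets 𝒱) - packetTwist 𝒱 1))
        (packetTwist 𝒱 1))

theorem volte_packet [CharZero 𝕜] {n m : ℕ} {d : Fin n → ℤ} {v : Fin n → V} {e : Fin m → ℤ}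
    {w : Fin m → V} (hv : ∀ i, v i ∈ 𝒱 (d i)) (hw : ∀ i, w i ∈ 𝒱 (e i)) :
    volte 𝒱 (packet 𝒱 v ⊗ₜ packet 𝒱 w)
      = ((((∑ i, d i) * ∑ i, e i).negOnePow : ℤ) : 𝕜) • (packet 𝒱 w ⊗ₜ[𝕜] packet 𝒱 v) := by
  have hx := packetTwist_packet 𝒱 1 hv
  have hy := packetTwist_packet 𝒱 1 hw
  rw [one_mul] at hx hy
  simp only [volte, LinearMap.comp_apply, LinearMap.add_apply, LinearMap.sub_apply,
    LinearMap.smul_apply, TensorProduct.map_tmul, LinearMap.id_apply, hx, hy, map_add,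
    LinearEquiv.coe_coe, TensorProduct.comm_tmul]
  have half : ∀ X : Packets 𝒱, (2 : 𝕜)⁻¹ • (X + X) = X := fun X => by
    rw [← two_smul 𝕜 X, smul_smul, inv_mul_cancel₀ two_ne_zero, one_smul]
  rcases Int.even_or_odd (∑ i, d i) with h | h
  · rw [Int.negOnePow_even _ h, Int.negOnePow_even _ (h.mul_right _)]
    simp [half]
  · rw [Int.negOnePow_odd _ h]
    have : ((∑ i, d i) * ∑ i, e i).negOnePow = (∑ i, e i).negOnePow := by
      rw [Int.negOnePow_eq_iff]
      obtain ⟨k, hk⟩ := h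
      exact ⟨k * ∑ i, e i, by rw [hk]; ring⟩
    rw [this]
    simp only [Units.val_neg, Units.val_one, Int.cast_neg, Int.cast_one, neg_smul, one_smul,
      add_neg_cancel, smul_zero, TensorProduct.tmul_zero, zero_add, sub_neg_eq_add, half,
      TensorProduct.smul_tmul']

/-! ### The cobracket -/

/-- `v_1 ⊗ … ⊗ v_n ↦ ∑_{U ⊗̲ V = X, U, V ≠ ∅} U ⊗ V - (-1)^{vu} V ⊗ U`, with
`X = v_1 ⊗̲ … ⊗̲ v_n`. -/
noncomputable def tensorCobracket (n : ℕ) :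
    (⨂[𝕜]^n V) →ₗ[𝕜] Packets 𝒱 ⊗[𝕜] Packets 𝒱 :=
  (LinearMap.id - volte 𝒱) ∘ₗ
    ∑ x : Finset.HasAntidiagonal.antidiagonal n, cut 𝒱 x.1.1 x.1.2 (Finset.HasAntidiagonal.mem_antidiagonal.1 x.2)

theorem batImage_le_ker_tensorCobracket [CharZero 𝕜] (n : ℕ) :
    batImage 𝒱 n ≤ LinearMap.ker (tensorCobracket 𝒱 n) := by
  refine batImage_le fun p hp hn d v hv => ?_
  obtain ⟨q, rfl⟩ : ∃ q, n = p + q := ⟨n - p, by omega⟩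
  set T := packet 𝒱 (fun x : Fin p => v (Fin.castAdd q x)) ⊗ₜ[𝕜]
    packet 𝒱 (fun y : Fin q => v (Fin.natAdd p y)) with hT
  have hvT := volte_packet 𝒱 (fun x : Fin p => hv (Fin.castAdd q x))
    (fun y : Fin q => hv (Fin.natAdd p y))
  have hvT' := volte_packet 𝒱 (fun y : Fin q => hv (Fin.natAdd p y))
    (fun x : Fin p => hv (Fin.castAdd q x))
  have hcut : ∀ (j m : ℕ) (h : j + m = p + q), cut 𝒱 j m h (bat p d v)
      = (if j = p then T else 0) + if m = p then volte 𝒱 T else 0 := by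
    intro j m h
    have key : ∀ (n : ℕ) (h : j + m = n) (hn : n = p + q) (d : Fin n → ℤ) (v : Fin n → V)
        (_ : ∀ i, v i ∈ 𝒱 (d i)), cut 𝒱 j m h (bat p d v)
      = (if j = p then packet 𝒱 (fun x : Fin p => v (Fin.cast hn.symm (Fin.castAdd q x))) ⊗ₜ[𝕜]
          packet 𝒱 (fun y : Fin q => v (Fin.cast hn.symm (Fin.natAdd p y))) else 0)
        + if m = p then volte 𝒱
          (packet 𝒱 (fun x : Fin p => v (Fin.cast hn.symm (Fin.castAdd q x))) ⊗ₜ[𝕜]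
          packet 𝒱 (fun y : Fin q => v (Fin.cast hn.symm (Fin.natAdd p y)))) else 0 := by
      rintro n rfl hn d' v' hv'
      rw [cut_bat 𝒱 hp (by omega) hv']
      congr 1
      · split_ifs with hj
        · subst hj
          obtain rfl : m = q := by omega
          rfl
        · rfl
      · split_ifs with hj
        · subst hj
          obtain rfl : j = q := by omega
          rw [volte_packet 𝒱 (fun x : Fin m => hv' (Fin.cast hn.symm (Fin.castAdd j x)))
            (fun y : Fin j => hv' (Fin.cast hn.symm (Fin.natAdd m y))), koszulSign_blockSwap]
        · rfl
    exact key (p + q) h rfl d v hv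
  rw [LinearMap.mem_ker, tensorCobracket, LinearMap.comp_apply, LinearMap.sum_apply]
  simp only [hcut]
  rw [Finset.sum_coe_sort (Finset.HasAntidiagonal.antidiagonal (p + q))
    (fun x : ℕ × ℕ => (if x.1 = p then T else 0) + if x.2 = p then volte 𝒱 T else 0),
    Finset.sum_add_distrib,
    Finset.sum_eq_single (p, q) (fun x hx hne => if_neg fun h => hne (by
      rw [Finset.HasAntidiagonal.mem_antidiagonal] at hx; ext <;> simp only <;> omega))
      (fun h => absurd (by simp) h),
    Finset.sum_eq_single (q, p) (fun x hx hne => if_neg fun h => hne (by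
      rw [Finset.HasAntidiagonal.mem_antidiagonal] at hx; ext <;> simp only <;> omega))
      (fun h => absurd (by simp [add_comm]) h), if_pos rfl, if_pos rfl]
  have h2 : volte 𝒱 (volte 𝒱 T) = T := by
    rw [hT, hvT, map_smul, hvT', smul_smul, mul_comm (∑ i, d (Fin.natAdd p i)), ← Int.cast_mul,
      ← Units.val_mul, Int.units_mul_self, Units.val_one, Int.cast_one, one_smul]
  rw [LinearMap.sub_apply, LinearMap.id_apply, map_add, h2]
  abel

/-- The Lie cobracket `δ` of `⨂̲⁺ V`. -/
noncomputable def cobracket [CharZero 𝕜] : Packets 𝒱 →ₗ[𝕜] Packets 𝒱 ⊗[𝕜] Packets 𝒱 :=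
  DirectSum.toModule 𝕜 ℕ _ fun n =>
    PacketPower.lift 𝒱 (n + 1) (tensorCobracket 𝒱 (n + 1))
      (batImage_le_ker_tensorCobracket 𝒱 (n + 1))

/-! ### Compatibility of a bracket with the cobracket -/

/-- `τ₁₂ = τ ⊗ id` on `⨂̲⁺ V ⊗ ⨂̲⁺ V ⊗ ⨂̲⁺ V`. -/
noncomputable def volte₁₂ :
    (Packets 𝒱 ⊗[𝕜] Packets 𝒱) ⊗[𝕜] Packets 𝒱 →ₗ[𝕜] (Packets 𝒱 ⊗[𝕜] Packets 𝒱) ⊗[𝕜] Packets 𝒱 :=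
  (volte 𝒱).rTensor (Packets 𝒱)

/-- `τ₂₃ = id ⊗ τ` on `⨂̲⁺ V ⊗ ⨂̲⁺ V ⊗ ⨂̲⁺ V`. -/
noncomputable def volte₂₃ :
    (Packets 𝒱 ⊗[𝕜] Packets 𝒱) ⊗[𝕜] Packets 𝒱 →ₗ[𝕜] (Packets 𝒱 ⊗[𝕜] Packets 𝒱) ⊗[𝕜] Packets 𝒱 :=
  (TensorProduct.assoc 𝕜 (Packets 𝒱) (Packets 𝒱) (Packets 𝒱)).symm.toLinearMap ∘ₗ
    (volte 𝒱).lTensor (Packets 𝒱) ∘ₗ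
      (TensorProduct.assoc 𝕜 (Packets 𝒱) (Packets 𝒱) (Packets 𝒱)).toLinearMap

/-- `δ ⊗ id`. -/
noncomputable def cobracketLeft [CharZero 𝕜] :
    Packets 𝒱 ⊗[𝕜] Packets 𝒱 →ₗ[𝕜] (Packets 𝒱 ⊗[𝕜] Packets 𝒱) ⊗[𝕜] Packets 𝒱 :=
  (cobracket 𝒱).rTensor (Packets 𝒱)

/-- `id ⊗ δ` (no sign, as `δ` has degree `0`). -/
noncomputable def cobracketRight [CharZero 𝕜] :
    Packets 𝒱 ⊗[𝕜] Packets 𝒱 →ₗ[𝕜] (Packets 𝒱 ⊗[𝕜] Packets 𝒱) ⊗[𝕜] Packets 𝒱 :=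
  (TensorProduct.assoc 𝕜 (Packets 𝒱) (Packets 𝒱) (Packets 𝒱)).symm.toLinearMap ∘ₗ
    (cobracket 𝒱).lTensor (Packets 𝒱)

/-- `m ⊗ id`. -/
noncomputable def bracketLeft (m : Packets 𝒱 ⊗[𝕜] Packets 𝒱 →ₗ[𝕜] Packets 𝒱) :
    (Packets 𝒱 ⊗[𝕜] Packets 𝒱) ⊗[𝕜] Packets 𝒱 →ₗ[𝕜] Packets 𝒱 ⊗[𝕜] Packets 𝒱 :=
  m.rTensor (Packets 𝒱)

/-- `id ⊗ m` for `m` of degree `c`, with the Koszul sign: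
`(id ⊗ m)(X ⊗ Y ⊗ Z) = (-1)^{c·x} X ⊗ m(Y ⊗ Z)`. -/
noncomputable def bracketRight (c : ℤ) (m : Packets 𝒱 ⊗[𝕜] Packets 𝒱 →ₗ[𝕜] Packets 𝒱) :
    (Packets 𝒱 ⊗[𝕜] Packets 𝒱) ⊗[𝕜] Packets 𝒱 →ₗ[𝕜] Packets 𝒱 ⊗[𝕜] Packets 𝒱 :=
  TensorProduct.map (packetTwist 𝒱 c) m ∘ₗ
    (TensorProduct.assoc 𝕜 (Packets 𝒱) (Packets 𝒱) (Packets 𝒱)).toLinearMap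

/-- The bracket `m` is of degree `c`. -/
def IsOfDegree (c : ℤ) (m : Packets 𝒱 ⊗[𝕜] Packets 𝒱 →ₗ[𝕜] Packets 𝒱) : Prop :=
  ∀ (x y : ℤ) (X Y : Packets 𝒱), X ∈ packetDegree 𝒱 x → Y ∈ packetDegree 𝒱 y →
    m (X ⊗ₜ Y) ∈ packetDegree 𝒱 (x + y + c)

/-- The bracket `m` of `⨂̲⁺ V` extends the bracket `ℓ` of the space of cogenerators `V`:
its corestriction to `V` is `ℓ`, that is `pr ∘ m = ℓ ∘ (pr ⊗ pr)` for the projection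
`pr : ⨂̲⁺ V → V`. -/
def Extends (l : V →ₗ[𝕜] V →ₗ[𝕜] V) (m : Packets 𝒱 ⊗[𝕜] Packets 𝒱 →ₗ[𝕜] Packets 𝒱) : Prop :=
  ∀ X Y : Packets 𝒱, cogenProj 𝒱 (m (X ⊗ₜ Y)) = l (cogenProj 𝒱 X) (cogenProj 𝒱 Y)

/-- The identity
`δ ∘ m = (m ⊗ id) ∘ (τ₂₃ ∘ (δ ⊗ id) + id ⊗ δ) + (id ⊗ m) ∘ (δ ⊗ id + τ₁₂ ∘ (id ⊗ δ))`
for a bracket `m` of degree `c`. -/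
def IsCompatible [CharZero 𝕜] (c : ℤ) (m : Packets 𝒱 ⊗[𝕜] Packets 𝒱 →ₗ[𝕜] Packets 𝒱) : Prop :=
  cobracket 𝒱 ∘ₗ m =
    bracketLeft 𝒱 m ∘ₗ (volte₂₃ 𝒱 ∘ₗ cobracketLeft 𝒱 + cobracketRight 𝒱) +
      bracketRight 𝒱 c m ∘ₗ (cobracketLeft 𝒱 + volte₁₂ 𝒱 ∘ₗ cobracketRight 𝒱)

end Packets

/-- The space `ℋ = ⨂̲⁺(A[-a+1])`. -/
abbrev HSpace {𝕜 A : Type*} [Field 𝕜] [AddCommGroup A] [Module 𝕜 A]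
    (𝒜 : ℤ → Submodule 𝕜 A) (a : ℤ) : Type _ := Packets (shifted 𝒜 a)

end ABAlgebra

open ABAlgebra

/-!
Everything is tested on words in homogeneous letters, whose classes span the packets.

Existence. The sum over all shuffles of two words of the contractions of a letter of the first word
with an adjacent letter of the second is, up to sign, a biderivation of the shuffle product, hence
descends to packets. It is also compatible with deconcatenation `Δ` of words: a cut of such a term
splits both words, and one of the two pieces is a contraction while the other is a plain shuffle.
In packets proper shuffles vanish, so only the cuts of one of the two words survive, which is the
non-antisymmetrized form of `(∗)`; since `δ = (1 - τ) ∘ Δ` on packets, `(∗)` follows.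

Uniqueness. Two solutions have the same projection to `V`, and by induction on the total length the
same cobracket, so it suffices that `ker δ ∩ ker pr = 0`. In characteristic zero this follows from
the dual of the Dynkin idempotent: the convolution of the length-weighted identity with the antipode
of the shuffle Hopf algebra multiplies the class of a word by its length, and on words of length at
least two it factors through `δ`.
-/

namespace ABAlgebra

/-! ### Signs and words -/

section Words

variable {R L M : Type*} [CommRing R] [AddCommMonoid M] [Module R M]

/-- The Koszul sign `(-1)^{xy}` as an element of the ring `R`. -/
def commSign (R : Type*) [CommRing R] (x y : ℤ) : R := (((x * y).negOnePow : ℤ) : R)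

theorem commSign_add_left (x y z : ℤ) :
    commSign R (x + y) z = commSign R x z * commSign R y z := by
  simp [commSign, add_mul, Int.negOnePow_add]

theorem commSign_add_right (x y z : ℤ) :
    commSign R x (y + z) = commSign R x y * commSign R x z := by
  simp [commSign, mul_add, Int.negOnePow_add]

theorem commSign_zero_left (x : ℤ) : commSign R 0 x = 1 := by simp [commSign]

theorem commSign_zero_right (x : ℤ) : commSign R x 0 = 1 := by simp [commSign]

theorem commSign_comm (x y : ℤ) : commSign R x y = commSign R y x := by
  rw [commSign, commSign, mul_comm]

theorem commSign_mul_self (x y : ℤ) : commSign R x y * commSign R x y = 1 := by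
  rw [commSign, ← Int.cast_mul, ← Units.val_mul, Int.units_mul_self, Units.val_one, Int.cast_one]

theorem commSign_mul_cancel_left (x y : ℤ) (r : R) :
    commSign R x y * (commSign R x y * r) = r := by
  rw [← mul_assoc, commSign_mul_self, one_mul]

/-- The free `R`-module on the words in the alphabet `L`, i.e. the tensor algebra of the free
module on `L`. Shuffles and brackets are computed here, before passing to packets. -/
abbrev Words (R L : Type*) [CommRing R] : Type _ := List L →₀ R

/-- The basis vector of `Words R L` given by the word `w`. -/
noncomputable def word (R : Type*) [CommRing R] (w : List L) : Words R L := Finsupp.single w 1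

/-- The linear extension to `Words R L` of a map defined on words. -/
noncomputable def wordLift (f : List L → M) : Words R L →ₗ[R] M :=
  Finsupp.linearCombination R f

theorem wordLift_word (f : List L → M) (w : List L) : wordLift (R := R) f (word R w) = f w := by
  simp [wordLift, word]

theorem words_hom_ext {f g : Words R L →ₗ[R] M} (h : ∀ w, f (word R w) = g (word R w)) :
    f = g :=
  Finsupp.lhom_ext' fun w => LinearMap.ext_ring (h w)

theorem words_hom_ext₂ {f g : Words R L →ₗ[R] Words R L →ₗ[R] M}
    (h : ∀ u v, f (word R u) (word R v) = g (word R u) (word R v)) : f = g :=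
  words_hom_ext fun u => words_hom_ext fun v => h u v

/-- The linear map adding the letter `a` in front of words. -/
noncomputable def consLetter (a : L) : Words R L →ₗ[R] Words R L :=
  wordLift fun w => word R (a :: w)

theorem word_cons (a : L) (w : List L) : word R (a :: w) = consLetter a (word R w) := by
  rw [consLetter, wordLift_word]

variable (deg : L → ℤ)

/-- The degree of a word, i.e. the sum of the degrees of its letters. -/
def wordDeg (w : List L) : ℤ := (w.map deg).sum

theorem wordDeg_nil : wordDeg deg [] = 0 := rfl

theorem wordDeg_cons (a : L) (w : List L) : wordDeg deg (a :: w) = deg a + wordDeg deg w := by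
  simp [wordDeg]

theorem wordDeg_append (u v : List L) : wordDeg deg (u ++ v) = wordDeg deg u + wordDeg deg v := by
  simp [wordDeg]

/-- The linear map `w ↦ (-1)^{x·w} w`: the sign of moving an element of degree `x` past `w`. -/
noncomputable def twist (x : ℤ) : Words R L →ₗ[R] Words R L :=
  wordLift fun w => commSign R x (wordDeg deg w) • word R w

theorem twist_word (x : ℤ) (w : List L) :
    twist deg x (word R w) = commSign R x (wordDeg deg w) • word R w := wordLift_word _ _

theorem twist_cons (x : ℤ) (a : L) (t : Words R L) :
    twist deg x (consLetter a t) = commSign R x (deg a) • consLetter a (twist deg x t) := by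
  have : twist deg x ∘ₗ consLetter a
      = commSign R x (deg a) • (consLetter a ∘ₗ twist (R := R) deg x) := by
    refine words_hom_ext fun w => ?_
    simp only [LinearMap.comp_apply, LinearMap.smul_apply, ← word_cons, twist_word, map_smul,
      wordDeg_cons, commSign_add_right, smul_smul]
  exact LinearMap.congr_fun this t

end Words

/-! ### The shuffle product -/

section Shuffle

variable {R L : Type*} [CommRing R] (deg : L → ℤ)

/-- The graded shuffle product of two words, by recursion on the first letter of the result. -/
noncomputable def shuffleWord (R : Type*) [CommRing R] : List L → List L → Words R L
  | [], v => word R v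
  | a :: u, [] => word R (a :: u)
  | a :: u, b :: v => consLetter a (shuffleWord R u (b :: v)) +
      commSign R (deg b) (wordDeg deg (a :: u)) • consLetter b (shuffleWord R (a :: u) v)
termination_by u v => u.length + v.length

/-- The graded shuffle product, bilinear on `Words R L`. -/
noncomputable def shuffle : Words R L →ₗ[R] Words R L →ₗ[R] Words R L :=
  wordLift fun u => wordLift fun v => shuffleWord deg R u v

theorem shuffle_word (u v : List L) :
    shuffle deg (word R u) (word R v) = shuffleWord deg R u v := by
  rw [shuffle, wordLift_word, wordLift_word]

theorem shuffle_nil_left (t : Words R L) : shuffle deg (word R []) t = t := by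
  have : shuffle deg (word R ([] : List L)) = LinearMap.id :=
    words_hom_ext fun w => by rw [shuffle_word, shuffleWord, LinearMap.id_apply]
  rw [this, LinearMap.id_apply]

theorem shuffle_nil_right (t : Words R L) : shuffle deg t (word R []) = t := by
  have : (shuffle deg).flip (word R ([] : List L)) = LinearMap.id :=
    words_hom_ext fun w => by
      cases w <;> rw [LinearMap.flip_apply, shuffle_word, shuffleWord, LinearMap.id_apply]
  rw [← LinearMap.flip_apply, this, LinearMap.id_apply]

theorem shuffle_word_cons_cons (a b : L) (u v : List L) :
    shuffle deg (word R (a :: u)) (word R (b :: v)) =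
      consLetter a (shuffle deg (word R u) (word R (b :: v))) +
        commSign R (deg b) (wordDeg deg (a :: u)) •
          consLetter b (shuffle deg (word R (a :: u)) (word R v)) := by
  simp only [shuffle_word]
  rw [shuffleWord]

theorem shuffle_cons_cons (a b : L) (t s : Words R L) :
    shuffle deg (consLetter a t) (consLetter b s) =
      consLetter a (shuffle deg t (consLetter b s)) +
        commSign R (deg b) (deg a) •
          consLetter b (shuffle deg (consLetter a (twist deg (deg b) t)) s) := by
  have : (shuffle deg).compl₁₂ (consLetter a) (consLetter b) =
      ((shuffle deg).compl₂ (consLetter b)).compr₂ (consLetter a) + commSign R (deg b) (deg a) •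
        ((shuffle deg).comp (consLetter a ∘ₗ twist (R := R) deg (deg b))).compr₂
          (consLetter b) := by
    refine words_hom_ext₂ fun u v => ?_
    simp only [LinearMap.compl₁₂_apply, LinearMap.add_apply, LinearMap.compr₂_apply,
      LinearMap.compl₂_apply, LinearMap.smul_apply, LinearMap.comp_apply, twist_word,
      ← word_cons, map_smul, shuffle_word_cons_cons, wordDeg_cons,
      commSign_add_right, smul_smul]
  exact LinearMap.congr_fun₂ this t s

theorem twist_shuffle_word (x : ℤ) (u v : List L) :
    twist deg x (shuffle deg (word R u) (word R v)) =
      commSign R x (wordDeg deg u + wordDeg deg v) • shuffle deg (word R u) (word R v) := by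
  induction u, v using shuffleWord.induct with
  | case1 v => simp only [shuffle_nil_left, twist_word, wordDeg_nil, zero_add]
  | case2 a u => simp only [shuffle_nil_right, twist_word, wordDeg_nil, add_zero]
  | case3 a u b v ihu ihv =>
    simp only [shuffle_word_cons_cons, map_add, map_smul, twist_cons, ihu, ihv, smul_add,
      smul_smul, wordDeg_cons, commSign_add_right]
    simp only [mul_comm, mul_left_comm]

theorem twist_shuffle (x : ℤ) (t s : Words R L) :
    twist deg x (shuffle deg t s) = shuffle deg (twist deg x t) (twist deg x s) := by
  have : (shuffle (R := R) deg).compr₂ (twist deg x)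
      = (shuffle deg).compl₁₂ (twist deg x) (twist deg x) := by
    refine words_hom_ext₂ fun u v => ?_
    simp only [LinearMap.compr₂_apply, LinearMap.compl₁₂_apply, twist_shuffle_word, twist_word,
      map_smul, LinearMap.smul_apply, smul_smul, commSign_add_right, mul_comm]
  exact LinearMap.congr_fun₂ this t s

theorem shuffle_assoc_word (u v w : List L) :
    shuffle deg (shuffle deg (word R u) (word R v)) (word R w) =
      shuffle deg (word R u) (shuffle deg (word R v) (word R w)) := by
  induction u generalizing v w with
  | nil => simp only [shuffle_nil_left]
  | cons a u ihu =>
    induction v generalizing w with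
    | nil => simp only [shuffle_nil_left, shuffle_nil_right]
    | cons b v ihv =>
      induction w with
      | nil => simp only [shuffle_nil_right]
      | cons e w ihw =>
        have hu := ihu (b :: v) (e :: w)
        have hv := ihv (e :: w)
        clear ihu ihv
        simp only [word_cons, twist_cons, twist_word, twist_shuffle, map_smul, map_add,
          LinearMap.smul_apply, LinearMap.add_apply,
          shuffle_cons_cons, smul_add, smul_smul] at hu hv ihw ⊢
        rw [hu, hv, ← ihw]
        simp only [map_add, map_smul, smul_add, smul_smul]
        simp only [mul_comm, mul_left_comm, commSign_comm]
        abel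

theorem shuffle_assoc (t s r : Words R L) :
    shuffle deg (shuffle deg t s) r = shuffle deg t (shuffle deg s r) := by
  have h₁ (w : List L) : (shuffle (R := R) deg).compr₂ ((shuffle deg).flip (word R w)) =
      (shuffle deg).compl₂ ((shuffle deg).flip (word R w)) :=
    words_hom_ext₂ fun u v => shuffle_assoc_word deg u v w
  have h₂ : shuffle deg (shuffle deg t s) = (shuffle deg t).comp (shuffle deg s) :=
    words_hom_ext fun w => LinearMap.congr_fun₂ (h₁ w) t s
  exact LinearMap.congr_fun h₂ r

theorem shuffle_comm_word (u v : List L) :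
    shuffle deg (word R u) (word R v) =
      commSign R (wordDeg deg u) (wordDeg deg v) • shuffle deg (word R v) (word R u) := by
  induction u, v using shuffleWord.induct with
  | case1 v =>
    simp only [shuffle_nil_left, shuffle_nil_right, wordDeg_nil, commSign_zero_left, one_smul]
  | case2 a u =>
    simp only [shuffle_nil_left, shuffle_nil_right, wordDeg_nil, commSign_zero_right, one_smul]
  | case3 a u b v ihu ihv =>
    rw [shuffle_word_cons_cons, shuffle_word_cons_cons, ihu, ihv]
    simp only [map_smul, smul_add, smul_smul, wordDeg_cons, commSign_add_left, commSign_add_right]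
    simp only [mul_comm, mul_left_comm, commSign_comm, commSign_mul_cancel_left]
    abel

theorem shuffle_right_comm_word (u v w : List L) :
    shuffle deg (shuffle deg (word R u) (word R v)) (word R w) =
      commSign R (wordDeg deg v) (wordDeg deg w) •
        shuffle deg (shuffle deg (word R u) (word R w)) (word R v) := by
  rw [shuffle_assoc, shuffle_comm_word deg v w, map_smul, shuffle_assoc]

theorem shuffle_left_comm_word (u v w : List L) :
    shuffle deg (word R u) (shuffle deg (word R v) (word R w)) =
      commSign R (wordDeg deg u) (wordDeg deg v) •
        shuffle deg (word R v) (shuffle deg (word R u) (word R w)) := by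
  rw [← shuffle_assoc, shuffle_comm_word deg u v, map_smul, LinearMap.smul_apply, shuffle_assoc]

end Shuffle

/-! ### The bracket of words -/

section Bracket

variable {R L : Type*} [CommRing R] (deg : L → ℤ) (c : ℤ) (l : L → L → L)

/-- The bracket of degree `c` of two words: the signed sum, over their shuffles, of the
contractions by `l` of a letter of the first word immediately followed by one of the second. -/
noncomputable def bracketWord (R : Type*) [CommRing R] : List L → List L → Words R L
  | [], _ => 0
  | _ :: _, [] => 0
  | a :: u, b :: v => commSign R c (deg a) • consLetter a (bracketWord R u (b :: v)) +
      (commSign R (deg b) (wordDeg deg (a :: u)) * commSign R c (deg b)) •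
        consLetter b (bracketWord R (a :: u) v) +
      commSign R (deg b) (wordDeg deg u) • consLetter (l a b) (shuffleWord deg R u v)
termination_by u v => u.length + v.length

/-- The bilinear extension of `bracketWord` to `Words R L`. -/
noncomputable def wordBracket : Words R L →ₗ[R] Words R L →ₗ[R] Words R L :=
  wordLift fun u => wordLift fun v => bracketWord deg c l R u v

theorem wordBracket_word (u v : List L) :
    wordBracket deg c l (word R u) (word R v) = bracketWord deg c l R u v := by
  rw [wordBracket, wordLift_word, wordLift_word]

theorem wordBracket_nil_left (t : Words R L) : wordBracket deg c l (word R []) t = 0 := by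
  have : wordBracket deg c l (word R ([] : List L)) = 0 :=
    words_hom_ext fun w => by rw [wordBracket_word, bracketWord, LinearMap.zero_apply]
  rw [this, LinearMap.zero_apply]

theorem wordBracket_nil_right (t : Words R L) : wordBracket deg c l t (word R []) = 0 := by
  have : (wordBracket deg c l).flip (word R ([] : List L)) = 0 :=
    words_hom_ext fun w => by
      cases w <;> rw [LinearMap.flip_apply, wordBracket_word, bracketWord, LinearMap.zero_apply]
  rw [← LinearMap.flip_apply, this, LinearMap.zero_apply]

theorem wordBracket_word_cons_cons (a b : L) (u v : List L) :
    wordBracket deg c l (word R (a :: u)) (word R (b :: v)) =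
      commSign R c (deg a) • consLetter a (wordBracket deg c l (word R u) (word R (b :: v))) +
      (commSign R (deg b) (wordDeg deg (a :: u)) * commSign R c (deg b)) •
        consLetter b (wordBracket deg c l (word R (a :: u)) (word R v)) +
      commSign R (deg b) (wordDeg deg u) •
        consLetter (l a b) (shuffle deg (word R u) (word R v)) := by
  simp only [wordBracket_word, shuffle_word]
  rw [bracketWord]

theorem wordBracket_cons_cons (a b : L) (t s : Words R L) :
    wordBracket deg c l (consLetter a t) (consLetter b s) =
      commSign R c (deg a) • consLetter a (wordBracket deg c l t (consLetter b s)) +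
        (commSign R (deg b) (deg a) * commSign R c (deg b)) •
          consLetter b (wordBracket deg c l (consLetter a (twist deg (deg b) t)) s) +
        consLetter (l a b) (shuffle deg (twist deg (deg b) t) s) := by
  have : (wordBracket deg c l).compl₁₂ (consLetter a) (consLetter b) =
      commSign R c (deg a) •
        ((wordBracket deg c l).compl₂ (consLetter b)).compr₂ (consLetter a) +
      (commSign R (deg b) (deg a) * commSign R c (deg b)) •
        ((wordBracket deg c l).comp (consLetter a ∘ₗ twist (R := R) deg (deg b))).compr₂
          (consLetter b) +
      ((shuffle deg).comp (twist (R := R) deg (deg b))).compr₂ (consLetter (l a b)) := by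
    refine words_hom_ext₂ fun u v => ?_
    simp only [LinearMap.compl₁₂_apply, LinearMap.add_apply, LinearMap.compr₂_apply,
      LinearMap.compl₂_apply, LinearMap.smul_apply, LinearMap.comp_apply, twist_word,
      ← word_cons, map_smul, wordBracket_word_cons_cons, wordDeg_cons,
      commSign_add_right, smul_smul, mul_comm, mul_left_comm]
  exact LinearMap.congr_fun₂ this t s

variable {deg c l}

theorem twist_wordBracket_word (hl : ∀ a b, deg (l a b) = deg a + deg b + c) (x : ℤ)
    (u v : List L) :
    twist deg x (wordBracket deg c l (word R u) (word R v)) =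
      commSign R x (wordDeg deg u + wordDeg deg v + c) •
        wordBracket deg c l (word R u) (word R v) := by
  induction u, v using shuffleWord.induct with
  | case1 v => simp only [wordBracket_nil_left, map_zero, smul_zero]
  | case2 a u => simp only [wordBracket_nil_right, map_zero, smul_zero]
  | case3 a u b v ihu ihv =>
    simp only [wordBracket_word_cons_cons, map_add, map_smul, twist_cons, ihu, ihv,
      twist_shuffle_word, hl, smul_add, smul_smul, wordDeg_cons, commSign_add_right]
    simp only [mul_comm, mul_left_comm]

theorem twist_wordBracket (hl : ∀ a b, deg (l a b) = deg a + deg b + c) (x : ℤ)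
    (t s : Words R L) :
    twist deg x (wordBracket deg c l t s) =
      commSign R x c • wordBracket deg c l (twist deg x t) (twist deg x s) := by
  have : (wordBracket (R := R) deg c l).compr₂ (twist deg x)
      = commSign R x c • (wordBracket deg c l).compl₁₂ (twist deg x) (twist deg x) := by
    refine words_hom_ext₂ fun u v => ?_
    simp only [LinearMap.compr₂_apply, LinearMap.compl₁₂_apply, LinearMap.smul_apply,
      twist_wordBracket_word hl, twist_word, map_smul, smul_smul, commSign_add_right, mul_comm]
  exact LinearMap.congr_fun₂ this t s

theorem wordBracket_shuffle_left (hl : ∀ a b, deg (l a b) = deg a + deg b + c) (u v w : List L) :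
    wordBracket deg c l (shuffle deg (word R u) (word R v)) (word R w) =
      commSign R c (wordDeg deg u) •
        shuffle deg (word R u) (wordBracket deg c l (word R v) (word R w)) +
      commSign R (wordDeg deg v) (wordDeg deg w) •
        shuffle deg (wordBracket deg c l (word R u) (word R w)) (word R v) := by
  induction u generalizing v w with
  | nil =>
    simp only [shuffle_nil_left, wordBracket_nil_left, wordDeg_nil, commSign_zero_right, one_smul,
      map_zero, LinearMap.zero_apply, smul_zero, add_zero]
  | cons a u ihu =>
    induction v generalizing w with
    | nil =>
      simp only [shuffle_nil_right, wordBracket_nil_left, wordDeg_nil, commSign_zero_left, one_smul,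
        map_zero, smul_zero, zero_add]
    | cons b v ihv =>
      induction w with
      | nil =>
        simp only [wordBracket_nil_right, map_zero, smul_zero, add_zero, LinearMap.zero_apply]
      | cons e w ihw =>
        have hu := ihu (b :: v) (e :: w)
        have hv := ihv (e :: w)
        have contract_u := shuffle_right_comm_word (R := R) deg u (b :: v) w
        have contract_v := shuffle_assoc_word (R := R) deg (a :: u) v w
        clear ihu ihv
        simp only [word_cons, twist_cons, twist_word, twist_shuffle, map_smul, map_add,
          LinearMap.smul_apply, LinearMap.add_apply, hl, twist_wordBracket hl, wordDeg_cons,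
          wordBracket_cons_cons, shuffle_cons_cons, smul_add, smul_smul, commSign_add_left,
          commSign_add_right] at hu hv contract_u contract_v ihw ⊢
        rw [hu, hv, contract_u, contract_v, eq_sub_of_add_eq ihw]
        simp only [map_smul, map_add, map_sub, smul_add, smul_smul, smul_sub]
        simp only [mul_comm, mul_left_comm, commSign_comm, commSign_mul_cancel_left]
        abel

theorem wordBracket_shuffle_right (hl : ∀ a b, deg (l a b) = deg a + deg b + c) (u v w : List L) :
    wordBracket deg c l (word R u) (shuffle deg (word R v) (word R w)) =
      shuffle deg (wordBracket deg c l (word R u) (word R v)) (word R w) +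
      (commSign R (wordDeg deg u) (wordDeg deg v) * commSign R c (wordDeg deg v)) •
        shuffle deg (word R v) (wordBracket deg c l (word R u) (word R w)) := by
  induction u generalizing v w with
  | nil =>
    simp only [wordBracket_nil_left, map_zero, LinearMap.zero_apply, smul_zero, add_zero]
  | cons a u ihu =>
    induction v generalizing w with
    | nil =>
      simp only [shuffle_nil_left, wordBracket_nil_right, wordDeg_nil, commSign_zero_right,
        one_smul, map_zero, LinearMap.zero_apply, zero_add, mul_one]
    | cons b v ihv =>
      induction w with
      | nil =>
        simp only [shuffle_nil_right, wordBracket_nil_right, map_zero, smul_zero, add_zero]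
      | cons e w ihw =>
        have hu := ihu (b :: v) (e :: w)
        have hv := ihv (e :: w)
        have contract_v := (shuffle_assoc_word (R := R) deg u v (e :: w)).symm
        have contract_w := shuffle_left_comm_word (R := R) deg u (b :: v) w
        clear ihu ihv
        simp only [word_cons, twist_cons, twist_word, twist_shuffle, map_smul, map_add,
          LinearMap.smul_apply, LinearMap.add_apply, hl, twist_wordBracket hl, wordDeg_cons,
          wordBracket_cons_cons, shuffle_cons_cons, smul_add, smul_smul, commSign_add_left,
          commSign_add_right] at hu hv contract_v contract_w ihw ⊢
        rw [eq_sub_of_add_eq hu, hv, contract_v, contract_w, ihw]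
        simp only [map_smul, map_add, map_sub, smul_add, smul_smul, smul_sub]
        simp only [mul_comm, mul_left_comm, commSign_comm, commSign_mul_cancel_left]
        abel

end Bracket

/-! ### Deconcatenation -/

section Deconcatenation

variable {R L M : Type*} [CommRing R]

/-- The sum of `β x y` over the cuts `w = x ++ y` of a word. -/
def cutSum [AddCommMonoid M] (β : List L → List L → M) : List L → M
  | [] => β [] []
  | a :: w => β [] (a :: w) + cutSum (fun x y => β (a :: x) y) w

theorem cutSum_congr [AddCommMonoid M] {β γ : List L → List L → M} {w : List L}
    (h : ∀ x y, x ++ y = w → β x y = γ x y) : cutSum β w = cutSum γ w := by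
  induction w generalizing β γ with
  | nil => exact h [] [] rfl
  | cons a w ih =>
    rw [cutSum, cutSum, h [] (a :: w) rfl,
      ih fun x y e => h (a :: x) y (by rw [List.cons_append, e])]

theorem cutSum_add [AddCommMonoid M] (β γ : List L → List L → M) (w : List L) :
    cutSum (fun x y => β x y + γ x y) w = cutSum β w + cutSum γ w := by
  induction w generalizing β γ with
  | nil => rfl
  | cons a w ih => simp only [cutSum, ih, add_add_add_comm]

theorem map_cutSum {N F : Type*} [AddCommMonoid M] [AddCommMonoid N] [FunLike F M N]
    [AddMonoidHomClass F M N] (f : F) (β : List L → List L → M) (w : List L) :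
    f (cutSum β w) = cutSum (fun x y => f (β x y)) w := by
  induction w generalizing β with
  | nil => rfl
  | cons a w ih => simp only [cutSum, map_add, ih]

theorem smul_cutSum [AddCommMonoid M] [Module R M] (r : R) (β : List L → List L → M)
    (w : List L) : r • cutSum β w = cutSum (fun x y => r • β x y) w :=
  map_cutSum (DistribSMul.toAddMonoidHom M r) β w

theorem cutSum_eq_of_right [AddCommMonoid M] {β : List L → List L → M}
    (h : ∀ x b y, β x (b :: y) = 0) (w : List L) : cutSum β w = β w [] := by
  induction w generalizing β with
  | nil => rfl
  | cons a w ih => rw [cutSum, h, zero_add, ih fun x b y => h _ b y]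

theorem cutSum_zero [AddCommMonoid M] (w : List L) : cutSum (fun _ _ => (0 : M)) w = 0 :=
  cutSum_eq_of_right (fun _ _ _ => rfl) w

theorem cutSum_eq_of_left [AddCommMonoid M] {β : List L → List L → M}
    (h : ∀ a x y, β (a :: x) y = 0) (w : List L) : cutSum β w = β [] w := by
  cases w with
  | nil => rfl
  | cons a w => simp only [cutSum, h, cutSum_zero, add_zero]

theorem cutSum_concat [AddCommMonoid M] (β : List L → List L → M) (w : List L) (b : L) :
    cutSum β (w ++ [b]) = cutSum (fun x y => β x (y ++ [b])) w + β (w ++ [b]) [] := by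
  induction w generalizing β with
  | nil => rfl
  | cons a w ih => simp only [List.cons_append, cutSum, ih, add_assoc]

/-- The sum of `γ x x' y y'` over the cuts `u = x ++ x'` and `v = y ++ y'` of two words. -/
def cutSum₂ [AddCommMonoid M] (γ : List L → List L → List L → List L → M) (u v : List L) : M :=
  cutSum (fun x x' => cutSum (fun y y' => γ x x' y y') v) u

theorem map_cutSum₂ {N F : Type*} [AddCommMonoid M] [AddCommMonoid N] [FunLike F M N]
    [AddMonoidHomClass F M N] (f : F) (γ : List L → List L → List L → List L → M)
    (u v : List L) : f (cutSum₂ γ u v) = cutSum₂ (fun x x' y y' => f (γ x x' y y')) u v := by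
  simp only [cutSum₂, map_cutSum]

theorem smul_cutSum₂ [AddCommMonoid M] [Module R M] (r : R)
    (γ : List L → List L → List L → List L → M) (u v : List L) :
    r • cutSum₂ γ u v = cutSum₂ (fun x x' y y' => r • γ x x' y y') u v :=
  map_cutSum₂ (DistribSMul.toAddMonoidHom M r) γ u v

theorem cutSum₂_zero [AddCommMonoid M] (u v : List L) :
    cutSum₂ (fun _ _ _ _ => (0 : M)) u v = 0 := by
  simp only [cutSum₂, cutSum_zero]

theorem cutSum₂_add [AddCommMonoid M] (γ γ' : List L → List L → List L → List L → M)
    (u v : List L) :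
    cutSum₂ (fun x x' y y' => γ x x' y y' + γ' x x' y y') u v = cutSum₂ γ u v + cutSum₂ γ' u v := by
  simp only [cutSum₂, cutSum_add]

theorem cutSum₂_cons_cons [AddCommMonoid M] {γ α β κ : List L → List L → List L → List L → M}
    {a b : L} {u v : List L}
    (h : ∀ x x' y y', x ++ x' = u →
      γ (a :: x) x' (b :: y) y' = α x x' (b :: y) y' + β (a :: x) x' y y' + κ x x' y y')
    (hα : ∀ x x', γ (a :: x) x' [] (b :: v) = α x x' [] (b :: v))
    (hβ : ∀ y y', γ [] (a :: u) (b :: y) y' = β [] (a :: u) y y') :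
    cutSum₂ γ (a :: u) (b :: v) = γ [] (a :: u) [] (b :: v) + cutSum₂ α u (b :: v) +
      cutSum₂ β (a :: u) v + cutSum₂ κ u v := by
  have split : cutSum (fun x x' => cutSum (fun y y' => γ (a :: x) x' (b :: y) y') v) u =
      cutSum (fun x x' => cutSum (fun y y' =>
        α x x' (b :: y) y' + β (a :: x) x' y y' + κ x x' y y') v) u :=
    cutSum_congr fun x x' hx => cutSum_congr fun y y' _ => h x x' y y' hx
  simp only [cutSum₂, cutSum, cutSum_add, split, hα, hβ]
  abel

/-- The deconcatenation coproduct. -/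
noncomputable def deconcat : Words R L →ₗ[R] Words R L ⊗[R] Words R L :=
  wordLift (cutSum fun x y => word R x ⊗ₜ word R y)

theorem deconcat_word (w : List L) :
    deconcat (word R w) = cutSum (fun x y => word R x ⊗ₜ[R] word R y) w :=
  wordLift_word _ _

theorem deconcat_cons (a : L) (t : Words R L) :
    deconcat (consLetter a t) =
      word R [] ⊗ₜ[R] consLetter a t + (consLetter a).rTensor _ (deconcat t) := by
  have : deconcat (R := R) ∘ₗ consLetter a = TensorProduct.mk R _ _ (word R []) ∘ₗ consLetter a +
      (consLetter a).rTensor (Words R L) ∘ₗ deconcat := by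
    refine words_hom_ext fun w => ?_
    simp only [LinearMap.comp_apply, LinearMap.add_apply, TensorProduct.mk_apply, ← word_cons,
      deconcat_word, cutSum, map_cutSum, LinearMap.rTensor_tmul]
  exact LinearMap.congr_fun this t

variable (R) (deg : L → ℤ) (c : ℤ) (l : L → L → L)

/-- The shuffle product of `x ⊗ x'` and `y ⊗ y'` in the graded tensor square of the shuffle
algebra. -/
noncomputable def shuffleCut (x x' y y' : List L) : Words R L ⊗[R] Words R L :=
  commSign R (wordDeg deg x') (wordDeg deg y) •
    (shuffle deg (word R x) (word R y) ⊗ₜ[R] shuffle deg (word R x') (word R y'))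

theorem shuffleCut_cons_cons (a b : L) (x x' y y' : List L) :
    shuffleCut R deg (a :: x) x' (b :: y) y' =
      (consLetter a).rTensor _ (shuffleCut R deg x x' (b :: y) y') +
      commSign R (deg b) (wordDeg deg (a :: (x ++ x'))) •
        (consLetter b).rTensor _ (shuffleCut R deg (a :: x) x' y y') := by
  simp only [shuffleCut, shuffle_word_cons_cons, TensorProduct.add_tmul, smul_add,
    ← TensorProduct.smul_tmul', smul_smul, wordDeg_cons, wordDeg_append, commSign_add_right,
    map_smul, LinearMap.rTensor_tmul]
  simp only [mul_comm, mul_left_comm, commSign_comm]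

theorem shuffleCut_nil_left (x' y y' : List L) :
    shuffleCut R deg [] x' y y' = commSign R (wordDeg deg x') (wordDeg deg y) •
      (word R y ⊗ₜ[R] shuffle deg (word R x') (word R y')) := by
  rw [shuffleCut, shuffle_nil_left]

theorem shuffleCut_nil_right (x x' y' : List L) :
    shuffleCut R deg x x' [] y' = word R x ⊗ₜ[R] shuffle deg (word R x') (word R y') := by
  rw [shuffleCut, shuffle_nil_right, wordDeg_nil, commSign_zero_right, one_smul]

theorem deconcat_shuffle (u v : List L) :
    deconcat (shuffle deg (word R u) (word R v)) = cutSum₂ (shuffleCut R deg) u v := by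
  induction u, v using shuffleWord.induct with
  | case1 v =>
    simp only [cutSum₂, cutSum, shuffleCut_nil_left, shuffle_nil_left, wordDeg_nil,
      commSign_zero_left, one_smul, deconcat_word]
  | case2 a u =>
    simp only [cutSum₂, cutSum, shuffleCut_nil_right, shuffle_nil_right, deconcat_word]
  | case3 a u b v ihu ihv =>
    rw [cutSum₂_cons_cons (κ := fun _ _ _ _ => 0)
        (α := fun x x' y y' => (consLetter a).rTensor _ (shuffleCut R deg x x' y y'))
        (β := fun x x' y y' => commSign R (deg b) (wordDeg deg (a :: u)) •
          (consLetter b).rTensor _ (shuffleCut R deg x x' y y'))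
        (fun x x' y y' hx => by rw [shuffleCut_cons_cons, hx, add_zero])
        (fun x x' => by
          simp only [shuffleCut_nil_right, LinearMap.rTensor_tmul, ← word_cons])
        (fun y y' => by
          simp only [shuffleCut_nil_left, map_smul, LinearMap.rTensor_tmul, ← word_cons,
            smul_smul, wordDeg_cons deg b, commSign_add_right, commSign_comm (deg b)]),
      cutSum₂_zero, add_zero, shuffleCut_nil_right, shuffle_word_cons_cons]
    simp only [map_add, map_smul, deconcat_cons, ihu, ihv, TensorProduct.tmul_add,
      TensorProduct.tmul_smul, smul_add, map_cutSum₂, smul_cutSum₂]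
    abel

/-- The bracket of `x ⊗ x'` and `y ⊗ y'` in the graded tensor square of the shuffle algebra:
the bracket acts as a biderivation, on one factor at a time. -/
noncomputable def bracketCut (x x' y y' : List L) : Words R L ⊗[R] Words R L :=
  commSign R (wordDeg deg x') (wordDeg deg y) •
    (wordBracket deg c l (word R x) (word R y) ⊗ₜ[R] shuffle deg (word R x') (word R y') +
      commSign R c (wordDeg deg x + wordDeg deg y) •
        (shuffle deg (word R x) (word R y) ⊗ₜ[R] wordBracket deg c l (word R x') (word R y')))

theorem bracketCut_cons_cons (a b : L) (x x' y y' : List L) :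
    bracketCut R deg c l (a :: x) x' (b :: y) y' =
      commSign R c (deg a) • (consLetter a).rTensor _ (bracketCut R deg c l x x' (b :: y) y') +
      (commSign R (deg b) (wordDeg deg (a :: (x ++ x'))) * commSign R c (deg b)) •
        (consLetter b).rTensor _ (bracketCut R deg c l (a :: x) x' y y') +
      commSign R (deg b) (wordDeg deg (x ++ x')) •
        (consLetter (l a b)).rTensor _ (shuffleCut R deg x x' y y') := by
  simp only [bracketCut, shuffleCut, map_smul, map_add, LinearMap.rTensor_tmul,
    shuffle_word_cons_cons, wordBracket_word_cons_cons, TensorProduct.add_tmul, smul_add,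
    ← TensorProduct.smul_tmul', smul_smul, wordDeg_cons, wordDeg_append, commSign_add_right]
  simp only [mul_comm, mul_left_comm, commSign_comm]
  abel

theorem bracketCut_nil_left (x' y y' : List L) :
    bracketCut R deg c l [] x' y y' =
      (commSign R (wordDeg deg x') (wordDeg deg y) * commSign R c (wordDeg deg y)) •
        (word R y ⊗ₜ[R] wordBracket deg c l (word R x') (word R y')) := by
  simp only [bracketCut, wordBracket_nil_left, TensorProduct.zero_tmul, zero_add,
    shuffle_nil_left, smul_smul, wordDeg_nil]

theorem bracketCut_nil_right (x x' y' : List L) :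
    bracketCut R deg c l x x' [] y' = commSign R c (wordDeg deg x) •
      (word R x ⊗ₜ[R] wordBracket deg c l (word R x') (word R y')) := by
  simp only [bracketCut, wordBracket_nil_right, TensorProduct.zero_tmul, zero_add,
    shuffle_nil_right, wordDeg_nil, commSign_zero_right, one_smul, add_zero]

theorem deconcat_wordBracket (u v : List L) :
    deconcat (wordBracket deg c l (word R u) (word R v)) =
      cutSum₂ (bracketCut R deg c l) u v := by
  induction u, v using shuffleWord.induct with
  | case1 v =>
    simp only [cutSum₂, cutSum, bracketCut_nil_left, wordBracket_nil_left, map_zero,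
      TensorProduct.tmul_zero, smul_zero, cutSum_zero]
  | case2 a u =>
    simp only [cutSum₂, cutSum, bracketCut_nil_right, wordBracket_nil_right, map_zero,
      TensorProduct.tmul_zero, smul_zero, cutSum_zero, add_zero]
  | case3 a u b v ihu ihv =>
    rw [cutSum₂_cons_cons
        (α := fun x x' y y' => commSign R c (deg a) •
          (consLetter a).rTensor _ (bracketCut R deg c l x x' y y'))
        (β := fun x x' y y' => (commSign R (deg b) (wordDeg deg (a :: u)) * commSign R c (deg b)) •
          (consLetter b).rTensor _ (bracketCut R deg c l x x' y y'))
        (κ := fun x x' y y' => commSign R (deg b) (wordDeg deg u) •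
          (consLetter (l a b)).rTensor _ (shuffleCut R deg x x' y y'))
        (fun x x' y y' hx => by rw [bracketCut_cons_cons, hx])
        (fun x x' => by
          simp only [bracketCut_nil_right, map_smul, LinearMap.rTensor_tmul, ← word_cons,
            smul_smul, wordDeg_cons, commSign_add_right])
        (fun y y' => by
          simp only [bracketCut_nil_left, map_smul, LinearMap.rTensor_tmul, ← word_cons,
            smul_smul, wordDeg_cons deg b, commSign_add_right, commSign_comm (deg b), mul_comm,
            mul_left_comm, mul_assoc]),
      bracketCut_nil_right, wordDeg_nil, commSign_zero_right, one_smul,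
      wordBracket_word_cons_cons]
    simp only [map_add, map_smul, deconcat_cons, ihu, ihv, deconcat_shuffle,
      TensorProduct.tmul_add, TensorProduct.tmul_smul, smul_add, map_cutSum₂,
      smul_cutSum₂]
    abel

end Deconcatenation

/-! ### The dual Dynkin map -/

section Dynkin

variable {R L M : Type*} [CommRing R] (deg : L → ℤ)

/-- The sign `(-1)^{n + ∑_{i < j} dᵢ dⱼ}` of the antipode on a word with letters of degrees
`d₁, …, dₙ`. -/
def antipodeSign (R : Type*) [CommRing R] : List L → R
  | [] => 1
  | a :: v => -(commSign R (deg a) (wordDeg deg v) * antipodeSign R v)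

theorem antipodeSign_concat (v : List L) (b : L) :
    antipodeSign deg R (v ++ [b]) =
      -(commSign R (deg b) (wordDeg deg v) * antipodeSign deg R v) := by
  induction v with
  | nil => rfl
  | cons a v ih =>
    rw [List.cons_append, antipodeSign, ih, antipodeSign, wordDeg_append, wordDeg_cons,
      wordDeg_cons, wordDeg_nil, add_zero, commSign_add_right, commSign_add_right,
      commSign_comm (deg b) (deg a)]
    ring

/-- The antipode of the shuffle Hopf algebra on a word: the signed reversed word. -/
noncomputable def antipode (R : Type*) [CommRing R] (w : List L) : Words R L :=
  antipodeSign deg R w • word R w.reverse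

theorem antipode_nil : antipode deg R ([] : List L) = word R [] := by
  rw [antipode, antipodeSign, one_smul, List.reverse_nil]

theorem antipode_concat (v : List L) (b : L) :
    antipode deg R (v ++ [b]) =
      -(commSign R (deg b) (wordDeg deg v) • consLetter b (antipode deg R v)) := by
  rw [antipode, antipode, antipodeSign_concat, List.reverse_append, List.reverse_singleton,
    List.singleton_append, word_cons, map_smul, smul_smul, neg_smul]

theorem antipode_singleton (b : L) : antipode deg R [b] = -word R [b] := by
  have := antipode_concat (R := R) deg [] b
  rwa [List.nil_append, wordDeg_nil, commSign_zero_right, one_smul, antipode_nil,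
    ← word_cons] at this

/-- The convolution of the words, weighted by a function `k` of their length, with the
antipode. -/
noncomputable def weightedConv (k : ℕ → R) (w : List L) : Words R L :=
  cutSum (fun x y => k x.length • shuffle deg (word R x) (antipode deg R y)) w

theorem weightedConv_nil (k : ℕ → R) : weightedConv deg k ([] : List L) = k 0 • word R [] := by
  rw [weightedConv, cutSum, antipode_nil, shuffle_nil_left, List.length_nil]

theorem weightedConv_singleton (k : ℕ → R) (a : L) :
    weightedConv deg k [a] = (k 1 - k 0) • word R [a] := by
  simp only [weightedConv, cutSum, antipode_singleton, antipode_nil, shuffle_nil_left,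
    shuffle_nil_right, List.length_nil, List.length_singleton]
  module

theorem weightedConv_cons_concat (k : ℕ → R) (a b : L) (w : List L) :
    weightedConv deg k (a :: (w ++ [b])) =
      consLetter a (weightedConv deg (fun n => k (n + 1)) (w ++ [b])) -
        commSign R (deg b) (wordDeg deg (a :: w)) • consLetter b (weightedConv deg k (a :: w)) := by
  have proper_cut (x y : List L) (hxy : x ++ y = w) :
      k (x.length + 1) • shuffle deg (word R (a :: x)) (antipode deg R (y ++ [b])) =
      k (x.length + 1) • consLetter a (shuffle deg (word R x) (antipode deg R (y ++ [b]))) +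
        -(commSign R (deg b) (wordDeg deg (a :: w))) • k (x.length + 1) •
          consLetter b (shuffle deg (word R (a :: x)) (antipode deg R y)) := by
    subst hxy
    rw [antipode_concat, word_cons]
    simp only [map_neg, map_smul, shuffle_cons_cons, twist_word, LinearMap.smul_apply, smul_add,
      smul_smul, wordDeg_cons, wordDeg_append, commSign_add_right, smul_neg]
    module
  have empty_cut := antipode_concat (R := R) deg (a :: w) b
  rw [List.cons_append] at empty_cut
  simp only [weightedConv, cutSum, cutSum_concat, List.length_cons, List.length_nil,
    shuffle_nil_left, empty_cut, map_add, map_smul, map_cutSum]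
  rw [cutSum_congr proper_cut, cutSum_add, ← smul_cutSum]
  simp only [antipode_nil, shuffle_nil_right, word_cons]
  module

theorem weightedConv_one {w : List L} (hw : w ≠ []) :
    weightedConv deg (fun _ => (1 : R)) w = 0 := by
  induction h : w.length generalizing w with
  | zero => exact absurd (List.length_eq_zero_iff.1 h) hw
  | succ n ih =>
    obtain ⟨a, w, rfl⟩ := List.exists_cons_of_length_eq_add_one h
    rw [List.length_cons, Nat.add_right_cancel_iff] at h
    obtain rfl | ⟨w, b, rfl⟩ := List.eq_nil_or_concat' w
    · rw [weightedConv_singleton, sub_self, zero_smul]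
    · rw [weightedConv_cons_concat, ih (by simp) h, ih (List.cons_ne_nil a w) (by simpa using h),
        map_zero, map_zero, smul_zero, sub_zero]

/-- The dual Dynkin map on a word: the convolution of the length-weighted words with the
antipode. -/
noncomputable def dynkin (R : Type*) [CommRing R] (w : List L) : Words R L :=
  weightedConv deg (fun n => (n : R)) w

theorem dynkin_nil : dynkin deg R ([] : List L) = 0 := by
  rw [dynkin, weightedConv_nil, Nat.cast_zero, zero_smul]

theorem dynkin_singleton (a : L) : dynkin deg R [a] = word R [a] := by
  rw [dynkin, weightedConv_singleton, Nat.cast_one, Nat.cast_zero, sub_zero, one_smul]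

theorem dynkin_cons_concat (a b : L) (w : List L) :
    dynkin deg R (a :: (w ++ [b])) = consLetter a (dynkin deg R (w ++ [b])) -
        commSign R (deg b) (wordDeg deg (a :: w)) • consLetter b (dynkin deg R (a :: w)) := by
  have shift_weight : weightedConv deg (fun n => ((n + 1 : ℕ) : R)) (w ++ [b]) =
      dynkin deg R (w ++ [b]) + weightedConv deg (fun _ => (1 : R)) (w ++ [b]) := by
    simp only [dynkin, weightedConv, ← cutSum_add, ← add_smul, Nat.cast_add, Nat.cast_one]
  rw [dynkin, weightedConv_cons_concat, shift_weight, weightedConv_one deg (by simp), add_zero]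
  rfl

-- Only the cut `x = w`, `y = []` of the convolution is not a proper shuffle.
theorem map_dynkin [AddCommMonoid M] [Module R M] (f : Words R L →ₗ[R] M)
    (hf : ∀ a u b v, f (shuffle deg (word R (a :: u)) (word R (b :: v))) = 0) (w : List L) :
    f (dynkin deg R w) = (w.length : R) • f (word R w) := by
  rw [dynkin, weightedConv, map_cutSum, cutSum_eq_of_right, antipode_nil, shuffle_nil_right,
    map_smul]
  intro x b y
  cases x with
  | nil => rw [List.length_nil, Nat.cast_zero, zero_smul, map_zero]
  | cons a x =>
    obtain ⟨e, z, h⟩ := List.exists_cons_of_ne_nil (l := (b :: y).reverse) (by simp)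
    rw [antipode, h, map_smul, map_smul, map_smul, hf, smul_zero, smul_zero]

end Dynkin

/-! ### The first letter of a shuffle -/

section FirstLetter

variable {n p : ℕ}

/-- The permutation fixing `0` and acting as `ρ` on the other elements. -/
def fixZero (ρ : Equiv.Perm (Fin n)) : Equiv.Perm (Fin (n + 1)) :=
  Equiv.Perm.decomposeFin.symm (0, ρ)

theorem fixZero_zero (ρ : Equiv.Perm (Fin n)) : fixZero ρ 0 = 0 :=
  Equiv.Perm.decomposeFin_symm_apply_zero 0 ρ

theorem fixZero_succ (ρ : Equiv.Perm (Fin n)) (i : Fin n) : fixZero ρ i.succ = (ρ i).succ := by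
  simp [fixZero]

theorem fixZero_symm_zero (ρ : Equiv.Perm (Fin n)) : (fixZero ρ).symm 0 = 0 := by
  rw [Equiv.symm_apply_eq, fixZero_zero]

theorem fixZero_symm_succ (ρ : Equiv.Perm (Fin n)) (i : Fin n) :
    (fixZero ρ).symm i.succ = (ρ.symm i).succ := by
  rw [Equiv.symm_apply_eq, fixZero_succ, Equiv.apply_symm_apply]

theorem fixZero_injective : Function.Injective (fixZero (n := n)) := fun _ _ h =>
  (Prod.ext_iff.1 (Equiv.Perm.decomposeFin.symm.injective h)).2

theorem exists_fixZero {σ : Equiv.Perm (Fin (n + 1))} (h : σ 0 = 0) : ∃ ρ, fixZero ρ = σ := by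
  obtain ⟨⟨x, ρ⟩, rfl⟩ := Equiv.Perm.decomposeFin.symm.surjective σ
  rw [Equiv.Perm.decomposeFin_symm_apply_zero] at h
  exact ⟨ρ, by rw [h, fixZero]⟩

theorem koszulSign_fixZero (d : Fin (n + 1) → ℤ) (ρ : Equiv.Perm (Fin n)) :
    koszulSign d (fixZero ρ) = koszulSign (fun i => d i.succ) ρ := by
  simp [koszulSign, Fin.prod_univ_succ, fixZero_zero, fixZero_succ]

theorem val_cycleRange (x i : Fin (n + 1)) :
    (x.cycleRange i).val =
      if i.val < x.val then i.val + 1 else if i.val = x.val then 0 else i.val := by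
  rcases lt_trichotomy i x with hi | rfl | hi
  · rw [Fin.coe_cycleRange_of_lt hi, if_pos (Fin.lt_def.1 hi)]
  · rw [Fin.cycleRange_self, if_neg (lt_irrefl _), if_pos rfl, Fin.val_zero]
  · rw [Fin.cycleRange_of_gt hi, if_neg (Fin.lt_def.1 hi).asymm, if_neg (Fin.lt_def.1 hi).ne']

theorem koszulSign_cycleRange (d : Fin (n + 1) → ℤ) (x : Fin (n + 1)) :
    koszulSign d x.cycleRange = (d x * ∑ i with i.val < x.val, d i).negOnePow := by
  have inversion_iff (i j : Fin (n + 1)) :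
      (i < j ∧ x.cycleRange j < x.cycleRange i) ↔ (i < x ∧ x = j) := by
    rw [Fin.lt_def, Fin.lt_def, Fin.lt_def, val_cycleRange, val_cycleRange, Fin.ext_iff]
    split_ifs <;> omega
  simp only [koszulSign, inversion_iff, ite_and]
  rw [Finset.mul_sum, Finset.sum_filter, negOnePow_sum]
  refine Finset.prod_congr rfl fun i _ => ?_
  by_cases hi : i < x
  · simp [hi, Fin.lt_def.1 hi, mul_comm]
  · simp [hi]

theorem fixZero_mem_battements {ρ : Equiv.Perm (Fin n)} :
    fixZero ρ ∈ battements (n + 1) (p + 1) ↔ ρ ∈ battements n p := by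
  simp only [mem_battements, Fin.forall_fin_succ, fixZero_zero, fixZero_succ]
  simp

theorem fixZero_mul_cycleRange_mem_battements (hp : p < n + 1) {ρ : Equiv.Perm (Fin n)} :
    fixZero ρ * (⟨p, hp⟩ : Fin (n + 1)).cycleRange ∈ battements (n + 1) p ↔
      ρ ∈ battements n p := by
  set x : Fin (n + 1) := ⟨p, hp⟩
  have succAbove_lt (j : Fin n) : (x.succAbove j).val < p ↔ j.val < p :=
    Fin.succAbove_lt_iff_castSucc_lt x j
  have le_succAbove (j : Fin n) : p ≤ (x.succAbove j).val ↔ p ≤ j.val := by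
    rw [← not_lt, succAbove_lt, not_lt]
  have apply_succAbove (j : Fin n) :
      (fixZero ρ * x.cycleRange) (x.succAbove j) = (ρ j).succ := by
    rw [Equiv.Perm.mul_apply, Fin.cycleRange_succAbove, fixZero_succ]
  have apply_self : (fixZero ρ * x.cycleRange) x = 0 := by
    rw [Equiv.Perm.mul_apply, Fin.cycleRange_self, fixZero_zero]
  simp only [mem_battements, Fin.forall_iff_succAbove x, apply_succAbove, apply_self,
    succAbove_lt, le_succAbove, Fin.succAbove_lt_succAbove_iff, Fin.succ_lt_succ_iff]
  have false_of_lt (j : Fin n) (h : x.succAbove j < x) : ¬ p ≤ j.val :=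
    not_le.2 ((succAbove_lt j).1 h)
  have hxp : ¬ x.val < p := lt_irrefl p
  simp +contextual only [false_of_lt, hxp, lt_irrefl, Fin.succ_pos, false_imp_iff, imp_true_iff,
    true_and]

theorem apply_eq_zero_of_mem_battements (hp : p < n + 1) {σ : Equiv.Perm (Fin (n + 1))}
    (hσ : σ ∈ battements (n + 1) p) (h0 : σ 0 ≠ 0) : σ ⟨p, hp⟩ = 0 := by
  obtain ⟨mono_lt, mono_ge⟩ := mem_battements.1 hσ
  obtain ⟨y, hy⟩ := σ.surjective 0
  have hy0 : 0 < y := Fin.pos_iff_ne_zero.2 fun h => h0 (h ▸ hy)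
  have hpy : p ≤ y.val := not_lt.1 fun h => Fin.not_lt_zero _ (hy ▸ mono_lt 0 y hy0 h)
  rcases hpy.eq_or_lt with rfl | h
  · exact hy
  · exact absurd (hy ▸ mono_ge ⟨p, hp⟩ y h le_rfl) (Fin.not_lt_zero _)

open Classical in
theorem battements_succ (hp : p + 1 < n + 1) :
    battements (n + 1) (p + 1) = (battements n p).image fixZero ∪
      (battements n (p + 1)).image fun ρ =>
        fixZero ρ * (⟨p + 1, hp⟩ : Fin (n + 1)).cycleRange := by
  set x : Fin (n + 1) := ⟨p + 1, hp⟩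
  ext σ
  simp only [Finset.mem_union, Finset.mem_image]
  constructor
  · intro hσ
    by_cases h0 : σ 0 = 0
    · obtain ⟨ρ, rfl⟩ := exists_fixZero h0
      exact Or.inl ⟨ρ, fixZero_mem_battements.1 hσ, rfl⟩
    · obtain ⟨ρ, hρ⟩ := exists_fixZero (σ := σ * x.cycleRange⁻¹) (by
        rw [Equiv.Perm.mul_apply, Equiv.Perm.inv_def, Fin.cycleRange_symm_zero,
          apply_eq_zero_of_mem_battements hp hσ h0])
      obtain rfl : fixZero ρ * x.cycleRange = σ := by rw [hρ, inv_mul_cancel_right]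
      exact Or.inr ⟨ρ, (fixZero_mul_cycleRange_mem_battements hp).1 hσ, rfl⟩
  · rintro (⟨ρ, hρ, rfl⟩ | ⟨ρ, hρ, rfl⟩)
    · exact fixZero_mem_battements.2 hρ
    · exact (fixZero_mul_cycleRange_mem_battements hp).2 hρ

theorem fixZero_ne_fixZero_mul_cycleRange (hp : p + 1 < n + 1) (ρ ρ' : Equiv.Perm (Fin n)) :
    fixZero ρ ≠ fixZero ρ' * (⟨p + 1, hp⟩ : Fin (n + 1)).cycleRange := by
  intro h
  have h0 := Equiv.congr_fun h ⟨p + 1, hp⟩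
  rw [Equiv.Perm.mul_apply, Fin.cycleRange_self, fixZero_zero] at h0
  exact Fin.succ_ne_zero _ ((fixZero_succ ρ ⟨p, Nat.succ_lt_succ_iff.1 hp⟩).symm.trans h0)

theorem sum_battements_succ {W : Type*} [AddCommMonoid W] (hp : p + 1 < n + 1)
    (F : Equiv.Perm (Fin (n + 1)) → W) :
    ∑ σ ∈ battements (n + 1) (p + 1), F σ = ∑ ρ ∈ battements n p, F (fixZero ρ) +
      ∑ ρ ∈ battements n (p + 1),
        F (fixZero ρ * (⟨p + 1, hp⟩ : Fin (n + 1)).cycleRange) := by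
  classical
  have disjoint : Disjoint ((battements n p).image fixZero)
      ((battements n (p + 1)).image fun ρ =>
        fixZero ρ * (⟨p + 1, hp⟩ : Fin (n + 1)).cycleRange) := by
    rw [Finset.disjoint_left]
    simp only [Finset.mem_image]
    rintro _ ⟨ρ, -, rfl⟩ ⟨ρ', -, h⟩
    exact fixZero_ne_fixZero_mul_cycleRange hp ρ ρ' h.symm
  rw [battements_succ hp, Finset.sum_union disjoint, Finset.sum_image fixZero_injective.injOn,
    Finset.sum_image fun ρ _ ρ' _ h => fixZero_injective (mul_right_cancel h)]

theorem ofFn_succAbove {L : Type*} (α : Fin (n + 1) → L) (x : Fin (n + 1)) :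
    (List.ofFn fun i => α (x.succAbove i)) =
      (List.ofFn α).take x ++ (List.ofFn α).drop (x + 1) := by
  rw [← List.eraseIdx_eq_take_drop_succ]
  refine List.ext_getElem (by simp [List.length_eraseIdx, x.is_lt]) fun i h₁ h₂ => ?_
  rw [List.getElem_eraseIdx, List.getElem_ofFn]
  simp only [List.length_ofFn] at h₁
  split_ifs with h
  · rw [List.getElem_ofFn, Fin.succAbove_of_castSucc_lt x ⟨i, h₁⟩ h, Fin.castSucc_mk]
  · rw [List.getElem_ofFn, Fin.succAbove_of_le_castSucc x ⟨i, h₁⟩ (not_lt.1 h), Fin.succ_mk]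

variable {R L : Type*} [CommRing R] (deg : L → ℤ)

theorem sum_battements_word_of_trivial (α : Fin n → L) (h : p = 0 ∨ n ≤ p) :
    ∑ σ ∈ battements n p, ((koszulSign (fun i => deg (α i)) σ : ℤ) : R) •
      word R (List.ofFn fun i => α (σ.symm i)) = word R (List.ofFn α) := by
  rw [battements_trivial h, Finset.sum_singleton, koszulSign_one, Units.val_one, Int.cast_one,
    one_smul]
  rfl

theorem sum_battements_word_succ (α : Fin (n + 1) → L) (hp : p + 1 < n + 1) :
    ∑ σ ∈ battements (n + 1) (p + 1), ((koszulSign (fun i => deg (α i)) σ : ℤ) : R) •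
        word R (List.ofFn fun i => α (σ.symm i)) =
      consLetter (α 0) (∑ ρ ∈ battements n p,
        ((koszulSign (fun i => deg (α i.succ)) ρ : ℤ) : R) •
          word R (List.ofFn fun i => α (ρ.symm i).succ)) +
      commSign R (deg (α ⟨p + 1, hp⟩)) (∑ i : Fin (n + 1) with i.val < p + 1, deg (α i)) •
        consLetter (α ⟨p + 1, hp⟩) (∑ ρ ∈ battements n (p + 1),
          ((koszulSign (fun i => deg (α (Fin.succAbove ⟨p + 1, hp⟩ i))) ρ : ℤ) : R) •
            word R (List.ofFn fun i => α (Fin.succAbove ⟨p + 1, hp⟩ (ρ.symm i)))) := by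
  set x : Fin (n + 1) := ⟨p + 1, hp⟩ with hx
  rw [sum_battements_succ hp, ← hx, map_sum, map_sum, Finset.smul_sum]
  simp only [map_smul, smul_smul, ← word_cons]
  congr 1 <;> refine Finset.sum_congr rfl fun ρ _ => ?_
  · rw [koszulSign_fixZero, List.ofFn_succ]
    simp only [fixZero_symm_zero, fixZero_symm_succ]
  · have symm_mul (i : Fin (n + 1)) : (fixZero ρ * x.cycleRange).symm i =
      x.cycleRange.symm ((fixZero ρ).symm i) := rfl
    rw [koszulSign_mul, koszulSign_fixZero, koszulSign_cycleRange,
      List.ofFn_succ (f := fun i => α ((fixZero ρ * x.cycleRange).symm i)), Units.val_mul,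
      Int.cast_mul]
    simp only [symm_mul, fixZero_symm_zero, fixZero_symm_succ, Fin.cycleRange_symm_zero,
      Fin.cycleRange_symm_succ, commSign]
    rfl

theorem sum_deg_eq_wordDeg_take (α : Fin n → L) (p : ℕ) :
    ∑ i : Fin n with i.val < p, deg (α i) = wordDeg deg ((List.ofFn α).take p) := by
  rw [wordDeg, List.map_take, List.map_ofFn, List.sum_take_ofFn]
  rfl

theorem sum_battements_word (α : Fin n → L) (hp : p ≤ n) :
    ∑ σ ∈ battements n p, ((koszulSign (fun i => deg (α i)) σ : ℤ) : R) •
        word R (List.ofFn fun i => α (σ.symm i)) =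
      shuffle deg (word R ((List.ofFn α).take p)) (word R ((List.ofFn α).drop p)) := by
  induction n generalizing p with
  | zero =>
    rw [sum_battements_word_of_trivial deg α (Or.inr (Nat.zero_le _)), List.ofFn_zero,
      List.take_nil, List.drop_nil, shuffle_nil_left]
  | succ n ih =>
    obtain _ | p := p
    · rw [sum_battements_word_of_trivial deg α (Or.inl rfl), List.take_zero,
        List.drop_zero, shuffle_nil_left]
    obtain hp' | hp' := hp.eq_or_lt
    · rw [sum_battements_word_of_trivial deg α (Or.inr hp'.ge),
        List.take_of_length_le (by simp [hp']), List.drop_of_length_le (by simp [hp']),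
        shuffle_nil_right]
    set x : Fin (n + 1) := ⟨p + 1, hp'⟩
    have take_eq : (List.ofFn α).take (p + 1) = α 0 :: (List.ofFn fun i => α i.succ).take p := by
      rw [List.ofFn_succ, List.take_succ_cons]
    have drop_eq : (List.ofFn α).drop (p + 1) = α x :: (List.ofFn α).drop (p + 2) := by
      rw [List.drop_eq_getElem_cons (by simpa using hp'), List.getElem_ofFn]
    have drop_tail : (List.ofFn α).drop (p + 1) = (List.ofFn fun i => α i.succ).drop p := by
      rw [List.ofFn_succ, List.drop_succ_cons]
    have first_left := ih (fun i => α i.succ) (p := p) (by omega)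
    have first_right := ih (fun i => α (x.succAbove i)) (p := p + 1) (by omega)
    have length_take : ((List.ofFn α).take x).length = p + 1 := by simp [x]; omega
    rw [ofFn_succAbove, List.take_left' length_take, List.drop_left' length_take] at first_right
    rw [sum_battements_word_succ deg α hp', first_left, first_right, sum_deg_eq_wordDeg_take,
      take_eq, drop_eq, shuffle_word_cons_cons, ← drop_eq, ← take_eq, drop_tail]

end FirstLetter

/-! ### The bracket of words as a sum over shuffle permutations -/

section Contraction

variable {R L : Type*} [CommRing R] (deg : L → ℤ) (c : ℤ) (l : L → L → L)

/-- Forgetting the colours of the letters. Colouring the letters of two words by `true` and `false`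
records, in their shuffles, the word each letter comes from. -/
noncomputable def uncolor : Words R (L × Bool) →ₗ[R] Words R L :=
  wordLift fun w => word R (w.map Prod.fst)

theorem uncolor_word_map (w : List L) (e : Bool) :
    uncolor (word R (w.map fun a => (a, e))) = word R w := by
  rw [uncolor, wordLift_word, List.map_map, Function.comp_def, List.map_id']

theorem uncolor_cons (a : L × Bool) (t : Words R (L × Bool)) :
    uncolor (consLetter a t) = consLetter a.1 (uncolor t) := by
  have : uncolor ∘ₗ consLetter a = consLetter a.1 ∘ₗ uncolor (R := R) :=
    words_hom_ext fun w => by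
      simp only [LinearMap.comp_apply, ← word_cons, uncolor, wordLift_word, List.map_cons]
  exact LinearMap.congr_fun this t

theorem wordDeg_map_color (w : List L) (e : Bool) :
    wordDeg (fun x : L × Bool => deg x.1) (w.map fun a => (a, e)) = wordDeg deg w := by
  rw [wordDeg, List.map_map, Function.comp_def, wordDeg]

theorem uncolor_shuffle (u v : List L) (e e' : Bool) :
    uncolor (shuffle (fun x : L × Bool => deg x.1) (word R (u.map fun a => (a, e)))
      (word R (v.map fun a => (a, e')))) = shuffle deg (word R u) (word R v) := by
  induction u, v using shuffleWord.induct with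
  | case1 v => rw [List.map_nil, shuffle_nil_left, shuffle_nil_left, uncolor_word_map]
  | case2 a u => rw [List.map_nil, shuffle_nil_right, shuffle_nil_right, uncolor_word_map]
  | case3 a u b v ihu ihv =>
    have hdeg := wordDeg_map_color deg (a :: u) e
    rw [List.map_cons] at ihu ihv hdeg
    rw [List.map_cons, List.map_cons, shuffle_word_cons_cons, map_add, map_smul, uncolor_cons,
      uncolor_cons, ihu, ihv, hdeg, shuffle_word_cons_cons]

/-- The contraction of `a` with the first letter of a word, if the colours of these two letters are
`true` and `false`, in this order. -/
noncomputable def contractHead (R : Type*) [CommRing R] (a : L × Bool) :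
    List (L × Bool) → Words R L
  | [] => 0
  | b :: w => if a.2 = true ∧ b.2 = false then word R (l a.1 b.1 :: w.map Prod.fst) else 0

/-- The signed sum of the contractions of the pairs of consecutive letters of colours `true` and
`false`, in this order. -/
noncomputable def contractAll (R : Type*) [CommRing R] : List (L × Bool) → Words R L
  | [] => 0
  | a :: w => commSign R c (deg a.1) • consLetter a.1 (contractAll R w) + contractHead l R a w

theorem contractHead_eq_zero {a : L × Bool} (ha : a.2 = false) (w : List (L × Bool)) :
    contractHead l R a w = 0 := by
  cases w with
  | nil => rfl
  | cons b w => rw [contractHead, if_neg fun h => Bool.false_ne_true (ha.symm.trans h.1)]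

theorem contractAll_map_color (w : List L) (e : Bool) :
    contractAll deg c l R (w.map fun a => (a, e)) = 0 := by
  induction w with
  | nil => rfl
  | cons a w ih =>
    have : contractHead l R (a, e) (w.map fun a => (a, e)) = 0 := by
      cases w with
      | nil => rfl
      | cons b w =>
        rw [List.map_cons, contractHead, if_neg fun h => Bool.false_ne_true (h.2.symm.trans h.1)]
    rw [List.map_cons, contractAll, ih, map_zero, smul_zero, zero_add, this]

theorem wordLift_contractAll_cons (a : L × Bool) (t : Words R (L × Bool)) :
    wordLift (contractAll deg c l R) (consLetter a t) =
      commSign R c (deg a.1) • consLetter a.1 (wordLift (contractAll deg c l R) t) +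
        wordLift (contractHead l R a) t := by
  have : wordLift (contractAll deg c l R) ∘ₗ consLetter a =
      commSign R c (deg a.1) • (consLetter a.1 ∘ₗ wordLift (contractAll deg c l R)) +
        wordLift (contractHead l R a) := words_hom_ext fun w => by
    simp only [LinearMap.comp_apply, LinearMap.add_apply, LinearMap.smul_apply, ← word_cons,
      wordLift_word, contractAll]
  exact LinearMap.congr_fun this t

theorem wordLift_contractHead_cons (a b : L × Bool) (t : Words R (L × Bool)) :
    wordLift (contractHead l R a) (consLetter b t) =
      if a.2 = true ∧ b.2 = false then consLetter (l a.1 b.1) (uncolor t) else 0 := by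
  have : wordLift (contractHead l R a) ∘ₗ consLetter b =
      if a.2 = true ∧ b.2 = false then consLetter (l a.1 b.1) ∘ₗ uncolor (R := R) else 0 :=
    words_hom_ext fun w => by
      split_ifs with h <;>
        simp only [LinearMap.comp_apply, ← word_cons, wordLift_word, contractHead, uncolor, h,
          and_self, if_true, if_false, LinearMap.zero_apply]
  rw [← LinearMap.comp_apply, this]
  split_ifs <;> rfl

theorem wordLift_contractHead_shuffle (a b : L) (u v : List L) :
    wordLift (contractHead l R (a, true)) (shuffle (fun x : L × Bool => deg x.1)
      (word R (u.map fun a => (a, true))) (word R ((b :: v).map fun a => (a, false)))) =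
      commSign R (deg b) (wordDeg deg u) •
        consLetter (l a b) (shuffle deg (word R u) (word R v)) := by
  rw [List.map_cons]
  cases u with
  | nil =>
    rw [List.map_nil, shuffle_nil_left, shuffle_nil_left, word_cons, wordLift_contractHead_cons,
      if_pos ⟨rfl, rfl⟩, uncolor_word_map, wordDeg_nil, commSign_zero_right, one_smul]
  | cons e u =>
    have hdeg := wordDeg_map_color deg (e :: u) true
    have huncolor := uncolor_shuffle (R := R) deg (e :: u) v true false
    rw [List.map_cons] at hdeg huncolor
    rw [List.map_cons, shuffle_word_cons_cons, map_add, map_smul, wordLift_contractHead_cons,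
      wordLift_contractHead_cons, if_neg fun h => Bool.false_ne_true h.2.symm, if_pos ⟨rfl, rfl⟩,
      zero_add, hdeg, huncolor]

theorem wordLift_contractAll_shuffle (u v : List L) :
    wordLift (contractAll deg c l R) (shuffle (fun x : L × Bool => deg x.1)
      (word R (u.map fun a => (a, true))) (word R (v.map fun a => (a, false)))) =
      wordBracket deg c l (word R u) (word R v) := by
  induction u, v using shuffleWord.induct with
  | case1 v =>
    rw [List.map_nil, shuffle_nil_left, wordLift_word, contractAll_map_color, wordBracket_nil_left]
  | case2 a u =>
    rw [List.map_nil, shuffle_nil_right, wordLift_word, contractAll_map_color,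
      wordBracket_nil_right]
  | case3 a u b v ihu ihv =>
    have hdeg := wordDeg_map_color deg (a :: u) true
    have head := wordLift_contractHead_shuffle (R := R) deg l a b u v
    have head_zero : wordLift (R := R) (contractHead l R (b, false)) = 0 :=
      words_hom_ext fun w => by rw [wordLift_word, contractHead_eq_zero l rfl, LinearMap.zero_apply]
    rw [List.map_cons] at ihu ihv head hdeg
    rw [List.map_cons, List.map_cons, shuffle_word_cons_cons, map_add, map_smul,
      wordLift_contractAll_cons, wordLift_contractAll_cons, ihu, ihv, head, head_zero, hdeg,
      wordBracket_word_cons_cons, LinearMap.zero_apply, add_zero, smul_smul]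
    abel

theorem contractNth_zero_eq_cons {α : Type*} {n : ℕ} (op : α → α → α) (g : Fin (n + 2) → α) :
    Fin.contractNth 0 op g = Fin.cons (op (g 0) (g 1)) fun i => g i.succ.succ := by
  funext k
  induction k using Fin.cases with
  | zero => rw [Fin.contractNth_apply_of_eq _ _ _ _ rfl]; rfl
  | succ k => rw [Fin.contractNth_apply_of_gt _ _ _ _ k.val.succ_pos]; rfl

theorem contractNth_succ_eq_cons {α : Type*} {n : ℕ} (j : Fin (n + 1)) (op : α → α → α)
    (g : Fin (n + 2) → α) :
    Fin.contractNth j.succ op g = Fin.cons (g 0) (Fin.contractNth j op fun i => g i.succ) := by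
  funext k
  induction k using Fin.cases with
  | zero => rw [Fin.contractNth_apply_of_lt _ _ _ _ j.val.succ_pos]; rfl
  | succ k =>
    rw [Fin.cons_succ]
    rcases lt_trichotomy k.val j.val with h | h | h
    · rw [Fin.contractNth_apply_of_lt _ _ _ _ (Nat.succ_lt_succ h),
        Fin.contractNth_apply_of_lt _ _ _ _ h]
      rfl
    · rw [Fin.contractNth_apply_of_eq _ _ _ _ (congrArg Nat.succ h),
        Fin.contractNth_apply_of_eq _ _ _ _ h]
      rfl
    · rw [Fin.contractNth_apply_of_gt _ _ _ _ (Nat.succ_lt_succ h),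
        Fin.contractNth_apply_of_gt _ _ _ _ h]

theorem contractAll_ofFn {n : ℕ} (α : Fin (n + 1) → L) (e : Fin (n + 1) → Bool) :
    contractAll deg c l R (List.ofFn fun i => (α i, e i)) =
      ∑ k : Fin n with e k.castSucc = true ∧ e k.succ = false,
        commSign R c (∑ s with s < k.castSucc, deg (α s)) •
          word R (List.ofFn (Fin.contractNth k.castSucc l α)) := by
  induction n with
  | zero => simp [contractAll, contractHead]
  | succ n ih =>
    rw [List.ofFn_succ, contractAll, ih (fun i => α i.succ) fun i => e i.succ, Finset.sum_filter,
      Finset.sum_filter, Fin.sum_univ_succ, add_comm, map_sum, Finset.smul_sum]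
    congr 1
    · rw [List.ofFn_succ, contractHead]
      refine if_congr Iff.rfl ?_ rfl
      rw [Fin.castSucc_zero, contractNth_zero_eq_cons, List.ofFn_succ]
      simp [commSign_zero_right, List.map_ofFn, Function.comp_def]
    · refine Finset.sum_congr rfl fun k _ => ?_
      rw [apply_ite (consLetter _), map_zero, smul_ite, smul_zero]
      refine if_congr Iff.rfl ?_ rfl
      have sum_deg : ∑ s with s < k.succ.castSucc, deg (α s) =
          deg (α 0) + ∑ s with s < k.castSucc, deg (α s.succ) := by
        rw [Finset.sum_filter, Finset.sum_filter, Fin.sum_univ_succ]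
        simp
      rw [sum_deg, commSign_add_right, ← Fin.succ_castSucc, contractNth_succ_eq_cons,
        List.ofFn_succ, map_smul, smul_smul, word_cons]
      rfl

theorem wordBracket_word_eq_sum {n p : ℕ} (α : Fin (n + 1) → L) (hp : p ≤ n + 1) :
    wordBracket deg c l (word R ((List.ofFn α).take p)) (word R ((List.ofFn α).drop p)) =
      ∑ σ ∈ battements (n + 1) p,
        ∑ k : Fin n with (σ.symm k.castSucc).val < p ∧ p ≤ (σ.symm k.succ).val,
          (((koszulSign (fun i => deg (α i)) σ *
            (c * ∑ s with s < k.castSucc, deg (α (σ.symm s))).negOnePow : ℤˣ) : ℤ) : R) •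
            word R (List.ofFn (Fin.contractNth k.castSucc l fun i => α (σ.symm i))) := by
  set β : Fin (n + 1) → L × Bool := fun i => (α i, decide (i.val < p))
  have take_β : (List.ofFn β).take p = ((List.ofFn α).take p).map fun a => (a, true) :=
    List.ext_getElem (by simp) fun i h _ => by
      have hi : i < p := (List.length_take ▸ h).trans_le (min_le_left _ _)
      simp [β, hi, -List.ofFn_succ]
  have drop_β : (List.ofFn β).drop p = ((List.ofFn α).drop p).map fun a => (a, false) :=
    List.ext_getElem (by simp) fun i _ _ => by simp [β, -List.ofFn_succ]
  rw [← wordLift_contractAll_shuffle, ← take_β, ← drop_β, ← sum_battements_word _ β hp, map_sum]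
  refine Finset.sum_congr rfl fun σ _ => ?_
  rw [map_smul, wordLift_word,
    contractAll_ofFn deg c l (fun i => α (σ.symm i)) fun i => decide ((σ.symm i).val < p),
    Finset.smul_sum]
  refine Finset.sum_congr ?_ fun k _ => ?_
  · simp only [decide_eq_true_eq, decide_eq_false_iff_not, not_lt]
  · rw [smul_smul, commSign, ← Int.cast_mul, ← Units.val_mul]

end Contraction

/-! ### Packets of words of homogeneous letters -/

section PacketWords

variable {𝕜 V : Type*} [Field 𝕜] [AddCommGroup V] [Module 𝕜 V] (𝒱 : ℤ → Submodule 𝕜 V)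

/-- The alphabet of the homogeneous vectors of `V`, together with their degrees; the zero vector
is a letter in each degree. -/
abbrev Letter : Type _ := Σ i : ℤ, 𝒱 i

/-- The degree of a homogeneous vector. -/
abbrev letterDeg (a : Letter 𝒱) : ℤ := a.1

/-- The packet of a word, which is `0` for the empty word. -/
noncomputable def wordPacket (w : List (Letter 𝒱)) : Packets 𝒱 :=
  packet 𝒱 fun i : Fin w.length => ((w.get i).2 : V)

/-- The linear extension of `wordPacket`. -/
noncomputable def packetOf : Words 𝕜 (Letter 𝒱) →ₗ[𝕜] Packets 𝒱 := wordLift (wordPacket 𝒱)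

theorem packetOf_word (w : List (Letter 𝒱)) : packetOf 𝒱 (word 𝕜 w) = wordPacket 𝒱 w :=
  wordLift_word _ _

theorem packet_cast {m n : ℕ} (h : m = n) (v : Fin n → V) :
    packet 𝒱 (fun i => v (Fin.cast h i)) = packet 𝒱 v := by
  subst h
  rfl

theorem wordPacket_ofFn {n : ℕ} (α : Fin n → Letter 𝒱) :
    wordPacket 𝒱 (List.ofFn α) = packet 𝒱 fun i => ((α i).2 : V) := by
  rw [wordPacket, ← packet_cast 𝒱 (List.length_ofFn (f := α))]
  congr 1
  funext i
  rw [List.get_eq_getElem, List.getElem_ofFn]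
  rfl

theorem wordPacket_nil : wordPacket 𝒱 [] = 0 := packet_zero 𝒱 _

theorem packetOf_shuffle_ofFn {n p : ℕ} (hp : p ≤ n) (α : Fin n → Letter 𝒱) :
    packetOf 𝒱 (shuffle (letterDeg 𝒱) (word 𝕜 ((List.ofFn α).take p))
        (word 𝕜 ((List.ofFn α).drop p))) =
      cls 𝒱 n (bat p (fun i => (α i).1) fun i => ((α i).2 : V)) := by
  rw [← sum_battements_word (letterDeg 𝒱) α hp, bat, map_sum, map_sum]
  refine Finset.sum_congr rfl fun σ _ => ?_
  rw [map_smul, map_smul, packetOf_word, wordPacket_ofFn]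
  rfl

theorem packetOf_shuffle_eq_zero (a : Letter 𝒱) (u : List (Letter 𝒱)) (b : Letter 𝒱)
    (v : List (Letter 𝒱)) :
    packetOf 𝒱 (shuffle (letterDeg 𝒱) (word 𝕜 (a :: u)) (word 𝕜 (b :: v))) = 0 := by
  have h := packetOf_shuffle_ofFn 𝒱 (n := (a :: u ++ b :: v).length) (p := (a :: u).length)
    (by simp) (a :: u ++ b :: v).get
  rw [List.ofFn_get, List.take_left, List.drop_left] at h
  rw [h]
  exact cls_of_mem 𝒱 (mem_batImage (by simp) (by simp) fun i => ((a :: u ++ b :: v).get i).2.2)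

theorem cogenProj_singleton (a : Letter 𝒱) : cogenProj 𝒱 (wordPacket 𝒱 [a]) = (a.2 : V) := by
  change cogenProj 𝒱 (DirectSum.lof 𝕜 ℕ (fun n => PacketPower 𝒱 (n + 1)) 0
    (PacketPower.mk 𝒱 1 (PiTensorProduct.tprod 𝕜 _))) = _
  rw [cogenProj, LinearMap.comp_apply, DirectSum.component.lof_self]
  erw [PacketPower.lift_mk]
  exact PiTensorProduct.subsingletonEquiv_apply_tprod 0 _

theorem cogenProj_of_length_ne_one {w : List (Letter 𝒱)} (h : w.length ≠ 1) :
    cogenProj 𝒱 (wordPacket 𝒱 w) = 0 := by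
  rcases w with _ | ⟨a, _ | ⟨b, w⟩⟩
  · rw [wordPacket_nil, map_zero]
  · exact absurd List.length_singleton h
  · change cogenProj 𝒱 (DirectSum.lof 𝕜 ℕ (fun n => PacketPower 𝒱 (n + 1)) (w.length + 1) _) = 0
    rw [cogenProj, LinearMap.comp_apply, DirectSum.component.of,
      dif_neg (Nat.succ_ne_zero _), map_zero]

/-- The linear map multiplying a packet of length `n` by `n`. -/
noncomputable def lengthMap : Packets 𝒱 →ₗ[𝕜] Packets 𝒱 :=
  DirectSum.lmap fun n : ℕ => ((n + 1 : ℕ) : 𝕜) • LinearMap.id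

theorem lengthMap_wordPacket (w : List (Letter 𝒱)) :
    lengthMap 𝒱 (wordPacket 𝒱 w) = (w.length : 𝕜) • wordPacket 𝒱 w := by
  cases w with
  | nil => rw [wordPacket_nil, map_zero, smul_zero]
  | cons a w =>
    change lengthMap 𝒱 (DirectSum.lof 𝕜 ℕ (fun n => PacketPower 𝒱 (n + 1)) w.length _) = _
    rw [lengthMap, DirectSum.lmap_lof, LinearMap.smul_apply, map_smul]
    rfl

theorem lengthMap_injective [CharZero 𝕜] : Function.Injective (lengthMap 𝒱) := by
  rw [injective_iff_map_eq_zero]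
  intro z hz
  ext n : 1
  have h := congrArg (fun y : Packets 𝒱 => y n) hz
  simp only [lengthMap, DirectSum.lmap_apply, LinearMap.smul_apply, LinearMap.id_apply,
    DirectSum.zero_apply] at h
  exact (smul_eq_zero.1 h).resolve_left (Nat.cast_ne_zero.2 n.succ_ne_zero)

theorem cutSum_eq_sum_antidiagonal {L M : Type*} [AddCommMonoid M] (β : List L → List L → M)
    (w : List L) : cutSum β w =
      ∑ x ∈ Finset.HasAntidiagonal.antidiagonal w.length, β (w.take x.1) (w.drop x.1) := by
  induction w generalizing β with
  | nil => exact (Finset.sum_singleton _ _).symm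
  | cons a w ih =>
    rw [cutSum, ih, List.length_cons, Finset.Nat.sum_antidiagonal_succ]
    rfl

theorem cut_get (w : List (Letter 𝒱)) {j m : ℕ} (h : j + m = w.length) :
    cut 𝒱 j m h (PiTensorProduct.tprod 𝕜 fun i => ((w.get i).2 : V)) =
      wordPacket 𝒱 (w.take j) ⊗ₜ[𝕜] wordPacket 𝒱 (w.drop j) := by
  have take_eq : w.take j = List.ofFn fun i : Fin j => w.get (Fin.cast h (Fin.castAdd m i)) :=
    List.ext_getElem (by simp [← h]) fun i _ _ => by simp [-List.ofFn_succ]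
  have drop_eq : w.drop j = List.ofFn fun i : Fin m => w.get (Fin.cast h (Fin.natAdd j i)) :=
    List.ext_getElem (by simp [← h]) fun i _ _ => by simp [-List.ofFn_succ]
  rw [cut_tprod, take_eq, drop_eq, wordPacket_ofFn, wordPacket_ofFn]

theorem sum_get_eq_wordDeg {L : Type*} (deg : L → ℤ) (w : List L) :
    ∑ i, deg (w.get i) = wordDeg deg w := by
  rw [wordDeg, ← Fin.sum_univ_fun_getElem]
  rfl

variable [DirectSum.Decomposition 𝒱]

section Extensionality

variable {W : Type*} [AddCommGroup W] [Module 𝕜 W]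

theorem multilinear_ext_homogeneous {n : ℕ} {f g : MultilinearMap 𝕜 (fun _ : Fin n => V) W}
    (h : ∀ α : Fin n → Letter 𝒱, f (fun i => ((α i).2 : V)) = g fun i => ((α i).2 : V)) :
    f = g := by
  classical
  ext v
  have sum_decompose : v = fun i => ∑ k ∈ (DirectSum.decompose 𝒱 (v i)).support,
      (DirectSum.decompose 𝒱 (v i) k : V) :=
    funext fun i => (DirectSum.sum_support_decompose 𝒱 (v i)).symm
  rw [sum_decompose, MultilinearMap.map_sum_finset, MultilinearMap.map_sum_finset]
  exact Finset.sum_congr rfl fun r _ => h fun i => ⟨r i, DirectSum.decompose 𝒱 (v i) (r i)⟩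

theorem packets_hom_ext {f g : Packets 𝒱 →ₗ[𝕜] W}
    (h : ∀ w, f (wordPacket 𝒱 w) = g (wordPacket 𝒱 w)) : f = g := by
  refine DirectSum.linearMap_ext _ fun n => Submodule.linearMap_qext _ <|
    PiTensorProduct.ext <| multilinear_ext_homogeneous 𝒱 fun α => ?_
  have := h (List.ofFn α)
  rw [wordPacket_ofFn] at this
  exact this

theorem span_wordPacket : Submodule.span 𝕜 (Set.range (wordPacket 𝒱)) = ⊤ := by
  rw [← Submodule.ker_mkQ (Submodule.span 𝕜 (Set.range (wordPacket 𝒱))), LinearMap.ker_eq_top]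
  refine packets_hom_ext 𝒱 fun w => ?_
  rw [LinearMap.zero_apply, Submodule.mkQ_apply, Submodule.Quotient.mk_eq_zero]
  exact Submodule.subset_span ⟨w, rfl⟩

end Extensionality

theorem packetTwist_wordPacket (c : ℤ) (w : List (Letter 𝒱)) :
    packetTwist 𝒱 c (wordPacket 𝒱 w) =
      commSign 𝕜 c (wordDeg (letterDeg 𝒱) w) • wordPacket 𝒱 w := by
  rw [wordPacket, packetTwist_packet 𝒱 c (d := fun i => (w.get i).1) fun i => (w.get i).2.2,
    sum_get_eq_wordDeg (letterDeg 𝒱), commSign]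

theorem volte_wordPacket [CharZero 𝕜] (u v : List (Letter 𝒱)) :
    volte 𝒱 (wordPacket 𝒱 u ⊗ₜ wordPacket 𝒱 v) =
      commSign 𝕜 (wordDeg (letterDeg 𝒱) u) (wordDeg (letterDeg 𝒱) v) •
        (wordPacket 𝒱 v ⊗ₜ[𝕜] wordPacket 𝒱 u) := by
  rw [wordPacket, wordPacket, volte_packet 𝒱 (d := fun i => (u.get i).1)
    (e := fun i => (v.get i).1) (fun i => (u.get i).2.2) fun i => (v.get i).2.2,
    sum_get_eq_wordDeg (letterDeg 𝒱), sum_get_eq_wordDeg (letterDeg 𝒱), commSign]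

theorem cobracket_wordPacket [CharZero 𝕜] (w : List (Letter 𝒱)) :
    cobracket 𝒱 (wordPacket 𝒱 w) =
      cutSum (fun u v => wordPacket 𝒱 u ⊗ₜ[𝕜] wordPacket 𝒱 v) w -
        volte 𝒱 (cutSum (fun u v => wordPacket 𝒱 u ⊗ₜ[𝕜] wordPacket 𝒱 v) w) := by
  have cobracket_eq : cobracket 𝒱 (wordPacket 𝒱 w) = tensorCobracket 𝒱 w.length
      (PiTensorProduct.tprod 𝕜 fun i => ((w.get i).2 : V)) := by
    cases w with
    | nil =>
      rw [wordPacket_nil, map_zero, tensorCobracket, LinearMap.comp_apply, LinearMap.sum_apply,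
        Finset.sum_eq_zero, map_zero]
      intro x _
      rw [cut_get, List.take_nil, wordPacket_nil, TensorProduct.zero_tmul]
    | cons a w =>
      change cobracket 𝒱 (DirectSum.lof 𝕜 ℕ (fun n => PacketPower 𝒱 (n + 1)) w.length _) = _
      rw [cobracket, DirectSum.toModule_lof]
      rfl
  rw [cobracket_eq, tensorCobracket, LinearMap.comp_apply, LinearMap.sum_apply,
    LinearMap.sub_apply, LinearMap.id_apply, cutSum_eq_sum_antidiagonal]
  simp only [cut_get]
  rw [Finset.sum_coe_sort (Finset.HasAntidiagonal.antidiagonal w.length)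
    fun x : ℕ × ℕ => wordPacket 𝒱 (w.take x.1) ⊗ₜ[𝕜] wordPacket 𝒱 (w.drop x.1)]

end PacketWords

/-! ### The kernel of the cobracket -/

section CobracketKernel

variable {𝕜 V : Type*} [Field 𝕜] [AddCommGroup V] [Module 𝕜 V] (𝒱 : ℤ → Submodule 𝕜 V)

/-- The tensor given by a linear combination of words. -/
noncomputable def tensorOf : Words 𝕜 (Letter 𝒱) →ₗ[𝕜] TensorAlgebra 𝕜 V :=
  wordLift fun w => (w.map fun a => TensorAlgebra.ι 𝕜 (a.2 : V)).prod

theorem tensorOf_word (w : List (Letter 𝒱)) :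
    tensorOf 𝒱 (word 𝕜 w) = (w.map fun a => TensorAlgebra.ι 𝕜 (a.2 : V)).prod :=
  wordLift_word _ _

theorem tensorOf_cons (a : Letter 𝒱) (t : Words 𝕜 (Letter 𝒱)) :
    tensorOf 𝒱 (consLetter a t) = TensorAlgebra.ι 𝕜 (a.2 : V) * tensorOf 𝒱 t := by
  have : tensorOf 𝒱 ∘ₗ consLetter a =
      LinearMap.mulLeft 𝕜 (TensorAlgebra.ι 𝕜 (a.2 : V)) ∘ₗ tensorOf 𝒱 :=
    words_hom_ext fun w => by
      simp only [LinearMap.comp_apply, ← word_cons, tensorOf_word, List.map_cons, List.prod_cons,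
        LinearMap.mulLeft_apply]
  exact LinearMap.congr_fun this t

/-- The class in `⨂̲⁺ V` of a tensor. -/
noncomputable def tensorCls : TensorAlgebra 𝕜 V →ₗ[𝕜] Packets 𝒱 :=
  DirectSum.toModule 𝕜 ℕ _ (cls 𝒱) ∘ₗ TensorAlgebra.toDirectSum.toLinearMap

theorem tensorCls_tensorOf (t : Words 𝕜 (Letter 𝒱)) :
    tensorCls 𝒱 (tensorOf 𝒱 t) = packetOf 𝒱 t := by
  have : tensorCls 𝒱 ∘ₗ tensorOf 𝒱 = packetOf 𝒱 := words_hom_ext fun w => by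
    have prod_eq_tprod : (w.map fun a => TensorAlgebra.ι 𝕜 (a.2 : V)).prod =
        TensorAlgebra.tprod 𝕜 V w.length fun i => ((w.get i).2 : V) := by
      rw [TensorAlgebra.tprod_apply]
      congr 1
      exact List.ext_getElem (by simp) fun i _ _ => by simp [-List.ofFn_succ]
    rw [LinearMap.comp_apply, tensorOf_word, prod_eq_tprod, tensorCls, LinearMap.comp_apply,
      AlgHom.toLinearMap_apply, TensorAlgebra.toDirectSum_tensorPower_tprod, packetOf_word,
      ← DirectSum.lof_eq_of 𝕜, DirectSum.toModule_lof]
    rfl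
  exact LinearMap.congr_fun this t

variable [DirectSum.Decomposition 𝒱] [CharZero 𝕜]

theorem map_cobracket_wordPacket {M : Type*} [AddCommGroup M] [Module 𝕜 M]
    (f : Packets 𝒱 ⊗[𝕜] Packets 𝒱 →ₗ[𝕜] M) (w : List (Letter 𝒱)) :
    f (cobracket 𝒱 (wordPacket 𝒱 w)) =
      cutSum (fun u v => f (wordPacket 𝒱 u ⊗ₜ wordPacket 𝒱 v)) w -
      cutSum (fun u v => commSign 𝕜 (wordDeg (letterDeg 𝒱) u) (wordDeg (letterDeg 𝒱) v) •
        f (wordPacket 𝒱 v ⊗ₜ wordPacket 𝒱 u)) w := by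
  simp only [cobracket_wordPacket, map_sub, map_cutSum, volte_wordPacket, map_smul]

/-- The map sending `X` to the tensor `pr(X)` plus the product of `pr` and of the previous
iterate, applied to `δ(X)`. It carries a packet of length at most `N` to its image under the dual
Dynkin map, which shows that the latter depends on the packet only. -/
noncomputable def iteratedCobracket : ℕ → Packets 𝒱 →ₗ[𝕜] TensorAlgebra 𝕜 V
  | 0 => 0
  | N + 1 => TensorAlgebra.ι 𝕜 ∘ₗ cogenProj 𝒱 + LinearMap.mul' 𝕜 (TensorAlgebra 𝕜 V) ∘ₗ
      TensorProduct.map (TensorAlgebra.ι 𝕜 ∘ₗ cogenProj 𝒱) (iteratedCobracket N) ∘ₗ cobracket 𝒱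

theorem iteratedCobracket_succ_wordPacket (N : ℕ) (w : List (Letter 𝒱)) :
    iteratedCobracket 𝒱 (N + 1) (wordPacket 𝒱 w) =
      TensorAlgebra.ι 𝕜 (cogenProj 𝒱 (wordPacket 𝒱 w)) +
      (cutSum (fun u v => TensorAlgebra.ι 𝕜 (cogenProj 𝒱 (wordPacket 𝒱 u)) *
          iteratedCobracket 𝒱 N (wordPacket 𝒱 v)) w -
        cutSum (fun u v => commSign 𝕜 (wordDeg (letterDeg 𝒱) u) (wordDeg (letterDeg 𝒱) v) •
          (TensorAlgebra.ι 𝕜 (cogenProj 𝒱 (wordPacket 𝒱 v)) *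
            iteratedCobracket 𝒱 N (wordPacket 𝒱 u))) w) := by
  rw [iteratedCobracket, LinearMap.add_apply, ← LinearMap.comp_assoc, LinearMap.comp_apply,
    LinearMap.comp_apply _ (cobracket 𝒱), map_cobracket_wordPacket]
  simp only [LinearMap.comp_apply, TensorProduct.map_tmul, LinearMap.mul'_apply]

theorem iteratedCobracket_succ_cons_concat (N : ℕ) (a b : Letter 𝒱) (w : List (Letter 𝒱)) :
    iteratedCobracket 𝒱 (N + 1) (wordPacket 𝒱 (a :: (w ++ [b]))) =
      TensorAlgebra.ι 𝕜 (a.2 : V) * iteratedCobracket 𝒱 N (wordPacket 𝒱 (w ++ [b])) -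
        commSign 𝕜 (letterDeg 𝒱 b) (wordDeg (letterDeg 𝒱) (a :: w)) •
          (TensorAlgebra.ι 𝕜 (b.2 : V) * iteratedCobracket 𝒱 N (wordPacket 𝒱 (a :: w))) := by
  have proj_cons_cons (e e' : Letter 𝒱) (x : List (Letter 𝒱)) :
      cogenProj 𝒱 (wordPacket 𝒱 (e :: e' :: x)) = 0 :=
    cogenProj_of_length_ne_one 𝒱 (by simp)
  have proj_cons_concat (e e' : Letter 𝒱) (x : List (Letter 𝒱)) :
      cogenProj 𝒱 (wordPacket 𝒱 (e :: (x ++ [e']))) = 0 :=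
    cogenProj_of_length_ne_one 𝒱 (by simp)
  rw [iteratedCobracket_succ_wordPacket, proj_cons_concat, map_zero, zero_add]
  congr 1
  · rw [cutSum, cutSum_eq_of_left, wordPacket_nil, map_zero, map_zero, zero_mul, zero_add,
      cogenProj_singleton]
    intro e x y
    rw [proj_cons_cons, map_zero, zero_mul]
  · rw [← List.cons_append, cutSum_concat, cutSum_eq_of_right, wordPacket_nil, map_zero, map_zero,
      zero_mul, smul_zero, add_zero, List.nil_append, cogenProj_singleton, commSign_comm,
      wordDeg_cons _ b, wordDeg_nil, add_zero]
    intro x e y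
    rw [List.cons_append, proj_cons_concat, map_zero, zero_mul, smul_zero]

theorem iteratedCobracket_wordPacket {N : ℕ} {w : List (Letter 𝒱)} (hw : w.length ≤ N) :
    iteratedCobracket 𝒱 N (wordPacket 𝒱 w) = tensorOf 𝒱 (dynkin (letterDeg 𝒱) 𝕜 w) := by
  induction N generalizing w with
  | zero =>
    rw [List.length_eq_zero_iff.1 (Nat.le_zero.1 hw), dynkin_nil, wordPacket_nil, map_zero,
      map_zero]
  | succ N ih =>
    rcases w with _ | ⟨a, w⟩
    · rw [dynkin_nil, wordPacket_nil, map_zero, map_zero]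
    obtain rfl | ⟨w, b, rfl⟩ := List.eq_nil_or_concat' w
    · rw [iteratedCobracket_succ_wordPacket, cogenProj_singleton, dynkin_singleton, tensorOf_word]
      simp only [cutSum, wordPacket_nil, map_zero, zero_mul, mul_zero, smul_zero, add_zero,
        sub_zero, List.map_cons, List.map_nil, List.prod_singleton]
    · rw [List.length_cons, List.length_append, List.length_singleton] at hw
      rw [iteratedCobracket_succ_cons_concat, ih (by simpa using hw), ih (by simpa using hw),
        dynkin_cons_concat, map_sub, map_smul, tensorOf_cons, tensorOf_cons]

theorem exists_tensorCls_iteratedCobracket (z : Packets 𝒱) :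
    ∃ N₀, ∀ N ≥ N₀, tensorCls 𝒱 (iteratedCobracket 𝒱 N z) = lengthMap 𝒱 z := by
  have mem_span : z ∈ Submodule.span 𝕜 (Set.range (wordPacket 𝒱)) :=
    span_wordPacket 𝒱 ▸ Submodule.mem_top
  induction mem_span using Submodule.span_induction with
  | mem z hz =>
    obtain ⟨w, rfl⟩ := hz
    refine ⟨w.length, fun N hN => ?_⟩
    rw [iteratedCobracket_wordPacket 𝒱 hN, tensorCls_tensorOf,
      map_dynkin _ _ (packetOf_shuffle_eq_zero 𝒱), packetOf_word, lengthMap_wordPacket]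
  | zero => exact ⟨0, fun N _ => by simp only [map_zero]⟩
  | add x y _ _ hx hy =>
    obtain ⟨N₁, h₁⟩ := hx
    obtain ⟨N₂, h₂⟩ := hy
    refine ⟨max N₁ N₂, fun N hN => ?_⟩
    rw [map_add, map_add, map_add, h₁ N (le_of_max_le_left hN), h₂ N (le_of_max_le_right hN)]
  | smul r x _ hx =>
    obtain ⟨N₁, h₁⟩ := hx
    exact ⟨N₁, fun N hN => by rw [map_smul, map_smul, map_smul, h₁ N hN]⟩

theorem eq_zero_of_cobracket_eq_zero {z : Packets 𝒱} (hδ : cobracket 𝒱 z = 0)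
    (hp : cogenProj 𝒱 z = 0) : z = 0 := by
  obtain ⟨N, hN⟩ := exists_tensorCls_iteratedCobracket 𝒱 z
  apply lengthMap_injective 𝒱
  rw [← hN (N + 1) (Nat.le_succ N), iteratedCobracket]
  simp only [LinearMap.add_apply, LinearMap.comp_apply, hδ, hp, map_zero, add_zero]

end CobracketKernel

/-! ### The bracket of packets -/

section Multilinear

variable {𝕜 V W : Type*} [Field 𝕜] [AddCommGroup V] [Module 𝕜 V] [AddCommGroup W] [Module 𝕜 W]

theorem contractNth_update {n : ℕ} [DecidableEq (Fin (n + 1))] (l : V →ₗ[𝕜] V →ₗ[𝕜] V)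
    (k : Fin n) (v : Fin (n + 1) → V) (i : Fin (n + 1)) :
    ∃ (j : Fin n) (f : V →ₗ[𝕜] V), ∀ x,
      Fin.contractNth k.castSucc (fun u v => l u v) (Function.update v i x) =
        Function.update (Fin.contractNth k.castSucc (fun u v => l u v) v) j (f x) := by
  have contractNth_apply (g : Fin (n + 1) → V) (m : Fin n) :
      Fin.contractNth k.castSucc (fun u v => l u v) g m =
        if m.val < k.val then g m.castSucc else
          if m.val = k.val then l (g m.castSucc) (g m.succ) else g m.succ := rfl
  obtain hi | hi | hi | hi : i.val < k.val ∨ i.val = k.val ∨ i.val = k.val + 1 ∨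
    k.val + 1 < i.val := by omega
  on_goal 1 => refine ⟨⟨i.val, by omega⟩, LinearMap.id, fun x => ?_⟩
  on_goal 2 => refine ⟨k, l.flip (v k.succ), fun x => ?_⟩
  on_goal 3 => refine ⟨k, l (v k.castSucc), fun x => ?_⟩
  on_goal 4 => refine ⟨⟨i.val - 1, by omega⟩, LinearMap.id, fun x => ?_⟩
  all_goals
    funext m
    simp only [contractNth_apply, Function.update_apply, Fin.ext_iff, Fin.val_castSucc,
      Fin.val_succ, LinearMap.id_apply, LinearMap.flip_apply]
    split_ifs <;> first | rfl | omega | rw [show m = k from Fin.ext ‹m.val = k.val›]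

/-- The composition of a multilinear map with the contraction of two consecutive arguments. -/
def contractMultilinear {n : ℕ} (l : V →ₗ[𝕜] V →ₗ[𝕜] V) (k : Fin n)
    (f : MultilinearMap 𝕜 (fun _ : Fin n => V) W) :
    MultilinearMap 𝕜 (fun _ : Fin (n + 1) => V) W where
  toFun v := f (Fin.contractNth k.castSucc (fun u v => l u v) v)
  map_update_add' v i x y := by
    obtain ⟨j, g, h⟩ := contractNth_update l k v i
    rw [h, h, h, map_add, MultilinearMap.map_update_add]
  map_update_smul' v i r x := by
    obtain ⟨j, g, h⟩ := contractNth_update l k v i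
    rw [h, h, map_smul, MultilinearMap.map_update_smul]

theorem exists_multilinear_of_degrees (𝒱 : ℤ → Submodule 𝕜 V) [DirectSum.Decomposition 𝒱] {n : ℕ}
    (G : (Fin n → ℤ) → MultilinearMap 𝕜 (fun _ : Fin n => V) W) :
    ∃ F : MultilinearMap 𝕜 (fun _ : Fin n => V) W, ∀ α : Fin n → Letter 𝒱,
      F (fun i => ((α i).2 : V)) = G (fun i => (α i).1) fun i => ((α i).2 : V) := by
  refine ⟨(MultilinearMap.fromDirectSumEquiv fun d => (G d).compLinearMap fun i =>
    (𝒱 (d i)).subtype).compLinearMap fun _ => (DirectSum.decomposeLinearEquiv 𝒱).toLinearMap,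
    fun α => ?_⟩
  have decompose_eq (i : Fin n) : (DirectSum.decomposeLinearEquiv 𝒱).toLinearMap ((α i).2 : V) =
      DirectSum.lof 𝕜 ℤ (fun j => 𝒱 j) (α i).1 (α i).2 := DirectSum.decompose_coe 𝒱 _
  rw [MultilinearMap.compLinearMap_apply]
  simp only [decompose_eq]
  rw [MultilinearMap.fromDirectSumEquiv_lof]
  rfl

end Multilinear

section LetterBracket

variable {𝕜 V : Type*} [Field 𝕜] [AddCommGroup V] [Module 𝕜 V] {𝒱 : ℤ → Submodule 𝕜 V}
  {c : ℤ} {l : V →ₗ[𝕜] V →ₗ[𝕜] V}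
  (hl : ∀ {i j : ℤ} {u v : V}, u ∈ 𝒱 i → v ∈ 𝒱 j → l u v ∈ 𝒱 (i + j + c))

/-- The bracket of two homogeneous vectors, as a homogeneous vector. -/
def letterBracket (a b : Letter 𝒱) : Letter 𝒱 :=
  ⟨a.1 + b.1 + c, l a.2 b.2, hl a.2.2 b.2.2⟩

theorem packetOf_wordBracket_ofFn {n p : ℕ} (hp : p ≤ n + 1) (α : Fin (n + 1) → Letter 𝒱) :
    packetOf 𝒱 (wordBracket (letterDeg 𝒱) c (letterBracket hl) (word 𝕜 ((List.ofFn α).take p))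
      (word 𝕜 ((List.ofFn α).drop p))) =
      ∑ σ ∈ battements (n + 1) p,
        ∑ k : Fin n with (σ.symm k.castSucc).val < p ∧ p ≤ (σ.symm k.succ).val,
          (((koszulSign (fun i => (α i).1) σ *
            (c * ∑ s with s < k.castSucc, (α (σ.symm s)).1).negOnePow : ℤˣ) : ℤ) : 𝕜) •
            packet 𝒱 (Fin.contractNth k.castSucc (fun u v => l u v)
              fun i => ((α (σ.symm i)).2 : V)) := by
  rw [wordBracket_word_eq_sum _ _ _ _ hp, map_sum]
  refine Finset.sum_congr rfl fun σ _ => ?_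
  rw [map_sum]
  refine Finset.sum_congr rfl fun k _ => ?_
  rw [map_smul, packetOf_word, wordPacket_ofFn]
  congr 2
  exact Fin.comp_contractNth (f := fun a : Letter 𝒱 => (a.2 : V)) _ _ (fun a b => rfl) _ _

theorem exists_multilinear_wordBracket [DirectSum.Decomposition 𝒱] {n p : ℕ} (hp : p ≤ n + 1) :
    ∃ F : MultilinearMap 𝕜 (fun _ : Fin (n + 1) => V) (Packets 𝒱), ∀ α : Fin (n + 1) → Letter 𝒱,
      F (fun i => ((α i).2 : V)) = packetOf 𝒱 (wordBracket (letterDeg 𝒱) c (letterBracket hl)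
        (word 𝕜 ((List.ofFn α).take p)) (word 𝕜 ((List.ofFn α).drop p))) := by
  obtain ⟨F, hF⟩ := exists_multilinear_of_degrees 𝒱 fun d : Fin (n + 1) → ℤ =>
    ∑ σ ∈ battements (n + 1) p,
      ∑ k : Fin n with (σ.symm k.castSucc).val < p ∧ p ≤ (σ.symm k.succ).val,
        (((koszulSign d σ * (c * ∑ s with s < k.castSucc, d (σ.symm s)).negOnePow : ℤˣ) : ℤ) : 𝕜) •
          (contractMultilinear l k
            ((cls 𝒱 n).compMultilinearMap (PiTensorProduct.tprod 𝕜))).domDomCongr σ.symm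
  refine ⟨F, fun α => ?_⟩
  rw [hF, packetOf_wordBracket_ofFn hl hp, sum_apply]
  exact Finset.sum_congr rfl fun σ _ => by rw [sum_apply]; rfl

end LetterBracket

section Descent

variable {𝕜 V : Type*} [Field 𝕜] [AddCommGroup V] [Module 𝕜 V] {𝒱 : ℤ → Submodule 𝕜 V}

theorem map_wordBracket_word_eq_zero {R L M : Type*} [CommRing R] [AddCommMonoid M] [Module R M]
    (deg : L → ℤ) (c : ℤ) (l : L → L → L) (f : Words R L →ₗ[R] M)
    (hf : ∀ a w, f (word R (a :: w)) = 0) (u v : List L) :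
    f (wordBracket deg c l (word R u) (word R v)) = 0 := by
  have map_consLetter (a : L) (t : Words R L) : f (consLetter a t) = 0 := by
    have : f ∘ₗ consLetter a = 0 := words_hom_ext fun w => by
      rw [LinearMap.comp_apply, ← word_cons, hf, LinearMap.zero_apply]
    exact LinearMap.congr_fun this t
  rcases u with _ | ⟨a, u⟩
  · rw [wordBracket_nil_left, map_zero]
  rcases v with _ | ⟨b, v⟩
  · rw [wordBracket_nil_right, map_zero]
  simp only [wordBracket_word_cons_cons, map_add, map_smul, map_consLetter, smul_zero, add_zero]

section WordBracket

variable {c : ℤ} {l : Letter 𝒱 → Letter 𝒱 → Letter 𝒱}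

theorem packetOf_shuffle_wordBracket (a : Letter 𝒱) (u v w : List (Letter 𝒱)) :
    packetOf 𝒱 (shuffle (letterDeg 𝒱) (word 𝕜 (a :: u))
      (wordBracket (letterDeg 𝒱) c l (word 𝕜 v) (word 𝕜 w))) = 0 :=
  map_wordBracket_word_eq_zero _ _ _
    (packetOf 𝒱 ∘ₗ shuffle (letterDeg 𝒱) (word 𝕜 (a :: u)))
    (packetOf_shuffle_eq_zero 𝒱 a u) v w

theorem packetOf_wordBracket_shuffle (a : Letter 𝒱) (u v w : List (Letter 𝒱)) :
    packetOf 𝒱 (shuffle (letterDeg 𝒱) (wordBracket (letterDeg 𝒱) c l (word 𝕜 v) (word 𝕜 w))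
      (word 𝕜 (a :: u))) = 0 :=
  map_wordBracket_word_eq_zero _ _ _
    (packetOf 𝒱 ∘ₗ (shuffle (letterDeg 𝒱)).flip (word 𝕜 (a :: u)))
    (packetOf_shuffle_eq_zero 𝒱 · · a u) v w

variable (hl : ∀ a b, (l a b).1 = a.1 + b.1 + c) (a : Letter 𝒱) (u : List (Letter 𝒱))
  (b : Letter 𝒱) (v w : List (Letter 𝒱))

include hl

theorem packetOf_wordBracket_shuffle_left :
    packetOf 𝒱 (wordBracket (letterDeg 𝒱) c l
      (shuffle (letterDeg 𝒱) (word 𝕜 (a :: u)) (word 𝕜 (b :: v))) (word 𝕜 w)) = 0 := by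
  rw [wordBracket_shuffle_left hl, map_add, map_smul, map_smul, packetOf_shuffle_wordBracket,
    packetOf_wordBracket_shuffle, smul_zero, smul_zero, add_zero]

theorem packetOf_wordBracket_shuffle_right :
    packetOf 𝒱 (wordBracket (letterDeg 𝒱) c l (word 𝕜 w)
      (shuffle (letterDeg 𝒱) (word 𝕜 (a :: u)) (word 𝕜 (b :: v)))) = 0 := by
  rw [wordBracket_shuffle_right hl, map_add, map_smul, packetOf_shuffle_wordBracket,
    packetOf_wordBracket_shuffle, smul_zero, add_zero]

end WordBracket

theorem map_bat_eq_zero {W : Type*} [AddCommGroup W] [Module 𝕜 W] {n p : ℕ} (hp : 0 < p)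
    (hn : p < n) (g : (⨂[𝕜]^n V) →ₗ[𝕜] W) (f : Words 𝕜 (Letter 𝒱) →ₗ[𝕜] W)
    (hgf : ∀ α : Fin n → Letter 𝒱,
      g (PiTensorProduct.tprod 𝕜 fun i => ((α i).2 : V)) = f (word 𝕜 (List.ofFn α)))
    (hf : ∀ a u b v, f (shuffle (letterDeg 𝒱) (word 𝕜 (a :: u)) (word 𝕜 (b :: v))) = 0)
    {d : Fin n → ℤ} {v : Fin n → V} (hv : ∀ i, v i ∈ 𝒱 (d i)) : g (bat p d v) = 0 := by
  set α : Fin n → Letter 𝒱 := fun i => ⟨d i, v i, hv i⟩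
  have bat_eq : g (bat p d v) = f (shuffle (letterDeg 𝒱) (word 𝕜 ((List.ofFn α).take p))
      (word 𝕜 ((List.ofFn α).drop p))) := by
    rw [← sum_battements_word (letterDeg 𝒱) α hn.le, bat, map_sum, map_sum]
    refine Finset.sum_congr rfl fun σ _ => ?_
    rw [map_smul, map_smul, ← hgf]
  obtain ⟨a, u, take_eq⟩ : ∃ a u, (List.ofFn α).take p = a :: u :=
    List.exists_cons_of_length_pos (by simp only [List.length_take, List.length_ofFn]; omega)
  obtain ⟨b, w, drop_eq⟩ : ∃ b w, (List.ofFn α).drop p = b :: w :=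
    List.exists_cons_of_length_pos (by simp only [List.length_drop, List.length_ofFn]; omega)
  rw [bat_eq, take_eq, drop_eq, hf]

variable [DirectSum.Decomposition 𝒱]

theorem exists_bilinear_packetPower {W : Type*} [AddCommGroup W] [Module 𝕜 W] {m n : ℕ}
    (Φ : Words 𝕜 (Letter 𝒱) →ₗ[𝕜] Words 𝕜 (Letter 𝒱) →ₗ[𝕜] W)
    (hleft : ∀ a u b v w,
      Φ (shuffle (letterDeg 𝒱) (word 𝕜 (a :: u)) (word 𝕜 (b :: v))) (word 𝕜 w) = 0)
    (hright : ∀ a u b v w,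
      Φ (word 𝕜 w) (shuffle (letterDeg 𝒱) (word 𝕜 (a :: u)) (word 𝕜 (b :: v))) = 0)
    (T : (⨂[𝕜]^m V) →ₗ[𝕜] (⨂[𝕜]^n V) →ₗ[𝕜] W)
    (hT : ∀ (α : Fin m → Letter 𝒱) (β : Fin n → Letter 𝒱),
      T (PiTensorProduct.tprod 𝕜 fun i => ((α i).2 : V))
        (PiTensorProduct.tprod 𝕜 fun i => ((β i).2 : V)) =
        Φ (word 𝕜 (List.ofFn α)) (word 𝕜 (List.ofFn β))) :
    ∃ B : PacketPower 𝒱 m →ₗ[𝕜] PacketPower 𝒱 n →ₗ[𝕜] W,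
      ∀ (α : Fin m → Letter 𝒱) (β : Fin n → Letter 𝒱),
        B (PacketPower.mk 𝒱 m (PiTensorProduct.tprod 𝕜 fun i => ((α i).2 : V)))
          (PacketPower.mk 𝒱 n (PiTensorProduct.tprod 𝕜 fun i => ((β i).2 : V))) =
          Φ (word 𝕜 (List.ofFn α)) (word 𝕜 (List.ofFn β)) := by
  have right_le : batImage 𝒱 n ≤ LinearMap.ker T.flip := batImage_le fun r hr hr' d v hv => by
    rw [LinearMap.mem_ker]
    refine PiTensorProduct.ext (multilinear_ext_homogeneous 𝒱 fun α => ?_)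
    exact map_bat_eq_zero hr hr' (T (PiTensorProduct.tprod 𝕜 fun i => ((α i).2 : V)))
      (Φ (word 𝕜 (List.ofFn α))) (hT α) (hright · · · · _) hv
  have left_le : batImage 𝒱 m ≤ LinearMap.ker (PacketPower.lift 𝒱 n T.flip right_le).flip :=
    batImage_le fun r hr hr' d v hv => by
      rw [LinearMap.mem_ker]
      refine Submodule.linearMap_qext _ <|
        PiTensorProduct.ext (multilinear_ext_homogeneous 𝒱 fun β => ?_)
      exact map_bat_eq_zero hr hr' (T.flip (PiTensorProduct.tprod 𝕜 fun i => ((β i).2 : V)))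
        (Φ.flip (word 𝕜 (List.ofFn β))) (hT · β) (hleft · · · · _) hv
  exact ⟨PacketPower.lift 𝒱 m _ left_le, hT⟩

variable {c : ℤ} {l : V →ₗ[𝕜] V →ₗ[𝕜] V}
  (hl : ∀ {i j : ℤ} {u v : V}, u ∈ 𝒱 i → v ∈ 𝒱 j → l u v ∈ 𝒱 (i + j + c))

theorem exists_bilinear_wordBracket (p q : ℕ) :
    ∃ T : (⨂[𝕜]^(p + 1) V) →ₗ[𝕜] (⨂[𝕜]^(q + 1) V) →ₗ[𝕜] Packets 𝒱,
      ∀ (α : Fin (p + 1) → Letter 𝒱) (β : Fin (q + 1) → Letter 𝒱),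
        T (PiTensorProduct.tprod 𝕜 fun i => ((α i).2 : V))
          (PiTensorProduct.tprod 𝕜 fun i => ((β i).2 : V)) =
          packetOf 𝒱 (wordBracket (letterDeg 𝒱) c (letterBracket hl) (word 𝕜 (List.ofFn α))
            (word 𝕜 (List.ofFn β))) := by
  obtain ⟨F, hF⟩ := exists_multilinear_wordBracket (𝒱 := 𝒱) (c := c) (l := l) hl
    (show p + 1 ≤ p + 1 + q + 1 by omega)
  refine ⟨TensorProduct.curry (PiTensorProduct.lift F ∘ₗ
    (TensorPower.mulEquiv (R := 𝕜) (M := V) (n := p + 1) (m := q + 1)).toLinearMap),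
    fun α β => ?_⟩
  have append_eq : Fin.append (fun i => ((α i).2 : V)) (fun i => ((β i).2 : V)) =
      fun i => ((Fin.append α β i).2 : V) := by
    have append_left (i : Fin (p + 1)) : Fin.append α β (Fin.castAdd (q + 1) i) = α i :=
      Fin.append_left α β i
    have append_right (i : Fin (q + 1)) : Fin.append α β (Fin.natAdd (p + 1) i) = β i :=
      Fin.append_right α β i
    funext i
    exact Fin.addCases (fun i => by rw [Fin.append_left, append_left])
      (fun i => by rw [Fin.append_right, append_right]) i
  have ofFn_append : List.ofFn (Fin.append α β) = List.ofFn α ++ List.ofFn β :=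
    List.ofFn_fin_append α β
  have bracket_append := hF (Fin.append α β :)
  rw [TensorProduct.curry_apply, LinearMap.comp_apply, LinearEquiv.coe_coe, ← TensorPower.gMul_def,
    TensorPower.tprod_mul_tprod, PiTensorProduct.lift.tprod, append_eq]
  refine bracket_append.trans ?_
  erw [ofFn_append]
  rw [List.take_left' List.length_ofFn, List.drop_left' List.length_ofFn]

theorem exists_bilinear_packetPower_wordBracket (p q : ℕ) :
    ∃ B : PacketPower 𝒱 (p + 1) →ₗ[𝕜] PacketPower 𝒱 (q + 1) →ₗ[𝕜] Packets 𝒱,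
      ∀ (α : Fin (p + 1) → Letter 𝒱) (β : Fin (q + 1) → Letter 𝒱),
        B (PacketPower.mk 𝒱 (p + 1) (PiTensorProduct.tprod 𝕜 fun i => ((α i).2 : V)))
          (PacketPower.mk 𝒱 (q + 1) (PiTensorProduct.tprod 𝕜 fun i => ((β i).2 : V))) =
          packetOf 𝒱 (wordBracket (letterDeg 𝒱) c (letterBracket hl) (word 𝕜 (List.ofFn α))
            (word 𝕜 (List.ofFn β))) := by
  obtain ⟨T, hT⟩ := exists_bilinear_wordBracket (𝒱 := 𝒱) (c := c) (l := l) hl p q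
  exact exists_bilinear_packetPower
    ((wordBracket (letterDeg 𝒱) c (letterBracket hl)).compr₂ (packetOf 𝒱))
    (packetOf_wordBracket_shuffle_left fun _ _ => rfl)
    (packetOf_wordBracket_shuffle_right fun _ _ => rfl) T hT

/-- The bracket `ℓ₂` of packets, induced by the bracket of words of homogeneous letters. -/
noncomputable def packetBracket : Packets 𝒱 ⊗[𝕜] Packets 𝒱 →ₗ[𝕜] Packets 𝒱 :=
  TensorProduct.lift <| DirectSum.toModule 𝕜 ℕ _ fun p =>
    (DirectSum.toModule 𝕜 ℕ _ fun q =>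
      (exists_bilinear_packetPower_wordBracket (𝒱 := 𝒱) (c := c) (l := l) hl p q).choose.flip).flip

theorem packetBracket_wordPacket (u v : List (Letter 𝒱)) :
    packetBracket hl (wordPacket 𝒱 u ⊗ₜ wordPacket 𝒱 v) =
      packetOf 𝒱 (wordBracket (letterDeg 𝒱) c (letterBracket hl) (word 𝕜 u) (word 𝕜 v)) := by
  rw [packetBracket, TensorProduct.lift.tmul]
  rcases u with _ | ⟨a, u⟩
  · rw [wordPacket_nil, map_zero, LinearMap.zero_apply, wordBracket_nil_left, map_zero]
  rcases v with _ | ⟨b, v⟩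
  · rw [wordPacket_nil, map_zero, wordBracket_nil_right, map_zero]
  have bracket_get := (exists_bilinear_packetPower_wordBracket (𝒱 := 𝒱) (c := c) (l := l) hl
    u.length v.length).choose_spec (a :: u).get (b :: v).get
  erw [List.ofFn_get (a :: u), List.ofFn_get (b :: v)] at bracket_get
  rw [← bracket_get]
  change DirectSum.toModule 𝕜 ℕ (Packets 𝒱 →ₗ[𝕜] Packets 𝒱) _
    (DirectSum.lof 𝕜 ℕ (fun n => PacketPower 𝒱 (n + 1)) u.length _)
    (DirectSum.lof 𝕜 ℕ (fun n => PacketPower 𝒱 (n + 1)) v.length _) = _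
  rw [DirectSum.toModule_lof, LinearMap.flip_apply, DirectSum.toModule_lof]
  rfl

end Descent

section HomogeneousWords

variable {R L : Type*} [CommRing R] (deg : L → ℤ)

/-- The span of the words of degree `k` and length `n`. -/
noncomputable def homogeneousWords (R : Type*) [CommRing R] (k : ℤ) (n : ℕ) :
    Submodule R (Words R L) :=
  Submodule.span R (word R '' {w | wordDeg deg w = k ∧ w.length = n})

theorem word_mem_homogeneousWords (w : List L) :
    word R w ∈ homogeneousWords deg R (wordDeg deg w) w.length :=
  Submodule.subset_span ⟨w, ⟨rfl, rfl⟩, rfl⟩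

theorem homogeneousWords_le_iff {k : ℤ} {n : ℕ} {S : Submodule R (Words R L)} :
    homogeneousWords deg R k n ≤ S ↔ ∀ w, wordDeg deg w = k → w.length = n → word R w ∈ S := by
  rw [homogeneousWords, Submodule.span_le, Set.image_subset_iff]
  exact ⟨fun h w hk hn => h ⟨hk, hn⟩, fun h w hw => h w hw.1 hw.2⟩

theorem consLetter_mem_homogeneousWords (a : L) {k : ℤ} {n : ℕ} {t : Words R L}
    (ht : t ∈ homogeneousWords deg R k n) :
    consLetter a t ∈ homogeneousWords deg R (deg a + k) (n + 1) := by
  suffices h : homogeneousWords deg R k n ≤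
      (homogeneousWords deg R (deg a + k) (n + 1)).comap (consLetter a) from h ht
  rw [homogeneousWords_le_iff]
  rintro w rfl rfl
  rw [Submodule.mem_comap, ← word_cons, ← wordDeg_cons, ← List.length_cons (a := a)]
  exact word_mem_homogeneousWords deg (a :: w)

theorem shuffle_word_mem_homogeneousWords (u v : List L) :
    shuffle deg (word R u) (word R v) ∈
      homogeneousWords deg R (wordDeg deg u + wordDeg deg v) (u.length + v.length) := by
  induction u, v using shuffleWord.induct with
  | case1 v =>
    rw [shuffle_nil_left, wordDeg_nil, zero_add, List.length_nil, zero_add]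
    exact word_mem_homogeneousWords deg v
  | case2 a u =>
    rw [shuffle_nil_right, wordDeg_nil, add_zero]
    exact word_mem_homogeneousWords deg (a :: u)
  | case3 a u b v ihu ihv =>
    rw [shuffle_word_cons_cons]
    refine Submodule.add_mem _ ?_ (Submodule.smul_mem _ _ ?_)
    · convert consLetter_mem_homogeneousWords deg a ihu using 2 <;>
        simp only [wordDeg_cons, List.length_cons] <;> omega
    · convert consLetter_mem_homogeneousWords deg b ihv using 2 <;>
        simp only [wordDeg_cons, List.length_cons] <;> omega

variable {deg} in
theorem wordBracket_word_mem_homogeneousWords {c : ℤ} {l : L → L → L}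
    (hl : ∀ a b, deg (l a b) = deg a + deg b + c) (u v : List L) :
    wordBracket deg c l (word R u) (word R v) ∈
      homogeneousWords deg R (wordDeg deg u + wordDeg deg v + c) (u.length + v.length - 1) := by
  induction u, v using shuffleWord.induct with
  | case1 v => rw [wordBracket_nil_left]; exact Submodule.zero_mem _
  | case2 a u => rw [wordBracket_nil_right]; exact Submodule.zero_mem _
  | case3 a u b v ihu ihv =>
    rw [wordBracket_word_cons_cons]
    refine Submodule.add_mem _ (Submodule.add_mem _ (Submodule.smul_mem _ _ ?_)
      (Submodule.smul_mem _ _ ?_)) (Submodule.smul_mem _ _ ?_)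
    · convert consLetter_mem_homogeneousWords deg a ihu using 2 <;>
        simp only [wordDeg_cons, List.length_cons] <;> omega
    · convert consLetter_mem_homogeneousWords deg b ihv using 2 <;>
        simp only [wordDeg_cons, List.length_cons] <;> omega
    · convert consLetter_mem_homogeneousWords deg (l a b)
        (shuffle_word_mem_homogeneousWords deg u v) using 2 <;>
        simp only [wordDeg_cons, List.length_cons, hl] <;> omega

end HomogeneousWords

section PacketDegree

variable {𝕜 V : Type*} [Field 𝕜] [AddCommGroup V] [Module 𝕜 V] (𝒱 : ℤ → Submodule 𝕜 V)

theorem wordPacket_mem_packetDegree (w : List (Letter 𝒱)) :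
    wordPacket 𝒱 w ∈ packetDegree 𝒱 (wordDeg (letterDeg 𝒱) w) := by
  cases w with
  | nil => rw [wordPacket_nil]; exact Submodule.zero_mem _
  | cons a w =>
    exact Submodule.subset_span ⟨_, fun i => ((a :: w).get i).1, _, Nat.succ_pos _,
      fun i => ((a :: w).get i).2.2, sum_get_eq_wordDeg (letterDeg 𝒱) (a :: w), rfl⟩

theorem packetDegree_eq_span (k : ℤ) : packetDegree 𝒱 k =
    Submodule.span 𝕜 (wordPacket 𝒱 '' {w | wordDeg (letterDeg 𝒱) w = k}) := by
  apply le_antisymm <;> refine Submodule.span_le.2 ?_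
  · rintro _ ⟨n, d, v, -, hv, rfl, rfl⟩
    refine Submodule.subset_span ⟨List.ofFn fun i => ⟨d i, v i, hv i⟩, ?_, wordPacket_ofFn 𝒱 _⟩
    rw [Set.mem_ofPred_eq, wordDeg, List.map_ofFn, List.sum_ofFn]
    rfl
  · rintro _ ⟨w, rfl, rfl⟩
    exact wordPacket_mem_packetDegree 𝒱 w

theorem packetOf_mem_packetDegree {k : ℤ} {n : ℕ} {t : Words 𝕜 (Letter 𝒱)}
    (ht : t ∈ homogeneousWords (letterDeg 𝒱) 𝕜 k n) : packetOf 𝒱 t ∈ packetDegree 𝒱 k := by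
  suffices h : homogeneousWords (letterDeg 𝒱) 𝕜 k n ≤ (packetDegree 𝒱 k).comap (packetOf 𝒱) from
    h ht
  rw [homogeneousWords_le_iff]
  rintro w rfl -
  rw [Submodule.mem_comap, packetOf_word]
  exact wordPacket_mem_packetDegree 𝒱 w

theorem cogenProj_packetOf_eq_zero {k : ℤ} {n : ℕ} (hn : n ≠ 1) {t : Words 𝕜 (Letter 𝒱)}
    (ht : t ∈ homogeneousWords (letterDeg 𝒱) 𝕜 k n) : cogenProj 𝒱 (packetOf 𝒱 t) = 0 := by
  suffices h : homogeneousWords (letterDeg 𝒱) 𝕜 k n ≤ LinearMap.ker (cogenProj 𝒱 ∘ₗ packetOf 𝒱) from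
    h ht
  rw [homogeneousWords_le_iff]
  rintro w - rfl
  rw [LinearMap.mem_ker, LinearMap.comp_apply, packetOf_word, cogenProj_of_length_ne_one 𝒱 hn]

variable {𝒱} in
theorem volte_tmul_of_mem [DirectSum.Decomposition 𝒱] [CharZero 𝕜] {x y : ℤ} {X Y : Packets 𝒱}
    (hX : X ∈ packetDegree 𝒱 x) (hY : Y ∈ packetDegree 𝒱 y) :
    volte 𝒱 (X ⊗ₜ Y) = commSign 𝕜 x y • (Y ⊗ₜ[𝕜] X) := by
  rw [packetDegree_eq_span] at hX hY
  induction hX, hY using Submodule.span_induction₂ with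
  | mem_mem X Y hX hY =>
    obtain ⟨u, rfl, rfl⟩ := hX
    obtain ⟨v, rfl, rfl⟩ := hY
    exact volte_wordPacket 𝒱 u v
  | zero_left Y _ => rw [TensorProduct.zero_tmul, TensorProduct.tmul_zero, map_zero, smul_zero]
  | zero_right X _ => rw [TensorProduct.zero_tmul, TensorProduct.tmul_zero, map_zero, smul_zero]
  | add_left X X' Y _ _ _ h h' =>
    rw [TensorProduct.add_tmul, TensorProduct.tmul_add, map_add, smul_add, h, h']
  | add_right X Y Y' _ _ _ h h' =>
    rw [TensorProduct.add_tmul, TensorProduct.tmul_add, map_add, smul_add, h, h']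
  | smul_left r X Y _ _ h =>
    rw [← TensorProduct.smul_tmul', TensorProduct.tmul_smul, map_smul, h, smul_comm]
  | smul_right r X Y _ _ h =>
    rw [← TensorProduct.smul_tmul', TensorProduct.tmul_smul, map_smul, h, smul_comm]

theorem packets_hom_ext₂ [DirectSum.Decomposition 𝒱] {W : Type*} [AddCommGroup W] [Module 𝕜 W]
    {f g : Packets 𝒱 ⊗[𝕜] Packets 𝒱 →ₗ[𝕜] W}
    (h : ∀ u v, f (wordPacket 𝒱 u ⊗ₜ wordPacket 𝒱 v) = g (wordPacket 𝒱 u ⊗ₜ wordPacket 𝒱 v)) :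
    f = g :=
  TensorProduct.ext <| packets_hom_ext 𝒱 fun u => packets_hom_ext 𝒱 fun v => h u v

end PacketDegree

section PacketBracket

variable {𝕜 V : Type*} [Field 𝕜] [AddCommGroup V] [Module 𝕜 V] {𝒱 : ℤ → Submodule 𝕜 V}
  [DirectSum.Decomposition 𝒱] {c : ℤ} {l : V →ₗ[𝕜] V →ₗ[𝕜] V}
  (hl : ∀ {i j : ℤ} {u v : V}, u ∈ 𝒱 i → v ∈ 𝒱 j → l u v ∈ 𝒱 (i + j + c))

theorem isOfDegree_packetBracket :
    IsOfDegree 𝒱 c (packetBracket (𝒱 := 𝒱) (c := c) (l := l) hl) := by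
  intro x y X Y hX hY
  suffices h : Submodule.map₂ (TensorProduct.curry (packetBracket (𝒱 := 𝒱) (c := c) (l := l) hl))
      (packetDegree 𝒱 x) (packetDegree 𝒱 y) ≤ packetDegree 𝒱 (x + y + c) from
    h (Submodule.apply_mem_map₂ _ hX hY)
  rw [packetDegree_eq_span 𝒱 x, packetDegree_eq_span 𝒱 y, Submodule.map₂_span_span,
    Submodule.span_le]
  rintro _ ⟨_, ⟨u, rfl, rfl⟩, _, ⟨v, rfl, rfl⟩, rfl⟩
  change packetBracket hl (wordPacket 𝒱 u ⊗ₜ wordPacket 𝒱 v) ∈ packetDegree 𝒱 _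
  rw [packetBracket_wordPacket]
  exact packetOf_mem_packetDegree 𝒱 (wordBracket_word_mem_homogeneousWords (fun _ _ => rfl) u v)

theorem packetBracket_singleton (a b : Letter 𝒱) :
    packetBracket hl (wordPacket 𝒱 [a] ⊗ₜ wordPacket 𝒱 [b]) =
      wordPacket 𝒱 [letterBracket hl a b] := by
  rw [packetBracket_wordPacket, wordBracket_word_cons_cons, wordBracket_nil_left,
    wordBracket_nil_right, map_zero, map_zero, smul_zero, smul_zero, zero_add, zero_add,
    shuffle_nil_left, ← word_cons, wordDeg_nil, commSign_zero_right, one_smul, packetOf_word]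

theorem cogenProj_packetBracket_eq_zero {u v : List (Letter 𝒱)}
    (h : ¬(u.length = 1 ∧ v.length = 1)) :
    cogenProj 𝒱 (packetBracket hl (wordPacket 𝒱 u ⊗ₜ wordPacket 𝒱 v)) = 0 := by
  rw [packetBracket_wordPacket]
  rcases u with _ | ⟨a, u⟩
  · rw [wordBracket_nil_left, map_zero, map_zero]
  rcases v with _ | ⟨b, v⟩
  · rw [wordBracket_nil_right, map_zero, map_zero]
  refine cogenProj_packetOf_eq_zero 𝒱 ?_
    (wordBracket_word_mem_homogeneousWords (fun _ _ => rfl) (a :: u) (b :: v))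
  simp only [List.length_cons] at h ⊢
  omega

theorem extends_packetBracket : Extends 𝒱 l (packetBracket (𝒱 := 𝒱) (c := c) (l := l) hl) := by
  suffices h : cogenProj 𝒱 ∘ₗ packetBracket hl =
      TensorProduct.lift (l.compl₁₂ (cogenProj 𝒱) (cogenProj 𝒱)) from
    fun X Y => LinearMap.congr_fun h (X ⊗ₜ Y)
  refine packets_hom_ext₂ 𝒱 fun u v => ?_
  rw [LinearMap.comp_apply, TensorProduct.lift.tmul, LinearMap.compl₁₂_apply]
  by_cases h : u.length = 1 ∧ v.length = 1
  · obtain ⟨a, rfl⟩ := List.length_eq_one_iff.1 h.1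
    obtain ⟨b, rfl⟩ := List.length_eq_one_iff.1 h.2
    rw [packetBracket_singleton, cogenProj_singleton, cogenProj_singleton, cogenProj_singleton]
    rfl
  · rw [cogenProj_packetBracket_eq_zero hl h]
    rcases not_and_or.1 h with hu | hv
    · rw [cogenProj_of_length_ne_one 𝒱 hu, map_zero, LinearMap.zero_apply]
    · rw [cogenProj_of_length_ne_one 𝒱 hv, map_zero]

end PacketBracket

section Leibniz

variable {𝕜 V : Type*} [Field 𝕜] [AddCommGroup V] [Module 𝕜 V] {𝒱 : ℤ → Submodule 𝕜 V}
  [DirectSum.Decomposition 𝒱] (c : ℤ) (m : Packets 𝒱 ⊗[𝕜] Packets 𝒱 →ₗ[𝕜] Packets 𝒱)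

/-- The action of the bracket with `Y` on the right, by the graded Leibniz rule, on the tensor
square of the packets. -/
noncomputable def leibnizLeft (Y : Packets 𝒱) :
    Packets 𝒱 ⊗[𝕜] Packets 𝒱 →ₗ[𝕜] Packets 𝒱 ⊗[𝕜] Packets 𝒱 :=
  (bracketLeft 𝒱 m ∘ₗ volte₂₃ 𝒱 + bracketRight 𝒱 c m) ∘ₗ (TensorProduct.mk 𝕜 _ _).flip Y

/-- The action of the bracket with `X` on the left, by the graded Leibniz rule, on the tensor
square of the packets. -/
noncomputable def leibnizRight (X : Packets 𝒱) :
    Packets 𝒱 ⊗[𝕜] Packets 𝒱 →ₗ[𝕜] Packets 𝒱 ⊗[𝕜] Packets 𝒱 :=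
  (bracketLeft 𝒱 m + bracketRight 𝒱 c m ∘ₗ volte₁₂ 𝒱) ∘ₗ
    (TensorProduct.assoc 𝕜 (Packets 𝒱) (Packets 𝒱) (Packets 𝒱)).symm.toLinearMap ∘ₗ
      TensorProduct.mk 𝕜 _ _ X

variable [CharZero 𝕜]

variable {c m} in
theorem isCompatible_iff : IsCompatible 𝒱 c m ↔ ∀ u v,
    cobracket 𝒱 (m (wordPacket 𝒱 u ⊗ₜ wordPacket 𝒱 v)) =
      leibnizLeft c m (wordPacket 𝒱 v) (cobracket 𝒱 (wordPacket 𝒱 u)) +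
        leibnizRight c m (wordPacket 𝒱 u) (cobracket 𝒱 (wordPacket 𝒱 v)) := by
  have leibniz_add_leibniz (X Y : Packets 𝒱) :
      leibnizLeft c m Y (cobracket 𝒱 X) + leibnizRight c m X (cobracket 𝒱 Y) =
        (bracketLeft 𝒱 m ∘ₗ (volte₂₃ 𝒱 ∘ₗ cobracketLeft 𝒱 + cobracketRight 𝒱) +
          bracketRight 𝒱 c m ∘ₗ (cobracketLeft 𝒱 + volte₁₂ 𝒱 ∘ₗ cobracketRight 𝒱)) (X ⊗ₜ Y) := by
    simp only [leibnizLeft, leibnizRight, cobracketLeft, cobracketRight, LinearMap.comp_apply,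
      LinearMap.add_apply, map_add, LinearMap.rTensor_tmul, LinearMap.lTensor_tmul,
      LinearMap.flip_apply, TensorProduct.mk_apply]
    abel
  simp only [leibniz_add_leibniz]
  exact ⟨fun h u v => LinearMap.congr_fun h _, fun h => packets_hom_ext₂ 𝒱 h⟩

theorem leibnizLeft_wordPacket (x x' v : List (Letter 𝒱)) :
    leibnizLeft c m (wordPacket 𝒱 v) (wordPacket 𝒱 x ⊗ₜ wordPacket 𝒱 x') =
      commSign 𝕜 (wordDeg (letterDeg 𝒱) x') (wordDeg (letterDeg 𝒱) v) •
        (m (wordPacket 𝒱 x ⊗ₜ wordPacket 𝒱 v) ⊗ₜ[𝕜] wordPacket 𝒱 x') +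
      commSign 𝕜 c (wordDeg (letterDeg 𝒱) x) •
        (wordPacket 𝒱 x ⊗ₜ[𝕜] m (wordPacket 𝒱 x' ⊗ₜ wordPacket 𝒱 v)) := by
  simp only [leibnizLeft, bracketLeft, bracketRight, volte₂₃, LinearMap.comp_apply,
    LinearMap.add_apply, LinearMap.flip_apply, TensorProduct.mk_apply, LinearEquiv.coe_coe,
    TensorProduct.assoc_tmul, LinearMap.lTensor_tmul, volte_wordPacket, TensorProduct.tmul_smul,
    map_smul, TensorProduct.assoc_symm_tmul, LinearMap.rTensor_tmul, TensorProduct.map_tmul,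
    packetTwist_wordPacket, ← TensorProduct.smul_tmul']

theorem leibnizRight_wordPacket (u y y' : List (Letter 𝒱)) :
    leibnizRight c m (wordPacket 𝒱 u) (wordPacket 𝒱 y ⊗ₜ wordPacket 𝒱 y') =
      m (wordPacket 𝒱 u ⊗ₜ wordPacket 𝒱 y) ⊗ₜ[𝕜] wordPacket 𝒱 y' +
      (commSign 𝕜 (wordDeg (letterDeg 𝒱) u) (wordDeg (letterDeg 𝒱) y) *
        commSign 𝕜 c (wordDeg (letterDeg 𝒱) y)) •
          (wordPacket 𝒱 y ⊗ₜ[𝕜] m (wordPacket 𝒱 u ⊗ₜ wordPacket 𝒱 y')) := by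
  simp only [leibnizRight, bracketLeft, bracketRight, volte₁₂, LinearMap.comp_apply,
    LinearMap.add_apply, TensorProduct.mk_apply, LinearEquiv.coe_coe,
    TensorProduct.assoc_symm_tmul, LinearMap.rTensor_tmul, volte_wordPacket,
    ← TensorProduct.smul_tmul', map_smul, TensorProduct.assoc_tmul, TensorProduct.map_tmul,
    packetTwist_wordPacket, smul_smul]

variable {c m} (hm : IsOfDegree 𝒱 c m)

include hm in
theorem volte_leibnizLeft (v : List (Letter 𝒱)) (z : Packets 𝒱 ⊗[𝕜] Packets 𝒱) :
    volte 𝒱 (leibnizLeft c m (wordPacket 𝒱 v) z) =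
      leibnizLeft c m (wordPacket 𝒱 v) (volte 𝒱 z) := by
  suffices h : volte 𝒱 ∘ₗ leibnizLeft c m (wordPacket 𝒱 v) =
      leibnizLeft c m (wordPacket 𝒱 v) ∘ₗ volte 𝒱 from LinearMap.congr_fun h z
  refine packets_hom_ext₂ 𝒱 fun x x' => ?_
  have mem_deg := wordPacket_mem_packetDegree (𝕜 := 𝕜) 𝒱
  simp only [LinearMap.comp_apply, volte_wordPacket, leibnizLeft_wordPacket, map_add, map_smul,
    volte_tmul_of_mem (hm _ _ _ _ (mem_deg _) (mem_deg v)) (mem_deg _),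
    volte_tmul_of_mem (mem_deg _) (hm _ _ _ _ (mem_deg _) (mem_deg v)), smul_add, smul_smul]
  generalize wordDeg (letterDeg 𝒱) x = i, wordDeg (letterDeg 𝒱) x' = j,
    wordDeg (letterDeg 𝒱) v = k
  rw [add_comm]
  congr 2
  · simp only [commSign_add_right, commSign_comm i c]
    linear_combination (commSign 𝕜 i j * commSign 𝕜 i k) * commSign_mul_self (R := 𝕜) c i
  · simp only [commSign_add_left, commSign_comm k j]
    linear_combination (commSign 𝕜 i j * commSign 𝕜 c j) * commSign_mul_self (R := 𝕜) j k

include hm in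
theorem volte_leibnizRight (u : List (Letter 𝒱)) (z : Packets 𝒱 ⊗[𝕜] Packets 𝒱) :
    volte 𝒱 (leibnizRight c m (wordPacket 𝒱 u) z) =
      leibnizRight c m (wordPacket 𝒱 u) (volte 𝒱 z) := by
  suffices h : volte 𝒱 ∘ₗ leibnizRight c m (wordPacket 𝒱 u) =
      leibnizRight c m (wordPacket 𝒱 u) ∘ₗ volte 𝒱 from LinearMap.congr_fun h z
  refine packets_hom_ext₂ 𝒱 fun y y' => ?_
  have mem_deg := wordPacket_mem_packetDegree (𝕜 := 𝕜) 𝒱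
  simp only [LinearMap.comp_apply, volte_wordPacket, leibnizRight_wordPacket, map_add, map_smul,
    volte_tmul_of_mem (hm _ _ _ _ (mem_deg u) (mem_deg _)) (mem_deg _),
    volte_tmul_of_mem (mem_deg _) (hm _ _ _ _ (mem_deg u) (mem_deg _)), smul_add, smul_smul]
  generalize wordDeg (letterDeg 𝒱) y = i, wordDeg (letterDeg 𝒱) y' = j,
    wordDeg (letterDeg 𝒱) u = k
  rw [add_comm]
  congr 2
  · simp only [commSign_add_right, commSign_comm i c, commSign_comm i k]
    linear_combination commSign 𝕜 i j * (commSign 𝕜 c i ^ 2 * commSign_mul_self (R := 𝕜) k i +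
      commSign_mul_self (R := 𝕜) c i)
  · simp only [commSign_add_left]
    ring

end Leibniz

section Uniqueness

variable {𝕜 V : Type*} [Field 𝕜] [AddCommGroup V] [Module 𝕜 V] {𝒱 : ℤ → Submodule 𝕜 V}
  [DirectSum.Decomposition 𝒱] [CharZero 𝕜]

theorem map_cobracket_wordPacket_congr {M : Type*} [AddCommGroup M] [Module 𝕜 M]
    {f g : Packets 𝒱 ⊗[𝕜] Packets 𝒱 →ₗ[𝕜] M} {w : List (Letter 𝒱)}
    (h : ∀ x x' : List (Letter 𝒱), x.length < w.length → x'.length < w.length →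
      f (wordPacket 𝒱 x ⊗ₜ wordPacket 𝒱 x') = g (wordPacket 𝒱 x ⊗ₜ wordPacket 𝒱 x')) :
    f (cobracket 𝒱 (wordPacket 𝒱 w)) = g (cobracket 𝒱 (wordPacket 𝒱 w)) := by
  have eq_on_cut {x x' : List (Letter 𝒱)} (hx : x ++ x' = w) :
      f (wordPacket 𝒱 x ⊗ₜ wordPacket 𝒱 x') = g (wordPacket 𝒱 x ⊗ₜ wordPacket 𝒱 x') ∧
      f (wordPacket 𝒱 x' ⊗ₜ wordPacket 𝒱 x) = g (wordPacket 𝒱 x' ⊗ₜ wordPacket 𝒱 x) := by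
    subst hx
    rcases x with _ | ⟨a, x⟩
    · simp only [wordPacket_nil, TensorProduct.zero_tmul, TensorProduct.tmul_zero, map_zero,
        and_self]
    rcases x' with _ | ⟨b, x'⟩
    · simp only [wordPacket_nil, TensorProduct.zero_tmul, TensorProduct.tmul_zero, map_zero,
        and_self]
    constructor <;> refine h _ _ ?_ ?_ <;>
      simp only [List.length_append, List.length_cons] <;> omega
  rw [map_cobracket_wordPacket, map_cobracket_wordPacket]
  congr 1 <;> refine cutSum_congr fun x x' hx => ?_
  · exact (eq_on_cut hx).1
  · rw [(eq_on_cut hx).2]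

theorem eq_of_extends_of_isCompatible {c : ℤ} {l : V →ₗ[𝕜] V →ₗ[𝕜] V}
    {m m' : Packets 𝒱 ⊗[𝕜] Packets 𝒱 →ₗ[𝕜] Packets 𝒱} (he : Extends 𝒱 l m)
    (he' : Extends 𝒱 l m') (hc : IsCompatible 𝒱 c m) (hc' : IsCompatible 𝒱 c m') : m = m' := by
  refine packets_hom_ext₂ 𝒱 fun u v => ?_
  induction hN : u.length + v.length using Nat.strong_induction_on generalizing u v with
  | _ N ih =>
    subst hN
    rw [← sub_eq_zero]
    refine eq_zero_of_cobracket_eq_zero 𝒱 ?_ (by rw [map_sub, he, he', sub_self])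
    rw [map_sub, isCompatible_iff.1 hc, isCompatible_iff.1 hc', sub_eq_zero]
    congr 1 <;> refine map_cobracket_wordPacket_congr fun x x' hx hx' => ?_
    · rw [leibnizLeft_wordPacket, leibnizLeft_wordPacket, ih _ (by omega) x v rfl,
        ih _ (by omega) x' v rfl]
    · rw [leibnizRight_wordPacket, leibnizRight_wordPacket, ih _ (by omega) u x rfl,
        ih _ (by omega) u x' rfl]

end Uniqueness

section BoundaryCuts

variable {L M : Type*} [AddCommMonoid M] {γ : List L → List L → List L → List L → M}

theorem cutSum₂_eq_of_right (h : ∀ x a x' y b y', γ x (a :: x') y (b :: y') = 0) {u v : List L}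
    (h' : γ u [] v [] = 0) :
    cutSum₂ γ u v = cutSum (fun x x' => γ x x' v []) u + cutSum (fun y y' => γ u [] y y') v := by
  rw [cutSum₂]
  induction u generalizing γ with
  | nil => rw [cutSum, cutSum, h', zero_add]
  | cons a u ih =>
    rw [cutSum, cutSum, ih (γ := fun x => γ (a :: x)) (fun x => h _) h', add_assoc,
      cutSum_eq_of_right fun y b y' => h _ _ _ _ _ _]

theorem cutSum₂_eq_of_left (h : ∀ a x x' b y y', γ (a :: x) x' (b :: y) y' = 0) {u v : List L}
    (h' : γ [] u [] v = 0) :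
    cutSum₂ γ u v = cutSum (fun x x' => γ x x' [] v) u + cutSum (fun y y' => γ [] u y y') v := by
  cases u with
  | nil => rw [cutSum₂, cutSum, cutSum, h', zero_add]
  | cons a u =>
    rw [cutSum₂, cutSum, cutSum, h', zero_add, add_comm]
    congr 1
    exact cutSum_congr fun x x' _ => cutSum_eq_of_left (fun b y y' => h _ _ _ _ _ _) v

end BoundaryCuts

section Compatibility

variable {𝕜 V : Type*} [Field 𝕜] [AddCommGroup V] [Module 𝕜 V] {𝒱 : ℤ → Submodule 𝕜 V}

theorem map_packetOf_deconcat_word (w : List (Letter 𝒱)) :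
    TensorProduct.map (packetOf 𝒱) (packetOf 𝒱) (deconcat (word 𝕜 w)) =
      cutSum (fun x x' => wordPacket 𝒱 x ⊗ₜ[𝕜] wordPacket 𝒱 x') w := by
  simp only [deconcat_word, map_cutSum, TensorProduct.map_tmul, packetOf_word]

variable [DirectSum.Decomposition 𝒱]

variable {c : ℤ} {l : V →ₗ[𝕜] V →ₗ[𝕜] V}
  (hl : ∀ {i j : ℤ} {u v : V}, u ∈ 𝒱 i → v ∈ 𝒱 j → l u v ∈ 𝒱 (i + j + c))

theorem map_packetOf_bracketCut (x x' y y' : List (Letter 𝒱)) :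
    TensorProduct.map (packetOf 𝒱) (packetOf 𝒱)
        (bracketCut 𝕜 (letterDeg 𝒱) c (letterBracket hl) x x' y y') =
      commSign 𝕜 (wordDeg (letterDeg 𝒱) x') (wordDeg (letterDeg 𝒱) y) •
        (packetBracket hl (wordPacket 𝒱 x ⊗ₜ wordPacket 𝒱 y) ⊗ₜ[𝕜]
          packetOf 𝒱 (shuffle (letterDeg 𝒱) (word 𝕜 x') (word 𝕜 y'))) +
      (commSign 𝕜 (wordDeg (letterDeg 𝒱) x') (wordDeg (letterDeg 𝒱) y) *
        commSign 𝕜 c (wordDeg (letterDeg 𝒱) x + wordDeg (letterDeg 𝒱) y)) •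
        (packetOf 𝒱 (shuffle (letterDeg 𝒱) (word 𝕜 x) (word 𝕜 y)) ⊗ₜ[𝕜]
          packetBracket hl (wordPacket 𝒱 x' ⊗ₜ wordPacket 𝒱 y')) := by
  simp only [bracketCut, map_smul, map_add, TensorProduct.map_tmul, packetBracket_wordPacket,
    smul_add, smul_smul]

variable [CharZero 𝕜]

theorem cobracket_packetOf (t : Words 𝕜 (Letter 𝒱)) :
    cobracket 𝒱 (packetOf 𝒱 t) =
      TensorProduct.map (packetOf 𝒱) (packetOf 𝒱) (deconcat t) -
        volte 𝒱 (TensorProduct.map (packetOf 𝒱) (packetOf 𝒱) (deconcat t)) := by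
  suffices h : cobracket 𝒱 ∘ₗ packetOf 𝒱 = (LinearMap.id - volte 𝒱) ∘ₗ
      TensorProduct.map (packetOf 𝒱) (packetOf 𝒱) ∘ₗ deconcat from LinearMap.congr_fun h t
  refine words_hom_ext fun w => ?_
  simp only [LinearMap.comp_apply, LinearMap.sub_apply, LinearMap.id_apply, packetOf_word,
    cobracket_wordPacket, map_packetOf_deconcat_word]

-- Proper shuffles vanish in packets: only the cuts leaving one of the two words whole survive.
theorem map_packetOf_deconcat_wordBracket (u v : List (Letter 𝒱)) :
    TensorProduct.map (packetOf 𝒱) (packetOf 𝒱) (deconcat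
      (wordBracket (letterDeg 𝒱) c (letterBracket hl) (word 𝕜 u) (word 𝕜 v))) =
      leibnizLeft c (packetBracket hl) (wordPacket 𝒱 v)
        (TensorProduct.map (packetOf 𝒱) (packetOf 𝒱) (deconcat (word 𝕜 u))) +
      leibnizRight c (packetBracket hl) (wordPacket 𝒱 u)
        (TensorProduct.map (packetOf 𝒱) (packetOf 𝒱) (deconcat (word 𝕜 v))) := by
  simp only [deconcat_wordBracket, map_cutSum₂, map_packetOf_bracketCut, cutSum₂_add,
    map_packetOf_deconcat_word, map_cutSum, leibnizLeft_wordPacket, leibnizRight_wordPacket,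
    cutSum_add]
  rw [cutSum₂_eq_of_right, cutSum₂_eq_of_left]
  · simp only [shuffle_nil_left, shuffle_nil_right, packetOf_word, wordDeg_nil,
      commSign_zero_left, commSign_zero_right, one_smul, one_mul, add_zero, zero_add]
    abel
  · intro a x x' b y y'
    rw [packetOf_shuffle_eq_zero, TensorProduct.zero_tmul, smul_zero]
  · rw [shuffle_nil_left, packetOf_word, wordPacket_nil, TensorProduct.zero_tmul, smul_zero]
  · intro x a x' y b y'
    rw [packetOf_shuffle_eq_zero, TensorProduct.tmul_zero, smul_zero]
  · rw [shuffle_nil_left, packetOf_word, wordPacket_nil, TensorProduct.tmul_zero, smul_zero]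

theorem isCompatible_packetBracket :
    IsCompatible 𝒱 c (packetBracket (𝒱 := 𝒱) (c := c) (l := l) hl) := by
  have hd := isOfDegree_packetBracket (𝒱 := 𝒱) (c := c) (l := l) hl
  refine isCompatible_iff.2 fun u v => ?_
  rw [packetBracket_wordPacket, cobracket_packetOf, map_packetOf_deconcat_wordBracket, map_add,
    volte_leibnizLeft hd, volte_leibnizRight hd, ← packetOf_word, ← packetOf_word,
    cobracket_packetOf, cobracket_packetOf, map_sub, map_sub]
  abel

end Compatibility

section Formula

variable {𝕜 V : Type*} [Field 𝕜] [AddCommGroup V] [Module 𝕜 V] {𝒱 : ℤ → Submodule 𝕜 V}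
  [DirectSum.Decomposition 𝒱] {c : ℤ} {l : V →ₗ[𝕜] V →ₗ[𝕜] V}
  (hl : ∀ {i j : ℤ} {u v : V}, u ∈ 𝒱 i → v ∈ 𝒱 j → l u v ∈ 𝒱 (i + j + c))

theorem packetBracket_packet {p q : ℕ} {α : Fin (p + 1 + (q + 1)) → V}
    {d : Fin (p + 1 + (q + 1)) → ℤ} (hα : ∀ i, α i ∈ 𝒱 (d i)) :
    packetBracket hl (packet 𝒱 (fun i : Fin (p + 1) => α (Fin.castAdd (q + 1) i)) ⊗ₜ[𝕜]
        packet 𝒱 (fun j : Fin (q + 1) => α (Fin.natAdd (p + 1) j))) =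
      ∑ σ ∈ battements (p + 1 + (q + 1)) (p + 1),
        ∑ k : Fin (p + 1 + q) with
            (σ.symm k.castSucc).val < p + 1 ∧ p + 1 ≤ (σ.symm k.succ).val,
          (((koszulSign d σ *
            (c * ∑ s with s < k.castSucc, d (σ.symm s)).negOnePow : ℤˣ) : ℤ) : 𝕜) •
          packet 𝒱 (Fin.contractNth k.castSucc (fun u v => l u v) (fun i => α (σ.symm i))) := by
  let w : Fin (p + 1 + q + 1) → Letter 𝒱 := fun i => ⟨d i, α i, hα i⟩
  have take_eq : (List.ofFn w).take (p + 1) =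
      List.ofFn fun i : Fin (p + 1) => w (Fin.castAdd (q + 1) i) :=
    List.ext_getElem (by simp [-List.ofFn_succ]; omega) fun i _ _ => by simp [-List.ofFn_succ]
  have drop_eq : (List.ofFn w).drop (p + 1) =
      List.ofFn fun j : Fin (q + 1) => w (Fin.natAdd (p + 1) j) :=
    List.ext_getElem (by simp [-List.ofFn_succ]; omega) fun i _ _ => by simp [-List.ofFn_succ]
  have packet_left := wordPacket_ofFn 𝒱 fun i : Fin (p + 1) => w (Fin.castAdd (q + 1) i)
  have packet_right := wordPacket_ofFn 𝒱 fun j : Fin (q + 1) => w (Fin.natAdd (p + 1) j)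
  have formula := packetOf_wordBracket_ofFn hl (p := p + 1) (by omega) w
  rw [take_eq, drop_eq, ← packetBracket_wordPacket, packet_left, packet_right] at formula
  exact formula

end Formula

theorem DiffABAlgebra.shiftedBracket_mem {𝕜 A : Type*} [Field 𝕜] [AddCommGroup A]
    [Module 𝕜 A] {𝒜 : ℤ → Submodule 𝕜 A} [DirectSum.Decomposition 𝒜] {a b : ℤ}
    (S : DiffABAlgebra 𝒜 a b) {i j : ℤ} {u v : A} (hu : u ∈ shifted 𝒜 a i)
    (hv : v ∈ shifted 𝒜 a j) : S.shiftedBracket u v ∈ shifted 𝒜 a (i + j + (b - a + 1)) := by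
  have degree_eq : i + (-a + 1) + (j + (-a + 1)) + b = i + j + (b - a + 1) + (-a + 1) := by ring
  rw [shiftedBracket, LinearMap.comp_apply, signTwist_of_mem (shifted 𝒜 a) _ hu, Units.smul_def,
    map_zsmul, LinearMap.smul_apply, shifted, shift, ← degree_eq]
  exact zsmul_mem (S.bracket_mem hu hv) _

end ABAlgebra

theorem proposition4p1_general {𝕜 V : Type*} [Field 𝕜] [CharZero 𝕜] [AddCommGroup V]
    [Module 𝕜 V] (𝒱 : ℤ → Submodule 𝕜 V) [DirectSum.Decomposition 𝒱] (c : ℤ)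
    (l : V →ₗ[𝕜] V →ₗ[𝕜] V)
    (hl : ∀ {i j : ℤ} {u v : V}, u ∈ 𝒱 i → v ∈ 𝒱 j → l u v ∈ 𝒱 (i + j + c)) :
    (∃! m : Packets 𝒱 ⊗[𝕜] Packets 𝒱 →ₗ[𝕜] Packets 𝒱,
      Extends 𝒱 l m ∧ IsCompatible 𝒱 c m) ∧
    ∀ m : Packets 𝒱 ⊗[𝕜] Packets 𝒱 →ₗ[𝕜] Packets 𝒱,
      Extends 𝒱 l m → IsCompatible 𝒱 c m → IsOfDegree 𝒱 c m ∧
      ∀ (p q : ℕ) (α : Fin (p + 1 + (q + 1)) → V) (d : Fin (p + 1 + (q + 1)) → ℤ),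
        (∀ i, α i ∈ 𝒱 (d i)) →
        m (packet 𝒱 (fun i : Fin (p + 1) => α (Fin.castAdd (q + 1) i)) ⊗ₜ[𝕜]
            packet 𝒱 (fun j : Fin (q + 1) => α (Fin.natAdd (p + 1) j))) =
          ∑ σ ∈ battements (p + 1 + (q + 1)) (p + 1),
            ∑ k : Fin (p + 1 + q) with
                (σ.symm k.castSucc).val < p + 1 ∧ p + 1 ≤ (σ.symm k.succ).val,
              (((koszulSign d σ *
                (c * ∑ s with s < k.castSucc, d (σ.symm s)).negOnePow : ℤˣ) : ℤ) : 𝕜) •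
              packet 𝒱 (Fin.contractNth k.castSucc (fun u v => l u v)
                (fun i => α (σ.symm i))) := by
  have extends_l : Extends 𝒱 l (packetBracket hl) := extends_packetBracket hl
  have compatible : IsCompatible 𝒱 c (packetBracket hl) := isCompatible_packetBracket hl
  refine ⟨⟨packetBracket hl, ⟨extends_l, compatible⟩, fun m hm =>
    eq_of_extends_of_isCompatible hm.1 extends_l hm.2 compatible⟩, fun m he hc => ?_⟩
  rw [eq_of_extends_of_isCompatible he extends_l hc compatible]
  exact ⟨isOfDegree_packetBracket hl, fun p q α d hα => packetBracket_packet hl hα⟩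

theorem proposition4p1 {𝕜 A : Type*} [Field 𝕜] [CharZero 𝕜] [AddCommGroup A] [Module 𝕜 A]
    (𝒜 : ℤ → Submodule 𝕜 A) [DirectSum.Decomposition 𝒜] (a b : ℤ) (S : DiffABAlgebra 𝒜 a b) :
    (∃! ℓ₂ : HSpace 𝒜 a ⊗[𝕜] HSpace 𝒜 a →ₗ[𝕜] HSpace 𝒜 a,
      IsOfDegree (shifted 𝒜 a) (b - a + 1) ℓ₂ ∧
      Extends (shifted 𝒜 a) S.shiftedBracket ℓ₂ ∧
      IsCompatible (shifted 𝒜 a) (b - a + 1) ℓ₂) ∧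
    ∀ ℓ₂ : HSpace 𝒜 a ⊗[𝕜] HSpace 𝒜 a →ₗ[𝕜] HSpace 𝒜 a,
      IsOfDegree (shifted 𝒜 a) (b - a + 1) ℓ₂ →
      Extends (shifted 𝒜 a) S.shiftedBracket ℓ₂ →
      IsCompatible (shifted 𝒜 a) (b - a + 1) ℓ₂ →
      -- `X` has `p + 1` letters and `Y` has `q + 1` letters; `k` stands for the positions `k, k+1`
      ∀ (p q : ℕ) (α : Fin (p + 1 + (q + 1)) → A) (d : Fin (p + 1 + (q + 1)) → ℤ),
        (∀ i, α i ∈ shifted 𝒜 a (d i)) →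
        ℓ₂ (packet (shifted 𝒜 a) (fun i : Fin (p + 1) => α (Fin.castAdd (q + 1) i)) ⊗ₜ[𝕜]
            packet (shifted 𝒜 a) (fun j : Fin (q + 1) => α (Fin.natAdd (p + 1) j))) =
          ∑ σ ∈ battements (p + 1 + (q + 1)) (p + 1),
            ∑ k : Fin (p + 1 + q) with
                (σ.symm k.castSucc).val < p + 1 ∧ p + 1 ≤ (σ.symm k.succ).val,
              (((koszulSign d σ *
                ((b - a + 1) * ∑ s with s < k.castSucc, d (σ.symm s)).negOnePow : ℤˣ) : ℤ) : 𝕜) •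
              packet (shifted 𝒜 a)
                (Fin.contractNth k.castSucc (fun u v => S.shiftedBracket u v)
                  (fun i => α (σ.symm i))) := by
  obtain ⟨⟨m, ⟨he, hc⟩, hu⟩, h⟩ :=
    proposition4p1_general (shifted 𝒜 a) (b - a + 1) S.shiftedBracket S.shiftedBracket_mem
  exact ⟨⟨m, ⟨(h m he hc).1, he, hc⟩, fun m' hm' => hu m' hm'.2⟩,
    fun m' _ he' hc' => (h m' he' hc').2⟩
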